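/- Let $\Omega=(a,b)$ be a bounded interval, $T>0$, $\alpha\ge 0$, $\beta\ge -1$, $\alpha^*:=\min\{\alpha,1+\beta\}$, and let $E_0,E_1,\omega_0,\omega_1$ be real functions independent of $\varepsilon$. For every $\varepsilon\in(0,1]$ let the following be classical solutions ($C^2$ on $\overline\Omega\times[0,T]$), with homogeneous Dirichlet boundary conditions at $x=a,b$: - $G^\varepsilon$ of $\partial_{tt}G-\varepsilon^{-2}\partial_{xx}G=0$, $G(x,0)=\varepsilon^\alpha\omega_0(x)$, $\partial_tG(x,0)=\varepsilon^\beta\omega_1(x)$; - $(E^\varepsilon,F^\varepsilon)$ of the (reformulated) Klein-Gordon-Zakharov system $\partial_{tt}E-\partial_{xx}E+(1-E^2+F+G^\varepsilon)E=0$, $\partial_{tt}F-\varepsilon^{-2}\partial_{xx}F-\partial_{tt}|E|^2=0$, with $E(x,0)=E_0$, $\partial_tE(x,0)=E_1$, $F(x,0)=\partial_tF(x,0)=0$; - $\widetilde E^\varepsilon$ of the Klein-Gordon equation with oscillatory potential $\partial_{tt}\widetilde E-\partial_{xx}\widetilde E+(1-\widetilde E^2+G^\varepsilon)\widetilde E=0$,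 $\widetilde E(x,0)=E_0$, $\partial_t\widetilde E(x,0)=E_1$. Assume (A): $E^\varepsilon,F^\varepsilon,\widetilde E^\varepsilon$ are three times continuously differentiable in $t$, and, with a constant independent of $\varepsilon\in(0,1]$ and $t\in[0,T]$, $$\|E^\varepsilon\|_{W^{4,\infty}(\Omega)}+\|\partial_tE^\varepsilon\|_{W^{2,\infty}(\Omega)}+\|\partial_{tt}E^\varepsilon\|_{W^{2,\infty}(\Omega)}+\varepsilon\|\partial_t^3E^\varepsilon\|_{W^{2,\infty}(\Omega)}\lesssim 1,$$ $$\|\widetilde E^\varepsilon\|_{W^{4,\infty}(\Omega)}+\|\partial_t\widetilde E^\varepsilon\|_{W^{2,\infty}(\Omega)}+\|\partial_{tt}\widetilde E^\varepsilon\|_{W^{2,\infty}(\Omega)}\lesssim 1,\qquad \|\partial_t^3\widetilde E^\varepsilon\|_{L^\infty(\Omega)}\lesssim \max\{1,\varepsilon^{\alpha^*-1}\},$$ $$\|F^\varepsilon\|_{W^{4,\infty}(\Omega)}\lesssim\varepsilon,\qquad \|\partial_tF^\varepsilon\|_{W^{4,\infty}(\Omega)}+\|\partial_{tt}F^\varepsilon\|_{W^{2,\infty}(\Omega)}+\varepsilon\|\partial_t^3F^\varepsilon\|_{W^{2,\infty}(\Omega)}\lesssim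 1;$$ and (B): $E_0,E_1\in W^{5,\infty}(\Omega)$, $\omega_0,\omega_1\in W^{3,\infty}(\Omega)$. Let $\rho\in C^\infty(\mathbb R)$ with $\rho(s)=1$ for $|s|\le1$, $\rho(s)\in[0,1]$ for $|s|\le 2$, $\rho(s)=0$ for $|s|\ge2$. Put $B=M_0+1$, where $M_0$ is the supremum of $|E^\varepsilon|$ and $|\widetilde E^\varepsilon|$ over $\Omega\times[0,T]$ and $\varepsilon\in(0,1]$, and $\rho_B(s)=s^2\rho(s/B)$, $g(y_1,y_2)=\frac12\int_0^1\rho_B'(sy_1+(1-s)y_2)\,ds$. For a positive integer $M$ and $\tau>0$ put $h=(b-a)/M$, $x_j=a+jh$, $t_k=k\tau$ and $H_j^{\varepsilon,k}=\int_{-1}^1(1-|s|)G^\varepsilon(x_j,t_k+s\tau)\,ds$. Write $\delta_x^+v_j=(v_{j+1}-v_j)/h$, $\delta_x^2v_j=(v_{j+1}-2v_j+v_{j-1})/h^2$, $\delta_t^2v^k=(v^{k+1}-2v^k+v^{k-1})/\tau^2$. The cut-off scheme is, for $1\le j\le M-1$ and $1\le k\le T/\tau-1$, $$\delta_t^2\hat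 E_j^{k}=(\delta_x^2-1-H_j^{\varepsilon,k})\frac{\hat E_j^{k+1}+\hat E_j^{k-1}}2+\big(\rho_B(\hat E_j^k)-\hat F_j^k\big)\,g(\hat E_j^{k+1},\hat E_j^{k-1}),$$ $$\delta_t^2\hat F_j^k=\frac1{2\varepsilon^2}\delta_x^2(\hat F_j^{k+1}+\hat F_j^{k-1})+\delta_t^2\rho_B(\hat E_j^k),$$ with $\hat E^k_0=\hat E^k_M=\hat F^k_0=\hat F^k_M=0$, $\hat E_j^0=E_0(x_j)$, $\hat F_j^0=0$, and, for $1\le j\le M-1$, $\hat E_j^1=E_0(x_j)+\tau E_1(x_j)+\frac{\tau^2}2\kappa(x_j)$, $\hat F_j^1=\frac{\tau^2}2\big(2E_1(x_j)^2+2E_0(x_j)\kappa(x_j)\big)$, where $\kappa=E_0''-E_0-(-E_0^2+\varepsilon^\alpha\omega_0)E_0$. The errors are $\hat e^k_j=E^\varepsilon(x_j,t_k)-\hat E_j^k$ and $\hat f_j^k=F^\varepsilon(x_j,t_k)-\hat F_j^k$, and $\|v\|^2=h\sum_{j=1}^{M-1}|v_j|^2$, $\|\delta_x^+v\|^2=h\sum_{j=0}^{M-1}|\delta_x^+v_j|^2$.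 Then there exist $\tau_2>0$ and $C>0$, independent of $\varepsilon$, $\tau$ and $h$, such that for all $\varepsilon\in(0,1]$, $0<\tau\le\tau_2$ and $0<h=(b-a)/M\le\frac12$ the scheme has a solution up to time $T$, and every solution satisfies $$\|\hat e^{k}\|+\|\delta_x^+\hat e^{k}\|+\|\hat f^{k}\|\le C\big(h^2+\tau^2+\tau\varepsilon^{\alpha^*}+\varepsilon\big),\qquad 0\le k\le \frac T\tau .$$ -/

import Mathlib

namespace KGZ

open Set MeasureTheory
open scoped ENNReal NNReal ContDiff

noncomputable section

/-! Functions of space and time are written `u x t`, on `Ω = (a, b)` and `[0, T]`. -/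

/-- The `n`-th time derivative of `u` on `[0, T]` (one-sided at the end points). -/
def dt (T : ℝ) (n : ℕ) (u : ℝ → ℝ → ℝ) (x t : ℝ) : ℝ :=
  iteratedDerivWithin n (fun s => u x s) (Icc 0 T) t

/-- The `n`-th space derivative of `u` on `[a, b]` (one-sided at the end points). -/
def dx (a b : ℝ) (n : ℕ) (u : ℝ → ℝ → ℝ) (x t : ℝ) : ℝ :=
  iteratedDerivWithin n (fun y => u y t) (Icc a b) x

/-- `w` is the weak (distributional) derivative of order `i` of `v` on `(a, b)`. -/
def IsWeakDeriv (a b : ℝ) (i : ℕ) (v w : ℝ → ℝ) : Prop :=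
  LocallyIntegrableOn v (Ioo a b) ∧ LocallyIntegrableOn w (Ioo a b) ∧
    ∀ φ : ℝ → ℝ, ContDiff ℝ ∞ φ → HasCompactSupport φ → tsupport φ ⊆ Ioo a b →
      ∫ x in Ioo a b, v x * iteratedDeriv i φ x = (-1) ^ i * ∫ x in Ioo a b, w x * φ x

/-- The norm of `L^∞(a, b)`. -/
def LinftyNorm (a b : ℝ) (v : ℝ → ℝ) : ℝ≥0∞ :=
  eLpNorm v ⊤ (volume.restrict (Ioo a b))

/-- The norm of the Sobolev space `W^{m,∞}(a, b)`; it is `∞` if `v` is not in that space. -/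
def sobolevNorm (a b : ℝ) (m : ℕ) (v : ℝ → ℝ) : ℝ≥0∞ :=
  ⨅ (w : ℕ → ℝ → ℝ) (_ : ∀ i ≤ m, IsWeakDeriv a b i v (w i)),
    ∑ i ∈ Finset.range (m + 1), LinftyNorm a b (w i)

/-- Twice continuously differentiable on `[a, b] × [0, T]`. -/
def IsC2 (a b T : ℝ) (u : ℝ → ℝ → ℝ) : Prop :=
  ContDiffOn ℝ 2 (fun p : ℝ × ℝ => u p.1 p.2) (Icc a b ×ˢ Icc 0 T)

/-- Homogeneous Dirichlet boundary condition. -/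
def Dirichlet (a b T : ℝ) (u : ℝ → ℝ → ℝ) : Prop :=
  ∀ t ∈ Icc 0 T, u a t = 0 ∧ u b t = 0

/-- `G` is the initial-layer solution of the linear wave equation with speed `1 / ε`. -/
structure IsWaveSolution (a b T α β ε : ℝ) (ω₀ ω₁ : ℝ → ℝ) (G : ℝ → ℝ → ℝ) : Prop where
  regular : IsC2 a b T G
  pde : ∀ x ∈ Ioo a b, ∀ t ∈ Ioc 0 T,
    dt T 2 G x t - 1 / ε ^ 2 * dx a b 2 G x t = 0
  init : ∀ x ∈ Icc a b, G x 0 = ε ^ α * ω₀ x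
  init_dt : ∀ x ∈ Icc a b, dt T 1 G x 0 = ε ^ β * ω₁ x
  boundary : Dirichlet a b T G

/-- `(E, F)` solves the Klein-Gordon-Zakharov system in its asymptotic consistent form. -/
structure IsKGZSolution (a b T ε : ℝ) (E₀ E₁ : ℝ → ℝ) (G E F : ℝ → ℝ → ℝ) : Prop where
  regular_E : IsC2 a b T E
  regular_F : IsC2 a b T F
  pde_E : ∀ x ∈ Ioo a b, ∀ t ∈ Ioc 0 T,
    dt T 2 E x t - dx a b 2 E x t + (1 - E x t ^ 2 + F x t + G x t) * E x t = 0
  pde_F : ∀ x ∈ Ioo a b, ∀ t ∈ Ioc 0 T,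
    dt T 2 F x t - 1 / ε ^ 2 * dx a b 2 F x t - dt T 2 (fun y s => |E y s| ^ 2) x t = 0
  init_E : ∀ x ∈ Icc a b, E x 0 = E₀ x
  init_dt_E : ∀ x ∈ Icc a b, dt T 1 E x 0 = E₁ x
  init_F : ∀ x ∈ Icc a b, F x 0 = 0
  init_dt_F : ∀ x ∈ Icc a b, dt T 1 F x 0 = 0
  boundary_E : Dirichlet a b T E
  boundary_F : Dirichlet a b T F

/-- `E` solves the Klein-Gordon equation with the oscillatory potential `G` (KG-OP). -/
structure IsKGOPSolution (a b T : ℝ) (E₀ E₁ : ℝ → ℝ) (G E : ℝ → ℝ → ℝ) : Prop where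
  regular : IsC2 a b T E
  pde : ∀ x ∈ Ioo a b, ∀ t ∈ Ioc 0 T,
    dt T 2 E x t - dx a b 2 E x t + (1 - E x t ^ 2 + G x t) * E x t = 0
  init : ∀ x ∈ Icc a b, E x 0 = E₀ x
  init_dt : ∀ x ∈ Icc a b, dt T 1 E x 0 = E₁ x
  boundary : Dirichlet a b T E

/-- The exponent `α* = min {α, 1 + β}`. -/
def alphaStar (α β : ℝ) : ℝ := min α (1 + β)

/-- The norm of `W^{m,∞}(Ω)` of the `i`-th time derivative of `u` at time `t`. -/
def dtNorm (a b T : ℝ) (i m : ℕ) (u : ℝ → ℝ → ℝ) (t : ℝ) : ℝ≥0∞ :=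
  sobolevNorm a b m (fun x => dt T i u x t)

/-- Three times continuously differentiable in time, so that the time derivatives whose norms
are bounded in assumption (A) are classical ones. -/
def IsC3InTime (a b T : ℝ) (u : ℝ → ℝ → ℝ) : Prop :=
  ∀ x ∈ Icc a b, ContDiffOn ℝ 3 (fun t => u x t) (Icc 0 T)

/-- Assumption (A): smoothness of the families of solutions, and bounds uniform in
`ε ∈ (0, 1]` and `t ∈ [0, T]`. The bound on the third time derivative of `E'` is
`ε ^ (α* - 1)` for `α* ≤ 1`, and `1` for `α* > 1`. -/
def AssumptionA (a b T α β : ℝ) (E F E' : ℝ → ℝ → ℝ → ℝ) : Prop :=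
  (∀ ε ∈ Ioc (0 : ℝ) 1,
    IsC3InTime a b T (E ε) ∧ IsC3InTime a b T (F ε) ∧ IsC3InTime a b T (E' ε)) ∧
  ∃ C : ℝ≥0, ∀ ε ∈ Ioc (0 : ℝ) 1, ∀ t ∈ Icc (0 : ℝ) T,
    dtNorm a b T 0 4 (E ε) t + dtNorm a b T 1 2 (E ε) t + dtNorm a b T 2 2 (E ε) t
        + ENNReal.ofReal ε * dtNorm a b T 3 2 (E ε) t ≤ C ∧
    dtNorm a b T 0 4 (E' ε) t + dtNorm a b T 1 2 (E' ε) t + dtNorm a b T 2 2 (E' ε) t ≤ C ∧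
    LinftyNorm a b (fun x => dt T 3 (E' ε) x t)
      ≤ C * ENNReal.ofReal (max 1 (ε ^ (alphaStar α β - 1))) ∧
    dtNorm a b T 0 4 (F ε) t ≤ C * ENNReal.ofReal ε ∧
    dtNorm a b T 1 4 (F ε) t + dtNorm a b T 2 2 (F ε) t
        + ENNReal.ofReal ε * dtNorm a b T 3 2 (F ε) t ≤ C

/-- Assumption (B) on the initial data, which do not depend on `ε`. -/
def AssumptionB (a b : ℝ) (E₀ E₁ ω₀ ω₁ : ℝ → ℝ) : Prop :=
  sobolevNorm a b 5 E₀ + sobolevNorm a b 5 E₁ + sobolevNorm a b 3 ω₀ + sobolevNorm a b 3 ω₁ < ⊤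

/-- The larger of the suprema of `|E^ε|` and of `|E'^ε|` over `Ω × [0, T]` and `ε ∈ (0, 1]`
(a supremum of a bounded set under assumption (A)). -/
def supBound (a b T : ℝ) (E E' : ℝ → ℝ → ℝ → ℝ) : ℝ :=
  sSup {r | ∃ ε ∈ Ioc (0 : ℝ) 1, ∃ x ∈ Ioo a b, ∃ t ∈ Icc 0 T, r = |E ε x t| ∨ r = |E' ε x t|}

/-- A smooth cut-off function, equal to `1` on `[-1, 1]` and to `0` outside `(-2, 2)`. -/
structure IsCutoff (ρ : ℝ → ℝ) : Prop where
  smooth : ContDiff ℝ ∞ ρ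
  eq_one : ∀ s, |s| ≤ 1 → ρ s = 1
  mem_Icc : ∀ s, |s| ≤ 2 → ρ s ∈ Icc (0 : ℝ) 1
  eq_zero : ∀ s, 2 ≤ |s| → ρ s = 0

/-- The truncated square `ρ_B(s) = s² ρ(s / B)`. -/
def rhoB (ρ : ℝ → ℝ) (B s : ℝ) : ℝ := s ^ 2 * ρ (s / B)

/-- `g(y₁, y₂) = (1/2) ∫₀¹ ρ_B'(s y₁ + (1 - s) y₂) ds`. -/
def gB (ρ : ℝ → ℝ) (B y₁ y₂ : ℝ) : ℝ :=
  1 / 2 * ∫ s in (0 : ℝ)..1, deriv (rhoB ρ B) (s * y₁ + (1 - s) * y₂)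

/-! Grid functions are written `u k j`: time level `k`, space index `j ∈ {0, …, M}`. -/

/-- Mesh size. -/
def mesh (a b : ℝ) (M : ℕ) : ℝ := (b - a) / M

/-- Grid point `x_j = a + j h`. -/
def node (a b : ℝ) (M j : ℕ) : ℝ := a + j * mesh a b M

/-- Forward difference in space. -/
def dxPlus (h : ℝ) (v : ℕ → ℝ) (j : ℕ) : ℝ := (v (j + 1) - v j) / h

/-- Second central difference in space (used for `j ≥ 1`). -/
def dxx (h : ℝ) (v : ℕ → ℝ) (j : ℕ) : ℝ := (v (j + 1) - 2 * v j + v (j - 1)) / h ^ 2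

/-- Second central difference in time (used for `k ≥ 1`). -/
def dtt (τ : ℝ) (u : ℕ → ℕ → ℝ) (k j : ℕ) : ℝ :=
  (u (k + 1) j - 2 * u k j + u (k - 1) j) / τ ^ 2

/-- Average over the time levels `k + 1` and `k - 1` (used for `k ≥ 1`). -/
def avg (u : ℕ → ℕ → ℝ) (k j : ℕ) : ℝ := (u (k + 1) j + u (k - 1) j) / 2

/-- The discrete `L²` norm over the interior grid points. -/
def gridNorm (h : ℝ) (M : ℕ) (v : ℕ → ℝ) : ℝ :=
  Real.sqrt (h * ∑ j ∈ Finset.Ico 1 M, |v j| ^ 2)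

/-- The discrete `L²` norm of the forward difference. -/
def gridGradNorm (h : ℝ) (M : ℕ) (v : ℕ → ℝ) : ℝ :=
  Real.sqrt (h * ∑ j ∈ Finset.range M, |dxPlus h v j| ^ 2)

/-- The averaged oscillatory potential at the grid point `x` and the time level `k`. -/
def avgPotential (τ : ℝ) (G : ℝ → ℝ → ℝ) (x : ℝ) (k : ℕ) : ℝ :=
  ∫ s in (-1 : ℝ)..1, (1 - |s|) * G x (k * τ + s * τ)

/-- The second time derivative of `E` at time `0`, from the equation and
`N(x, 0) = -E₀(x)² + ε ^ α ω₀(x)`. -/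
def initDttE (α ε : ℝ) (E₀ ω₀ : ℝ → ℝ) (x : ℝ) : ℝ :=
  iteratedDeriv 2 E₀ x - E₀ x - (-E₀ x ^ 2 + ε ^ α * ω₀ x) * E₀ x

/-- The second time derivative of `F` at time `0`, from the equation. -/
def initDttF (α ε : ℝ) (E₀ E₁ ω₀ : ℝ → ℝ) (x : ℝ) : ℝ :=
  2 * E₁ x ^ 2 + 2 * E₀ x * initDttE α ε E₀ ω₀ x

/-- `(U, V)` (approximating `(E, F)`) is produced by the finite difference scheme with cut-off
`ρ_B`, at the time levels `k ≤ T / τ`. -/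
structure IsCutoffScheme (a b T α ε τ : ℝ) (M : ℕ) (ρ : ℝ → ℝ) (B : ℝ)
    (E₀ E₁ ω₀ : ℝ → ℝ) (G : ℝ → ℝ → ℝ) (U V : ℕ → ℕ → ℝ) : Prop where
  boundary : ∀ k, U k 0 = 0 ∧ U k M = 0 ∧ V k 0 = 0 ∧ V k M = 0
  init : ∀ j ≤ M, U 0 j = E₀ (node a b M j) ∧ V 0 j = 0
  first : ∀ j ∈ Finset.Ico 1 M,
    U 1 j = E₀ (node a b M j) + τ * E₁ (node a b M j)
      + τ ^ 2 / 2 * initDttE α ε E₀ ω₀ (node a b M j) ∧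
    V 1 j = τ ^ 2 / 2 * initDttF α ε E₀ E₁ ω₀ (node a b M j)
  step : ∀ k : ℕ, 1 ≤ k → ((k + 1 : ℕ) : ℝ) ≤ T / τ → ∀ j ∈ Finset.Ico 1 M,
    dtt τ U k j = dxx (mesh a b M) (avg U k) j - avg U k j
      - avgPotential τ G (node a b M j) k * avg U k j
      + (rhoB ρ B (U k j) - V k j) * gB ρ B (U (k + 1) j) (U (k - 1) j) ∧
    dtt τ V k j = 1 / ε ^ 2 * dxx (mesh a b M) (avg V k) j
      + dtt τ (fun l i => rhoB ρ B (U l i)) k j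

/-- The error at the time level `k`: exact solution at the grid points minus grid function. -/
def gridError (a b τ : ℝ) (M : ℕ) (u : ℝ → ℝ → ℝ) (U : ℕ → ℕ → ℝ) (k j : ℕ) : ℝ :=
  u (node a b M j) (k * τ) - U k j

end

end KGZ

open KGZ

/-!
The comparison functions are `E` for `Ê`, and `0` for `F̂`: since `F = O(ε)`, the error of size `ε`
that the theorem allows lets the wave part be treated as if its exact solution were zero. With
`e = E - Ê`, `f = -F̂` and `p = ρ_B(E) - ρ_B(Ê)`, the difference `q = f - p` satisfies a discrete wave
equation whose residual, the second difference quotient of `E²`, is bounded uniformly in `ε`.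

Stability (`IsErrorSystem.bound`) is an energy estimate for `(e, q)`. The part of `e` is tested with
its centred velocity, which gives the usual discrete Klein-Gordon energy. The part of `q` is
multiplied by `ε²` and tested with a discrete velocity potential, which gives the `H⁻¹` energy
`ε² ‖∂ₓ⁻¹ ∂ₜ q‖² + ‖q‖²` (`waveEnergy_succ_sub`). There the bounded residual only contributes
`O(ε²)`, and the source `p` enters through first differences in time, which the Klein-Gordon energy
controls. The cross term between `p` and `q` in the energy is absorbed by giving the Klein-Gordon part
a large weight (`coerciveEnergy_le_totalEnergy`), and a discrete Gronwall inequality concludes. As the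
cut-off nonlinearities have bounded and Lipschitz continuous derivatives, no a priori bound on the
numerical solution is needed.

Consistency (`consistency_E`) rests on the identity that `(E(t + τ) - 2 E(t) + E(t - τ)) / τ²` is the
average of `∂ₜₜE` with the weight `1 - |s|`. Averaging the equation in the same way produces exactly
the averaged potential of the scheme. Smooth terms are averaged up to `O(τ²)`, the term `F E` is
counted as `O(ε)`, and in `G E` only the variation of `E` is lost, which costs `τ` times the size of
`G`. That size is `ε ^ α*` by conservation of energy for the wave equation (`exists_wave_bound`).
The first time step is consistent for the same reason, because the equation controls the oscillation
of `∂ₜₜE` (`abs_dt_two_sub_init_le`).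

The regularity assumptions bound weak derivatives. By mollification they are turned into bounds on
first and second differences of the continuous functions involved
(`exists_approximation_of_isWeakDeriv`, `exists_regular_bounds`).

Each time step of the scheme is solvable because its solutions are the critical points of a coercive
functional on a finite dimensional space (`exists_elliptic_solution`).
-/

namespace KGZ

open Set MeasureTheory
open scoped ENNReal NNReal ContDiff

/-! ### Discrete calculus -/

/-- Squared discrete `L²` norm over the interior grid points. -/
def sqNorm (h : ℝ) (M : ℕ) (v : ℕ → ℝ) : ℝ := h * ∑ j ∈ Finset.Ico 1 M, v j ^ 2

/-- Squared discrete `L²` norm of a function on the `M` cells `(x_j, x_{j+1})`. -/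
def cellSq (h : ℝ) (M : ℕ) (v : ℕ → ℝ) : ℝ := h * ∑ j ∈ Finset.range M, v j ^ 2

lemma sqNorm_nonneg {h : ℝ} (hh : 0 ≤ h) (M : ℕ) (v : ℕ → ℝ) : 0 ≤ sqNorm h M v :=
  mul_nonneg hh (Finset.sum_nonneg fun _ _ => sq_nonneg _)

lemma cellSq_nonneg {h : ℝ} (hh : 0 ≤ h) (M : ℕ) (v : ℕ → ℝ) : 0 ≤ cellSq h M v :=
  mul_nonneg hh (Finset.sum_nonneg fun _ _ => sq_nonneg _)

lemma sum_mul_sub_add_sum (M : ℕ) (ψ w : ℕ → ℝ) :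
    ∑ i ∈ Finset.range (M + 1), ψ i * (w (i + 1) - w i)
      + ∑ j ∈ Finset.Ico 1 (M + 1), w j * (ψ j - ψ (j - 1)) = ψ M * w (M + 1) - ψ 0 * w 0 := by
  induction M with
  | zero => simp; ring
  | succ m ih =>
    rw [Finset.sum_range_succ, Finset.sum_Ico_succ_top (by omega)]
    simp only [Nat.add_sub_cancel]
    linarith

/-- Summation by parts for a grid function that vanishes on the boundary. -/
lemma sum_mul_sub_eq {M : ℕ} (hM : 1 ≤ M) (ψ w : ℕ → ℝ) (h0 : w 0 = 0) (h1 : w M = 0) :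
    ∑ i ∈ Finset.range M, ψ i * (w (i + 1) - w i)
      = -∑ j ∈ Finset.Ico 1 M, w j * (ψ j - ψ (j - 1)) := by
  obtain ⟨m, rfl⟩ : ∃ m, M = m + 1 := ⟨M - 1, by omega⟩
  have := sum_mul_sub_add_sum m ψ w
  rw [h0, h1] at this
  linarith

/-- Discrete Green's formula. -/
lemma sum_dxPlus_mul_dxPlus {h : ℝ} (hh : h ≠ 0) {M : ℕ} (hM : 1 ≤ M) (u w : ℕ → ℝ)
    (h0 : w 0 = 0) (h1 : w M = 0) :
    ∑ i ∈ Finset.range M, dxPlus h u i * dxPlus h w i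
      = -∑ j ∈ Finset.Ico 1 M, dxx h u j * w j := by
  have := sum_mul_sub_eq hM (fun i => dxPlus h u i / h) w h0 h1
  have e1 : ∑ i ∈ Finset.range M, dxPlus h u i * dxPlus h w i
      = ∑ i ∈ Finset.range M, dxPlus h u i / h * (w (i + 1) - w i) :=
    Finset.sum_congr rfl fun i _ => by unfold dxPlus; ring
  rw [e1, this]
  congr 1
  refine Finset.sum_congr rfl fun j hj => ?_
  have : j - 1 + 1 = j := by have := (Finset.mem_Ico.1 hj).1; omega
  unfold dxPlus dxx
  rw [this]
  field_simp
  ring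

/-- The discrete primitive with mean value zero over the cells. It plays the part of
`∂ₓ (∂ₓ²)⁻¹`, so that its `L²` norm is a discrete `H⁻¹` norm of the grid function. -/
noncomputable def meanPrim (h : ℝ) (M : ℕ) : (ℕ → ℝ) →ₗ[ℝ] (ℕ → ℝ) where
  toFun v j := h * ∑ i ∈ Finset.Ico 1 (j + 1), v i
    - (∑ l ∈ Finset.range M, h * ∑ i ∈ Finset.Ico 1 (l + 1), v i) / M
  map_add' u v := by
    funext j
    simp only [Pi.add_apply, Finset.sum_add_distrib, mul_add]
    ring
  map_smul' c v := by
    funext j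
    simp only [Pi.smul_apply, smul_eq_mul, RingHom.id_apply, ← Finset.mul_sum]
    ring

lemma meanPrim_apply (h : ℝ) (M : ℕ) (v : ℕ → ℝ) (j : ℕ) :
    meanPrim h M v j = h * ∑ i ∈ Finset.Ico 1 (j + 1), v i
    - (∑ l ∈ Finset.range M, h * ∑ i ∈ Finset.Ico 1 (l + 1), v i) / M := rfl

lemma meanPrim_sub_pred (h : ℝ) (M : ℕ) (v : ℕ → ℝ) {j : ℕ} (hj : 1 ≤ j) :
    meanPrim h M v j - meanPrim h M v (j - 1) = h * v j := by
  rw [meanPrim_apply, meanPrim_apply, Nat.sub_add_cancel hj, Finset.sum_Ico_succ_top hj]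
  ring

/-- `meanPrim` is minus the adjoint of the forward difference. -/
lemma sum_dxPlus_mul_meanPrim {h : ℝ} (hh : h ≠ 0) {M : ℕ} (hM : 1 ≤ M) (φ v : ℕ → ℝ)
    (h0 : φ 0 = 0) (h1 : φ M = 0) :
    ∑ i ∈ Finset.range M, dxPlus h φ i * meanPrim h M v i
      = -∑ j ∈ Finset.Ico 1 M, φ j * v j := by
  have := sum_mul_sub_eq hM (fun i => meanPrim h M v i / h) φ h0 h1
  have e1 : ∑ i ∈ Finset.range M, dxPlus h φ i * meanPrim h M v i
      = ∑ i ∈ Finset.range M, meanPrim h M v i / h * (φ (i + 1) - φ i) :=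
    Finset.sum_congr rfl fun i _ => by unfold dxPlus; ring
  rw [e1, this]
  congr 1
  refine Finset.sum_congr rfl fun j hj => ?_
  have := meanPrim_sub_pred h M v (Finset.mem_Ico.1 hj).1
  rw [← sub_div, this]
  field_simp

/-- The mean value is normalized such that no constant of integration appears here. -/
lemma meanPrim_dxx {h : ℝ} (hh : h ≠ 0) {M : ℕ} (hM : 1 ≤ M) (φ : ℕ → ℝ)
    (h0 : φ 0 = 0) (h1 : φ M = 0) (j : ℕ) :
    meanPrim h M (dxx h φ) j = dxPlus h φ j := by
  have key : ∀ l : ℕ, h * ∑ i ∈ Finset.Ico 1 (l + 1), dxx h φ i = dxPlus h φ l - dxPlus h φ 0 := by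
    intro l
    induction l with
    | zero => simp
    | succ l ih =>
      rw [Finset.sum_Ico_succ_top (by omega), mul_add, ih]
      unfold dxx dxPlus
      simp only [Nat.add_sub_cancel]
      field_simp
      ring
  have hM' : (M : ℝ) ≠ 0 := by positivity
  have s : ∑ l ∈ Finset.range M, dxPlus h φ l = 0 := by
    simp only [dxPlus, ← Finset.sum_div]
    rw [Finset.sum_range_sub, h0, h1]; simp
  rw [meanPrim_apply, Finset.sum_congr rfl fun l _ => key l, key, Finset.sum_sub_distrib, s]
  simp only [Finset.sum_const, Finset.card_range, nsmul_eq_mul]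
  field_simp
  ring

lemma abs_meanPrim_le {h : ℝ} (hh : 0 ≤ h) {M : ℕ} (v : ℕ → ℝ) {K : ℝ} (hK : 0 ≤ K)
    (hv : ∀ j ∈ Finset.Ico 1 M, |v j| ≤ K) {j : ℕ} (hj : j < M) :
    |meanPrim h M v j| ≤ 2 * (M * h * K) := by
  have hM' : (0 : ℝ) < M := by exact_mod_cast (by omega : 0 < M)
  have key : ∀ l < M, |h * ∑ i ∈ Finset.Ico 1 (l + 1), v i| ≤ M * h * K := by
    intro l hl
    rw [abs_mul, abs_of_nonneg hh]
    have : |∑ i ∈ Finset.Ico 1 (l + 1), v i| ≤ ∑ i ∈ Finset.Ico 1 (l + 1), K :=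
      (Finset.abs_sum_le_sum_abs _ _).trans (Finset.sum_le_sum fun i hi =>
        hv i (by simp only [Finset.mem_Ico] at hi ⊢; omega))
    simp only [Finset.sum_const, Nat.card_Ico, nsmul_eq_mul, Nat.add_sub_cancel] at this
    have hl' : (l : ℝ) ≤ M := by exact_mod_cast hl.le
    calc h * |∑ i ∈ Finset.Ico 1 (l + 1), v i| ≤ h * (M * K) := by gcongr; nlinarith
      _ = _ := by ring
  rw [meanPrim_apply]
  have h2 : |(∑ l ∈ Finset.range M, h * ∑ i ∈ Finset.Ico 1 (l + 1), v i) / M| ≤ M * h * K := by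
    rw [abs_div, abs_of_pos hM', div_le_iff₀ hM']
    refine (Finset.abs_sum_le_sum_abs _ _).trans
      ((Finset.sum_le_sum fun l hl => key l (Finset.mem_range.1 hl)).trans ?_)
    simp only [Finset.sum_const, Finset.card_range, nsmul_eq_mul]
    linarith
  have := key j hj
  rw [abs_le] at this h2 ⊢
  constructor <;> linarith

/-! ### Energies -/

/-- Discrete energy of the Klein-Gordon part between the levels `k` and `k + 1`. -/
noncomputable def kgEnergy (h : ℝ) (M : ℕ) (τ : ℝ) (e : ℕ → ℕ → ℝ) (k : ℕ) : ℝ :=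
  sqNorm h M (fun j => (e (k + 1) j - e k j) / τ)
    + (cellSq h M (dxPlus h (e (k + 1))) + cellSq h M (dxPlus h (e k))) / 2
    + (sqNorm h M (e (k + 1)) + sqNorm h M (e k)) / 2

/-- Discrete velocity potential of the wave part. -/
noncomputable def potential (h : ℝ) (M : ℕ) (τ : ℝ) (q : ℕ → ℕ → ℝ) (k : ℕ) : ℕ → ℝ :=
  meanPrim h M (fun j => (q (k + 1) j - q k j) / τ)

/-- Discrete `H⁻¹` energy of the wave part between the levels `k` and `k + 1`, with the
correction by the source `p`. -/
noncomputable def waveEnergy (h : ℝ) (M : ℕ) (τ ε : ℝ) (p q : ℕ → ℕ → ℝ) (k : ℕ) : ℝ :=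
  ε ^ 2 * cellSq h M (potential h M τ q k)
    + (sqNorm h M (q (k + 1)) + sqNorm h M (q k)) / 2
    + h * ∑ j ∈ Finset.Ico 1 M, (p (k + 1) j + p k j) * (q (k + 1) j + q k j) / 2

/-- Energy balance of the Klein-Gordon part: the residual tested with the centred velocity. -/
lemma kgEnergy_succ_sub {h : ℝ} (hh : h ≠ 0) {M : ℕ} (hM : 1 ≤ M) {τ : ℝ} (hτ : τ ≠ 0)
    (e : ℕ → ℕ → ℝ) (k : ℕ)
    (h0 : e k 0 = 0) (h1 : e k M = 0) (h0' : e (k + 2) 0 = 0) (h1' : e (k + 2) M = 0) :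
    kgEnergy h M τ e (k + 1) - kgEnergy h M τ e k
      = h * ∑ j ∈ Finset.Ico 1 M,
        (dtt τ e (k + 1) j - dxx h (avg e (k + 1)) j + avg e (k + 1) j)
          * (e (k + 2) j - e k j) := by
  have g := sum_dxPlus_mul_dxPlus hh hM (avg e (k + 1)) (fun j => e (k + 2) j - e k j)
    (by simp [h0, h0']) (by simp [h1, h1'])
  have g' : ∑ i ∈ Finset.range M, dxPlus h (avg e (k + 1)) i
        * dxPlus h (fun j => e (k + 2) j - e k j) i
      = (∑ i ∈ Finset.range M, dxPlus h (e (k + 2)) i ^ 2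
        - ∑ i ∈ Finset.range M, dxPlus h (e k) i ^ 2) / 2 := by
    rw [← Finset.sum_sub_distrib, Finset.sum_div]
    refine Finset.sum_congr rfl fun i _ => ?_
    unfold dxPlus avg
    simp only [Nat.add_sub_cancel]
    ring
  have e2 : ∑ j ∈ Finset.Ico 1 M,
        (dtt τ e (k + 1) j - dxx h (avg e (k + 1)) j + avg e (k + 1) j)
          * (e (k + 2) j - e k j)
      = ∑ j ∈ Finset.Ico 1 M, ((e (k + 2) j - e (k + 1) j) / τ) ^ 2
        - ∑ j ∈ Finset.Ico 1 M, ((e (k + 1) j - e k j) / τ) ^ 2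
        - ∑ j ∈ Finset.Ico 1 M, dxx h (avg e (k + 1)) j * (e (k + 2) j - e k j)
        + (∑ j ∈ Finset.Ico 1 M, e (k + 2) j ^ 2 - ∑ j ∈ Finset.Ico 1 M, e k j ^ 2) / 2 := by
    rw [← Finset.sum_sub_distrib, ← Finset.sum_sub_distrib, ← Finset.sum_sub_distrib,
      Finset.sum_div, ← Finset.sum_add_distrib]
    refine Finset.sum_congr rfl fun i _ => ?_
    unfold dtt avg
    simp only [Nat.add_sub_cancel]
    field_simp
    ring
  rw [e2]
  unfold kgEnergy sqNorm cellSq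
  linear_combination h * (g - g')

/-- Energy balance of the wave part for `q = f - p`. The second difference of the source `p` is
removed by the passage from `f` to `q`; what remains of `p` are first differences in time, by a
summation by parts that produces the correction in the energy. -/
lemma waveEnergy_succ_sub {h : ℝ} (hh : h ≠ 0) {M : ℕ} (hM : 1 ≤ M) {τ ε : ℝ} (hτ : τ ≠ 0)
    (hε : ε ≠ 0) (f p q : ℕ → ℕ → ℝ) (hq : ∀ k j, q k j = f k j - p k j) (k : ℕ)
    (h0 : f k 0 = 0) (h1 : f k M = 0) (h0' : f (k + 2) 0 = 0) (h1' : f (k + 2) M = 0) :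
    waveEnergy h M τ ε p q (k + 1) - waveEnergy h M τ ε p q k
      = h * ∑ j ∈ Finset.Ico 1 M,
          ((p (k + 2) j - p k j) * (q (k + 1) j + q k j) / 2
            + (p (k + 1) j - p k j) * (q (k + 2) j - q k j) / 2)
        + τ * (ε ^ 2 * (h * ∑ i ∈ Finset.range M,
          meanPrim h M (fun j => dtt τ q (k + 1) j - 1 / ε ^ 2 * dxx h (avg f (k + 1)) j) i
            * (potential h M τ q (k + 1) i + potential h M τ q k i))) := by
  set η : ℕ → ℝ := fun j => dtt τ q (k + 1) j - 1 / ε ^ 2 * dxx h (avg f (k + 1)) j with hη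
  have a0 : avg f (k + 1) 0 = 0 := by simp [avg, h0, h0']
  have a1 : avg f (k + 1) M = 0 := by simp [avg, h1, h1']
  have d : ∀ i, potential h M τ q (k + 1) i - potential h M τ q k i
      = τ * (1 / ε ^ 2 * dxPlus h (avg f (k + 1)) i + meanPrim h M η i) := by
    intro i
    have : (fun j => (q (k + 2) j - q (k + 1) j) / τ) - (fun j => (q (k + 1) j - q k j) / τ)
        = τ • ((1 / ε ^ 2) • dxx h (avg f (k + 1)) + η) := by
      funext j
      simp only [hη, dtt, Pi.sub_apply, Pi.smul_apply, Pi.add_apply, smul_eq_mul,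
        Nat.add_sub_cancel]
      field_simp
      ring
    have h2 := congrFun (congrArg (meanPrim h M) this) i
    simp only [map_sub, map_smul, map_add, Pi.sub_apply, Pi.smul_apply, Pi.add_apply,
      smul_eq_mul] at h2
    rw [meanPrim_dxx hh hM _ a0 a1] at h2
    exact h2
  have s : ∀ i, potential h M τ q (k + 1) i + potential h M τ q k i
      = 1 / τ * meanPrim h M (fun j => q (k + 2) j - q k j) i := by
    intro i
    have : (fun j => (q (k + 2) j - q (k + 1) j) / τ) + (fun j => (q (k + 1) j - q k j) / τ)
        = (1 / τ) • (fun j => q (k + 2) j - q k j) := by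
      funext j
      simp only [Pi.smul_apply, Pi.add_apply, smul_eq_mul]
      field_simp
      ring
    have h2 := congrFun (congrArg (meanPrim h M) this) i
    simp only [map_smul, map_add, Pi.smul_apply, Pi.add_apply, smul_eq_mul] at h2
    exact h2
  have g := sum_dxPlus_mul_meanPrim hh hM (avg f (k + 1)) (fun j => q (k + 2) j - q k j) a0 a1
  have c1 : ∑ i ∈ Finset.range M, potential h M τ q (k + 1) i ^ 2
        - ∑ i ∈ Finset.range M, potential h M τ q k i ^ 2
      = 1 / ε ^ 2 * ∑ i ∈ Finset.range M, dxPlus h (avg f (k + 1)) i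
          * meanPrim h M (fun j => q (k + 2) j - q k j) i
        + τ * ∑ i ∈ Finset.range M, meanPrim h M η i
            * (potential h M τ q (k + 1) i + potential h M τ q k i) := by
    rw [← Finset.sum_sub_distrib, Finset.mul_sum, Finset.mul_sum, ← Finset.sum_add_distrib]
    refine Finset.sum_congr rfl fun i _ => ?_
    have e1 : potential h M τ q (k + 1) i ^ 2 - potential h M τ q k i ^ 2
      = (potential h M τ q (k + 1) i - potential h M τ q k i)
        * (potential h M τ q (k + 1) i + potential h M τ q k i) := by ring
    rw [e1, d, s]
    field_simp
  have c2 : ∑ j ∈ Finset.Ico 1 M, avg f (k + 1) j * (q (k + 2) j - q k j)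
      = (∑ j ∈ Finset.Ico 1 M, q (k + 2) j ^ 2 - ∑ j ∈ Finset.Ico 1 M, q k j ^ 2) / 2
        + (∑ j ∈ Finset.Ico 1 M, (p (k + 2) j + p (k + 1) j) * (q (k + 2) j + q (k + 1) j) / 2
          - ∑ j ∈ Finset.Ico 1 M, (p (k + 1) j + p k j) * (q (k + 1) j + q k j) / 2)
        - ∑ j ∈ Finset.Ico 1 M, ((p (k + 2) j - p k j) * (q (k + 1) j + q k j) / 2
            + (p (k + 1) j - p k j) * (q (k + 2) j - q k j) / 2) := by
    rw [← Finset.sum_sub_distrib, ← Finset.sum_sub_distrib,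
      Finset.sum_div, ← Finset.sum_add_distrib, ← Finset.sum_sub_distrib]
    refine Finset.sum_congr rfl fun i _ => ?_
    unfold avg
    simp only [Nat.add_sub_cancel]
    have e1 : f (k + 2) i = q (k + 2) i + p (k + 2) i := by rw [hq]; ring
    have e2 : f k i = q k i + p k i := by rw [hq]; ring
    rw [e1, e2]
    ring
  have hε2 : ε ^ 2 * (1 / ε ^ 2) = 1 := by field_simp
  unfold waveEnergy sqNorm cellSq
  rw [g, c2] at c1
  linear_combination (ε ^ 2 * h) * c1 + h * hε2 * (-(
      (∑ j ∈ Finset.Ico 1 M, q (k + 2) j ^ 2 - ∑ j ∈ Finset.Ico 1 M, q k j ^ 2) / 2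
        + (∑ j ∈ Finset.Ico 1 M, (p (k + 2) j + p (k + 1) j) * (q (k + 2) j + q (k + 1) j) / 2
          - ∑ j ∈ Finset.Ico 1 M, (p (k + 1) j + p k j) * (q (k + 1) j + q k j) / 2)
        - ∑ j ∈ Finset.Ico 1 M, ((p (k + 2) j - p k j) * (q (k + 1) j + q k j) / 2
            + (p (k + 1) j - p k j) * (q (k + 2) j - q k j) / 2)))

/-! ### Stability of the scheme -/

/-- A discrete Gronwall inequality. -/
lemma gronwall_discrete {X : ℕ → ℝ} {c r : ℝ} (hc : 0 ≤ c) (hc' : c ≤ 1 / 2) (hr : 0 ≤ r) {n : ℕ}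
    (h0 : ∀ k ≤ n, 0 ≤ X k)
    (hX : ∀ k < n, X (k + 1) ≤ X k + c * (X k + X (k + 1) + r)) :
    ∀ k ≤ n, X k + r ≤ Real.exp (4 * c * k) * (X 0 + r) := by
  intro k
  induction k with
  | zero => intro _; simp
  | succ k ih =>
    intro hk
    have h1 := ih (by omega)
    have h2 := hX k (by omega)
    have h3 := h0 k (by omega)
    have h4 : X (k + 1) + r ≤ (1 + 4 * c) * (X k + r) := by
      have : (1 - c) * (X (k + 1) + r) ≤ (1 - c) * ((1 + 4 * c) * (X k + r)) := by
        nlinarith [mul_nonneg (mul_nonneg hc (by linarith : 0 ≤ 1 - 2 * c)) (add_nonneg h3 hr)]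
      exact le_of_mul_le_mul_left this (by linarith)
    have h5 : 1 + 4 * c ≤ Real.exp (4 * c) := by linarith [Real.add_one_le_exp (4 * c)]
    calc X (k + 1) + r ≤ (1 + 4 * c) * (X k + r) := h4
      _ ≤ Real.exp (4 * c) * (Real.exp (4 * c * k) * (X 0 + r)) := by
        gcongr
      _ = Real.exp (4 * c * (k + 1 : ℕ)) * (X 0 + r) := by
        rw [← mul_assoc, ← Real.exp_add]; congr 2; push_cast; ring

lemma add_five_sq_le (A B C D R : ℝ) :
    (A + B + C + D + R) ^ 2 ≤ 5 * (A ^ 2 + B ^ 2 + C ^ 2 + D ^ 2 + R ^ 2) := by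
  linarith [sq_nonneg (A - B), sq_nonneg (A - C), sq_nonneg (A - D), sq_nonneg (A - R),
    sq_nonneg (B - C), sq_nonneg (B - D), sq_nonneg (B - R), sq_nonneg (C - D),
    sq_nonneg (C - R), sq_nonneg (D - R)]

/-- The residual of the Klein-Gordon part tested with the centred velocity, at one grid point. -/
lemma mul_velocity_le {L R τ s e₀ e₁ e₂ v₀ v₁ f p q : ℝ} (hL : 0 ≤ L) (hτ : 0 ≤ τ)
    (hf : f = q + p) (hp : |p| ≤ L * |e₁|)
    (hs : |s| ≤ L * (|e₂| + |e₁| + |e₀| + |f|) + R) :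
    s * (τ * (v₁ + v₀)) ≤ τ * (5 * (L + L ^ 2) ^ 2 * (e₂ ^ 2 + e₁ ^ 2 + e₀ ^ 2 + q ^ 2)
      + 5 * R ^ 2 + v₁ ^ 2 + v₀ ^ 2) := by
  have hf' : |f| ≤ |q| + L * |e₁| := by
    rw [hf]; exact (abs_add_le _ _).trans (by linarith)
  set l := L + L ^ 2 with hl
  have hl0 : 0 ≤ l := by positivity
  have hLl : L ≤ l := by nlinarith
  have hs' : |s| ≤ l * |e₂| + l * |e₁| + l * |e₀| + l * |q| + R := by
    have a0 := abs_nonneg e₀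
    have a1 := abs_nonneg e₁
    have a2 := abs_nonneg e₂
    have a3 := abs_nonneg q
    have : L * |f| ≤ L * |q| + L ^ 2 * |e₁| := by nlinarith
    have b0 := mul_le_mul_of_nonneg_right hLl a0
    have b2 := mul_le_mul_of_nonneg_right hLl a2
    have b3 := mul_le_mul_of_nonneg_right hLl a3
    have b1 : L * |e₁| + L ^ 2 * |e₁| = l * |e₁| := by rw [hl]; ring
    nlinarith
  have sq : s ^ 2 ≤ 5 * (l ^ 2 * (e₂ ^ 2 + e₁ ^ 2 + e₀ ^ 2 + q ^ 2) + R ^ 2) := by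
    have h1 : s ^ 2 ≤ (l * |e₂| + l * |e₁| + l * |e₀| + l * |q| + R) ^ 2 := by
      rw [← sq_abs s]
      exact pow_le_pow_left₀ (abs_nonneg _) hs' 2
    refine h1.trans ?_
    rw [← sq_abs e₂, ← sq_abs e₁, ← sq_abs e₀, ← sq_abs q]
    refine (add_five_sq_le _ _ _ _ _).trans (le_of_eq ?_)
    ring
  have h2 : s * (v₁ + v₀) ≤ s ^ 2 + v₁ ^ 2 + v₀ ^ 2 := by
    nlinarith [sq_nonneg (2 * s - (v₁ + v₀)), sq_nonneg (v₁ - v₀), sq_nonneg v₁, sq_nonneg v₀]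
  calc s * (τ * (v₁ + v₀)) = τ * (s * (v₁ + v₀)) := by ring
    _ ≤ _ := mul_le_mul_of_nonneg_left (by linarith) hτ

/-- The source terms of the energy balance of the wave part, at one grid point. -/
lemma source_mul_le {L τ e₀ e₁ e₂ v₀ v₁ p₀ p₁ p₂ q₀ q₁ q₂ : ℝ} (hL : 0 ≤ L) (hτ : 0 ≤ τ)
    (hp : |p₁ - p₀| ≤ L * τ * (|v₀| + |e₀| + |e₁|))
    (hp' : |p₂ - p₁| ≤ L * τ * (|v₁| + |e₁| + |e₂|)) :
    (p₂ - p₀) * (q₁ + q₀) / 2 + (p₁ - p₀) * (q₂ - q₀) / 2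
      ≤ τ * (5 * L * (v₁ ^ 2 + v₀ ^ 2 + e₂ ^ 2 + e₁ ^ 2 + e₀ ^ 2 + q₂ ^ 2 + q₁ ^ 2 + q₀ ^ 2)) := by
  obtain ⟨m, hm⟩ : ∃ m, m = |v₁| + |v₀| + 2 * |e₁| + |e₂| + |e₀| := ⟨_, rfl⟩
  have a0 := abs_nonneg e₀
  have a1 := abs_nonneg e₁
  have a2 := abs_nonneg e₂
  have a3 := abs_nonneg v₀
  have a4 := abs_nonneg v₁
  have hLτ : 0 ≤ L * τ := mul_nonneg hL hτ
  have h1 : |p₁ - p₀| ≤ L * τ * m :=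
    hp.trans (mul_le_mul_of_nonneg_left (by rw [hm]; linarith) hLτ)
  have h2 : |p₂ - p₀| ≤ L * τ * m := by
    have := abs_add_le (p₂ - p₁) (p₁ - p₀)
    rw [sub_add_sub_cancel] at this
    refine this.trans ((add_le_add hp' hp).trans (le_of_eq ?_))
    rw [hm]; ring
  have h3 : (p₂ - p₀) * (q₁ + q₀) ≤ L * τ * m * (|q₁| + |q₀|) :=
    (le_abs_self _).trans (by
      rw [abs_mul]; exact mul_le_mul h2 (abs_add_le _ _) (abs_nonneg _) ((abs_nonneg _).trans h2))
  have h4 : (p₁ - p₀) * (q₂ - q₀) ≤ L * τ * m * (|q₂| + |q₀|) :=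
    (le_abs_self _).trans (by
      rw [abs_mul]
      refine mul_le_mul h1 ?_ (abs_nonneg _) ((abs_nonneg _).trans h1)
      have := abs_add_le q₂ (-q₀)
      rwa [abs_neg, ← sub_eq_add_neg] at this)
  have h5 : m * (|q₁| + 2 * |q₀| + |q₂|)
      ≤ 10 * (v₁ ^ 2 + v₀ ^ 2 + e₂ ^ 2 + e₁ ^ 2 + e₀ ^ 2 + q₂ ^ 2 + q₁ ^ 2 + q₀ ^ 2) := by
    rw [← sq_abs v₁, ← sq_abs v₀, ← sq_abs e₂, ← sq_abs e₁, ← sq_abs e₀, ← sq_abs q₂,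
      ← sq_abs q₁, ← sq_abs q₀]
    have m2 : m ^ 2 ≤ 20 * (|v₁| ^ 2 + |v₀| ^ 2 + |e₂| ^ 2 + |e₁| ^ 2 + |e₀| ^ 2) := by
      have := add_five_sq_le |v₁| |v₀| (2 * |e₁|) |e₂| |e₀|
      rw [← hm] at this
      linarith [sq_nonneg |v₁|, sq_nonneg |v₀|, sq_nonneg |e₂|, sq_nonneg |e₀|]
    have n2 : (|q₁| + 2 * |q₀| + |q₂|) ^ 2 ≤ 12 * (|q₂| ^ 2 + |q₁| ^ 2 + |q₀| ^ 2) := by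
      linarith [sq_nonneg (|q₁| - 2 * |q₀|), sq_nonneg (|q₁| - |q₂|), sq_nonneg (|q₂| - 2 * |q₀|),
        sq_nonneg |q₁|, sq_nonneg |q₂|]
    have mn := sq_nonneg (m - (|q₁| + 2 * |q₀| + |q₂|))
    have mn' : 2 * (m * (|q₁| + 2 * |q₀| + |q₂|)) ≤ m ^ 2 + (|q₁| + 2 * |q₀| + |q₂|) ^ 2 := by
      linarith
    linarith [sq_nonneg |q₁|, sq_nonneg |q₂|, sq_nonneg |q₀|]
  have h6 := mul_le_mul_of_nonneg_left h5 hLτ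
  linarith

lemma sqNorm_le_of_abs_le {h : ℝ} (hh : 0 ≤ h) {M : ℕ} {v : ℕ → ℝ} {K : ℝ}
    (hv : ∀ j ∈ Finset.Ico 1 M, |v j| ≤ K) : sqNorm h M v ≤ M * h * K ^ 2 := by
  have : ∑ j ∈ Finset.Ico 1 M, v j ^ 2 ≤ ∑ j ∈ Finset.Ico 1 M, K ^ 2 :=
    Finset.sum_le_sum fun j hj => sq_le_sq.2 ((hv j hj).trans (le_abs_self K))
  simp only [Finset.sum_const, Nat.card_Ico, nsmul_eq_mul] at this
  have h1 : ((M - 1 : ℕ) : ℝ) ≤ M := by exact_mod_cast Nat.sub_le _ _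
  unfold sqNorm
  calc _ ≤ h * (((M - 1 : ℕ) : ℝ) * K ^ 2) := by gcongr
    _ ≤ h * (M * K ^ 2) := by gcongr
    _ = _ := by ring

lemma cellSq_le_of_abs_le {h : ℝ} (hh : 0 ≤ h) {M : ℕ} {v : ℕ → ℝ} {K : ℝ}
    (hv : ∀ j < M, |v j| ≤ K) : cellSq h M v ≤ M * h * K ^ 2 := by
  have : ∑ j ∈ Finset.range M, v j ^ 2 ≤ ∑ j ∈ Finset.range M, K ^ 2 :=
    Finset.sum_le_sum fun j hj =>
      sq_le_sq.2 ((hv j (Finset.mem_range.1 hj)).trans (le_abs_self K))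
  simp only [Finset.sum_const, Finset.card_range, nsmul_eq_mul] at this
  unfold cellSq
  calc _ ≤ h * (M * K ^ 2) := by gcongr
    _ = _ := by ring

/-- The part of the total energy that is a sum of squares. -/
noncomputable def coerciveEnergy (h : ℝ) (M : ℕ) (τ ε : ℝ) (e q : ℕ → ℕ → ℝ) (k : ℕ) : ℝ :=
  kgEnergy h M τ e k + ε ^ 2 * cellSq h M (potential h M τ q k)
    + (sqNorm h M (q (k + 1)) + sqNorm h M (q k)) / 4

/-- Total energy: the weight of the Klein-Gordon part makes up for the indefinite correction
in the wave part. -/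
noncomputable def totalEnergy (h : ℝ) (M : ℕ) (τ ε L : ℝ) (e p q : ℕ → ℕ → ℝ) (k : ℕ) : ℝ :=
  (2 * L ^ 2 + 1) * kgEnergy h M τ e k + waveEnergy h M τ ε p q k

lemma kgEnergy_ge {h : ℝ} (hh : 0 ≤ h) (M : ℕ) (τ : ℝ) (e : ℕ → ℕ → ℝ) (k : ℕ) :
    sqNorm h M (fun j => (e (k + 1) j - e k j) / τ)
      + (sqNorm h M (e (k + 1)) + sqNorm h M (e k)) / 2 ≤ kgEnergy h M τ e k := by
  have h1 := cellSq_nonneg hh M (dxPlus h (e (k + 1)))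
  have h2 := cellSq_nonneg hh M (dxPlus h (e k))
  unfold kgEnergy
  linarith

lemma coerciveEnergy_le_totalEnergy {h : ℝ} (hh : 0 ≤ h) (M : ℕ) (τ ε L : ℝ)
    (e p q : ℕ → ℕ → ℝ) (k : ℕ)
    (hp : ∀ j ∈ Finset.Ico 1 M, |p k j| ≤ L * |e k j|)
    (hp' : ∀ j ∈ Finset.Ico 1 M, |p (k + 1) j| ≤ L * |e (k + 1) j|) :
    coerciveEnergy h M τ ε e q k ≤ totalEnergy h M τ ε L e p q k := by
  have h1 := kgEnergy_ge hh M τ e k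
  have h2 := sqNorm_nonneg hh M (fun j => (e (k + 1) j - e k j) / τ)
  have h3 : -(L ^ 2 * (sqNorm h M (e (k + 1)) + sqNorm h M (e k)))
        - (sqNorm h M (q (k + 1)) + sqNorm h M (q k)) / 4
      ≤ h * ∑ j ∈ Finset.Ico 1 M, (p (k + 1) j + p k j) * (q (k + 1) j + q k j) / 2 := by
    have : -(L ^ 2 * (sqNorm h M (e (k + 1)) + sqNorm h M (e k)))
        - (sqNorm h M (q (k + 1)) + sqNorm h M (q k)) / 4
      = h * ∑ j ∈ Finset.Ico 1 M, (-(L ^ 2 * (e (k + 1) j ^ 2 + e k j ^ 2))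
          - (q (k + 1) j ^ 2 + q k j ^ 2) / 4) := by
      unfold sqNorm
      rw [Finset.sum_sub_distrib, Finset.sum_neg_distrib, ← Finset.mul_sum, ← Finset.sum_div,
        Finset.sum_add_distrib, Finset.sum_add_distrib]
      ring
    rw [this]
    refine mul_le_mul_of_nonneg_left (Finset.sum_le_sum fun j hj => ?_) hh
    have s : ∀ {x y : ℝ}, |x| ≤ L * |y| → x ^ 2 ≤ L ^ 2 * y ^ 2 := fun {x y} hxy => by
      rw [← sq_abs x, ← sq_abs y, ← mul_pow]
      exact pow_le_pow_left₀ (abs_nonneg _) hxy 2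
    nlinarith [s (hp j hj), s (hp' j hj),
      sq_nonneg (p (k + 1) j + p k j + (q (k + 1) j + q k j) / 2),
      sq_nonneg (p (k + 1) j - p k j), sq_nonneg (q (k + 1) j - q k j)]
  have h4 : L ^ 2 * (sqNorm h M (e (k + 1)) + sqNorm h M (e k)) ≤ 2 * L ^ 2 * kgEnergy h M τ e k := by
    nlinarith [sq_nonneg L]
  unfold coerciveEnergy totalEnergy waveEnergy
  linarith

/-- The relations between the errors `e` (of `E`) and `f` (of `F`) and the perturbation `p` of the
nonlinear source on the time levels `0, …, n`. The number `R` bounds the consistency error, and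
`L` stands for the constants that do not depend on the discretization. -/
structure IsErrorSystem (h : ℝ) (M : ℕ) (τ ε L R : ℝ) (n : ℕ) (e f p : ℕ → ℕ → ℝ) : Prop where
  boundary_e : ∀ k ≤ n, e k 0 = 0 ∧ e k M = 0
  boundary_f : ∀ k ≤ n, f k 0 = 0 ∧ f k M = 0
  residual_e : ∀ k, k + 2 ≤ n → ∀ j ∈ Finset.Ico 1 M,
    |dtt τ e (k + 1) j - dxx h (avg e (k + 1)) j + avg e (k + 1) j|
      ≤ L * (|e (k + 2) j| + |e (k + 1) j| + |e k j| + |f (k + 1) j|) + R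
  residual_f : ∀ k, k + 2 ≤ n → ∀ j ∈ Finset.Ico 1 M,
    |dtt τ (fun k j => f k j - p k j) (k + 1) j - 1 / ε ^ 2 * dxx h (avg f (k + 1)) j| ≤ L
  source : ∀ k ≤ n, ∀ j ∈ Finset.Ico 1 M, |p k j| ≤ L * |e k j|
  source_sub : ∀ k, k + 1 ≤ n → ∀ j ∈ Finset.Ico 1 M,
    |p (k + 1) j - p k j| ≤ L * (|e (k + 1) j - e k j| + τ * (|e k j| + |e (k + 1) j|))
  init : ∀ j ≤ M, e 0 j = 0 ∧ f 0 j = 0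
  first_e : 1 ≤ n → ∀ j ∈ Finset.Ico 1 M, |e 1 j| ≤ τ * R
  first_dx : 1 ≤ n → ∀ j < M, |dxPlus h (e 1) j| ≤ R
  first_f : 1 ≤ n → ∀ j ∈ Finset.Ico 1 M, |f 1 j| ≤ L * τ ^ 2

/-- Growth constant of the total energy. -/
noncomputable def growthConst (L ℓ : ℝ) : ℝ :=
  4 * ((2 * L ^ 2 + 1) * (5 * (L + L ^ 2) ^ 2 + 1) + 5 * L)
    + (2 * L ^ 2 + 1) * 5 * ℓ + 2 * ℓ ^ 3 * L ^ 2 + 1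

/-- Constant in the bound of the energy between the levels `0` and `1`. -/
noncomputable def initConst (L ℓ : ℝ) : ℝ :=
  (2 * L ^ 2 + 1) * (2 * ℓ) + ℓ * (2 * ℓ * (2 * L)) ^ 2 + ℓ * (2 * L) ^ 2 + ℓ * (L * (2 * L))

lemma growthConst_ge_one {L ℓ : ℝ} (hL : 0 ≤ L) (hℓ : 0 ≤ ℓ) : 1 ≤ growthConst L ℓ := by
  unfold growthConst
  have : 0 ≤ 4 * ((2 * L ^ 2 + 1) * (5 * (L + L ^ 2) ^ 2 + 1) + 5 * L)
    + (2 * L ^ 2 + 1) * 5 * ℓ + 2 * ℓ ^ 3 * L ^ 2 := by positivity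
  linarith

namespace IsErrorSystem

variable {h : ℝ} {M : ℕ} {τ ε L R : ℝ} {n : ℕ} {e f p : ℕ → ℕ → ℝ}

lemma velocity_bound (H : IsErrorSystem h M τ ε L R n e f p) (hτ : 0 < τ) (k : ℕ)
    (hk : k + 1 ≤ n) (j : ℕ) (hj : j ∈ Finset.Ico 1 M) :
    |p (k + 1) j - p k j| ≤ L * τ * (|(e (k + 1) j - e k j) / τ| + |e k j| + |e (k + 1) j|) := by
  refine (H.source_sub k hk j hj).trans (le_of_eq ?_)
  rw [abs_div, abs_of_pos hτ]
  field_simp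
  ring

lemma kgEnergy_step (H : IsErrorSystem h M τ ε L R n e f p) (hh : 0 < h) (hM : 1 ≤ M)
    (hτ : 0 < τ) (hL : 0 ≤ L) (k : ℕ) (hk : k + 2 ≤ n) :
    kgEnergy h M τ e (k + 1) - kgEnergy h M τ e k
      ≤ τ * ((5 * (L + L ^ 2) ^ 2 + 1) * (sqNorm h M (e (k + 2)) + sqNorm h M (e (k + 1))
          + sqNorm h M (e k) + sqNorm h M (fun j => f (k + 1) j - p (k + 1) j)
          + sqNorm h M (fun j => (e (k + 2) j - e (k + 1) j) / τ)
          + sqNorm h M (fun j => (e (k + 1) j - e k j) / τ)) + 5 * (M * h) * R ^ 2) := by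
  rw [kgEnergy_succ_sub hh.ne' hM hτ.ne' e k (H.boundary_e k (by omega)).1
    (H.boundary_e k (by omega)).2 (H.boundary_e _ hk).1 (H.boundary_e _ hk).2]
  have pt : ∀ j ∈ Finset.Ico 1 M,
      (dtt τ e (k + 1) j - dxx h (avg e (k + 1)) j + avg e (k + 1) j) * (e (k + 2) j - e k j)
      ≤ τ * ((5 * (L + L ^ 2) ^ 2 + 1) * (e (k + 2) j ^ 2 + e (k + 1) j ^ 2 + e k j ^ 2
        + (f (k + 1) j - p (k + 1) j) ^ 2 + ((e (k + 2) j - e (k + 1) j) / τ) ^ 2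
        + ((e (k + 1) j - e k j) / τ) ^ 2) + 5 * R ^ 2) := by
    intro j hj
    have h1 := mul_velocity_le (v₁ := (e (k + 2) j - e (k + 1) j) / τ)
      (v₀ := (e (k + 1) j - e k j) / τ) (q := f (k + 1) j - p (k + 1) j) hL hτ.le (by ring)
      (H.source (k + 1) (by omega) j hj) (H.residual_e k hk j hj)
    have h2 : τ * ((e (k + 2) j - e (k + 1) j) / τ + (e (k + 1) j - e k j) / τ)
        = e (k + 2) j - e k j := by field_simp; ring
    rw [h2] at h1
    refine h1.trans (mul_le_mul_of_nonneg_left ?_ hτ.le)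
    have : 0 ≤ 5 * (L + L ^ 2) ^ 2 * (((e (k + 2) j - e (k + 1) j) / τ) ^ 2
        + ((e (k + 1) j - e k j) / τ) ^ 2) := by positivity
    linarith [sq_nonneg (e (k + 2) j), sq_nonneg (e (k + 1) j), sq_nonneg (e k j),
      sq_nonneg (f (k + 1) j - p (k + 1) j)]
  have sm := mul_le_mul_of_nonneg_left (Finset.sum_le_sum pt) hh.le
  refine sm.trans ?_
  rw [← Finset.mul_sum, Finset.sum_add_distrib, ← Finset.mul_sum]
  simp only [Finset.sum_add_distrib, Finset.sum_const, Nat.card_Ico, nsmul_eq_mul]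
  have h1 : ((M - 1 : ℕ) : ℝ) ≤ M := by exact_mod_cast Nat.sub_le _ _
  have h2 : τ * (h * (((M - 1 : ℕ) : ℝ) * (5 * R ^ 2))) ≤ τ * (h * (M * (5 * R ^ 2))) := by
    gcongr
  unfold sqNorm
  linarith

/-- The residual of the wave part is only bounded, not small, but in the `H⁻¹` energy it carries
the weight `ε ^ 2 ≤ R ^ 2`. -/
lemma waveEnergy_step (H : IsErrorSystem h M τ ε L R n e f p) (hh : 0 < h) (hM : 1 ≤ M)
    (hτ : 0 < τ) (hL : 0 ≤ L) (hε : 0 < ε) (hεR : ε ≤ R) (k : ℕ) (hk : k + 2 ≤ n) :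
    waveEnergy h M τ ε p (fun k j => f k j - p k j) (k + 1)
      - waveEnergy h M τ ε p (fun k j => f k j - p k j) k
      ≤ τ * (5 * L * (sqNorm h M (fun j => (e (k + 2) j - e (k + 1) j) / τ)
          + sqNorm h M (fun j => (e (k + 1) j - e k j) / τ)
          + sqNorm h M (e (k + 2)) + sqNorm h M (e (k + 1)) + sqNorm h M (e k)
          + sqNorm h M (fun j => f (k + 2) j - p (k + 2) j)
          + sqNorm h M (fun j => f (k + 1) j - p (k + 1) j)
          + sqNorm h M (fun j => f k j - p k j))
        + 2 * (M * h) ^ 3 * L ^ 2 * R ^ 2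
        + ε ^ 2 * (cellSq h M (potential h M τ (fun k j => f k j - p k j) (k + 1))
          + cellSq h M (potential h M τ (fun k j => f k j - p k j) k))) := by
  set q : ℕ → ℕ → ℝ := fun k j => f k j - p k j with hq
  rw [waveEnergy_succ_sub hh.ne' hM hτ.ne' hε.ne' f p q (fun _ _ => rfl) k
    (H.boundary_f k (by omega)).1 (H.boundary_f k (by omega)).2 (H.boundary_f _ hk).1
    (H.boundary_f _ hk).2]
  set η : ℕ → ℝ := fun j => dtt τ q (k + 1) j - 1 / ε ^ 2 * dxx h (avg f (k + 1)) j
  have sm := mul_le_mul_of_nonneg_left (Finset.sum_le_sum fun j (hj : j ∈ Finset.Ico 1 M) =>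
    source_mul_le (q₀ := q k j) (q₁ := q (k + 1) j) (q₂ := q (k + 2) j) hL hτ.le
      (H.velocity_bound hτ k (by omega) j hj) (H.velocity_bound hτ (k + 1) hk j hj)) hh.le
  have hη := cellSq_le_of_abs_le hh.le fun j hj =>
    abs_meanPrim_le hh.le η hL (fun j hj => H.residual_f k hk j hj) hj
  have cs : h * ∑ i ∈ Finset.range M, meanPrim h M η i
      * (potential h M τ q (k + 1) i + potential h M τ q k i)
      ≤ cellSq h M (meanPrim h M η) / 2 + (cellSq h M (potential h M τ q (k + 1))
        + cellSq h M (potential h M τ q k)) := by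
    have : cellSq h M (meanPrim h M η) / 2 + (cellSq h M (potential h M τ q (k + 1))
        + cellSq h M (potential h M τ q k)) = h * ∑ i ∈ Finset.range M,
          (meanPrim h M η i ^ 2 / 2 + (potential h M τ q (k + 1) i ^ 2
            + potential h M τ q k i ^ 2)) := by
      unfold cellSq
      rw [Finset.sum_add_distrib, Finset.sum_add_distrib, ← Finset.sum_div]
      ring
    rw [this]
    refine mul_le_mul_of_nonneg_left (Finset.sum_le_sum fun i _ => ?_) hh.le
    nlinarith [sq_nonneg (meanPrim h M η i
        - (potential h M τ q (k + 1) i + potential h M τ q k i)),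
      sq_nonneg (potential h M τ q (k + 1) i - potential h M τ q k i)]
  have hε2 : ε ^ 2 ≤ R ^ 2 := pow_le_pow_left₀ hε.le hεR 2
  have cs2 : ε ^ 2 * (h * ∑ i ∈ Finset.range M, meanPrim h M η i
      * (potential h M τ q (k + 1) i + potential h M τ q k i))
      ≤ 2 * (M * h) ^ 3 * L ^ 2 * R ^ 2 + ε ^ 2 * (cellSq h M (potential h M τ q (k + 1))
        + cellSq h M (potential h M τ q k)) := by
    have c1 := mul_le_mul_of_nonneg_left cs (sq_nonneg ε)
    have c2 : ε ^ 2 * (cellSq h M (meanPrim h M η) / 2)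
        ≤ R ^ 2 * (M * h * (2 * (M * h * L)) ^ 2 / 2) := by
      have := cellSq_nonneg hh.le M (meanPrim h M η)
      gcongr
    have c3 : R ^ 2 * (M * h * (2 * (M * h * L)) ^ 2 / 2) = 2 * (M * h) ^ 3 * L ^ 2 * R ^ 2 := by
      ring
    linarith
  have cs3 := mul_le_mul_of_nonneg_left cs2 hτ.le
  refine (add_le_add sm cs3).trans (le_of_eq ?_)
  rw [← Finset.mul_sum, ← Finset.mul_sum]
  simp only [Finset.sum_add_distrib]
  unfold sqNorm
  ring

lemma totalEnergy_step (H : IsErrorSystem h M τ ε L R n e f p) (hh : 0 < h) (hM : 1 ≤ M)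
    (hτ : 0 < τ) (hL : 0 ≤ L) (hε : 0 < ε) (hεR : ε ≤ R) (k : ℕ) (hk : k + 2 ≤ n) :
    totalEnergy h M τ ε L e p (fun k j => f k j - p k j) (k + 1)
      ≤ totalEnergy h M τ ε L e p (fun k j => f k j - p k j) k
        + τ * growthConst L (M * h) * (coerciveEnergy h M τ ε e (fun k j => f k j - p k j) k
          + coerciveEnergy h M τ ε e (fun k j => f k j - p k j) (k + 1) + R ^ 2) := by
  have a := H.kgEnergy_step hh hM hτ hL k hk
  have b := H.waveEnergy_step hh hM hτ hL hε hεR k hk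
  have g0 := kgEnergy_ge hh.le M τ e k
  have g1 := kgEnergy_ge hh.le M τ e (k + 1)
  simp only [add_assoc, one_add_one_eq_two] at g0 g1
  set q : ℕ → ℕ → ℝ := fun k j => f k j - p k j with hq
  have y0 : coerciveEnergy h M τ ε e q k = kgEnergy h M τ e k
    + ε ^ 2 * cellSq h M (potential h M τ q k)
    + (sqNorm h M (fun j => f (k + 1) j - p (k + 1) j) + sqNorm h M (fun j => f k j - p k j)) / 4 :=
    rfl
  have y1 : coerciveEnergy h M τ ε e q (k + 1) = kgEnergy h M τ e (k + 1)
    + ε ^ 2 * cellSq h M (potential h M τ q (k + 1))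
    + (sqNorm h M (fun j => f (k + 2) j - p (k + 2) j)
      + sqNorm h M (fun j => f (k + 1) j - p (k + 1) j)) / 4 := rfl
  have n1 := sqNorm_nonneg hh.le M (fun j => (e (k + 2) j - e (k + 1) j) / τ)
  have n2 := sqNorm_nonneg hh.le M (fun j => (e (k + 1) j - e k j) / τ)
  have n3 := sqNorm_nonneg hh.le M (e (k + 2))
  have n4 := sqNorm_nonneg hh.le M (e (k + 1))
  have n5 := sqNorm_nonneg hh.le M (e k)
  have n6 := sqNorm_nonneg hh.le M (fun j => f (k + 2) j - p (k + 2) j)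
  have n7 := sqNorm_nonneg hh.le M (fun j => f (k + 1) j - p (k + 1) j)
  have n8 := sqNorm_nonneg hh.le M (fun j => f k j - p k j)
  have n9 : 0 ≤ ε ^ 2 * cellSq h M (potential h M τ q k) :=
    mul_nonneg (sq_nonneg _) (cellSq_nonneg hh.le M _)
  have n10 : 0 ≤ ε ^ 2 * cellSq h M (potential h M τ q (k + 1)) :=
    mul_nonneg (sq_nonneg _) (cellSq_nonneg hh.le M _)
  unfold totalEnergy growthConst
  generalize sqNorm h M (fun j => (e (k + 2) j - e (k + 1) j) / τ) = s1 at *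
  generalize sqNorm h M (fun j => (e (k + 1) j - e k j) / τ) = s2 at *
  generalize sqNorm h M (e (k + 2)) = s3 at *
  generalize sqNorm h M (e (k + 1)) = s4 at *
  generalize sqNorm h M (e k) = s5 at *
  generalize sqNorm h M (fun j => f (k + 2) j - p (k + 2) j) = s6 at *
  generalize sqNorm h M (fun j => f (k + 1) j - p (k + 1) j) = s7 at *
  generalize sqNorm h M (fun j => f k j - p k j) = s8 at *
  generalize cellSq h M (potential h M τ q k) = c0 at *
  generalize cellSq h M (potential h M τ q (k + 1)) = c1 at *
  generalize kgEnergy h M τ e (k + 1) = D1 at *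
  generalize kgEnergy h M τ e k = D0 at *
  generalize waveEnergy h M τ ε p q (k + 1) = W1 at *
  generalize waveEnergy h M τ ε p q k = W0 at *
  generalize coerciveEnergy h M τ ε e q k = Y0 at *
  generalize coerciveEnergy h M τ ε e q (k + 1) = Y1 at *
  set S := s1 + s2 + s3 + s4 + s5 + s6 + s7 + s8 with hS
  have hSY : S ≤ 4 * (Y0 + Y1) := by rw [hS, y0, y1]; linarith
  have hY : 0 ≤ Y0 + Y1 := by rw [y0, y1]; linarith
  set Λ := 5 * (L + L ^ 2) ^ 2 + 1 with hΛ
  have hΛ0 : 0 ≤ Λ := by positivity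
  set K := 2 * L ^ 2 + 1 with hK
  have hK0 : 0 ≤ K := by positivity
  set ℓ := (M : ℝ) * h with hℓ
  have hℓ0 : 0 ≤ ℓ := by positivity
  have a' : K * (D1 - D0) ≤ K * (τ * (Λ * S + 5 * ℓ * R ^ 2)) := by
    refine mul_le_mul_of_nonneg_left (a.trans (mul_le_mul_of_nonneg_left ?_ hτ.le)) hK0
    have := mul_le_mul_of_nonneg_left (by rw [hS]; linarith : s3 + s4 + s5 + s7 + s1 + s2 ≤ S) hΛ0
    linarith
  have c : K * (Λ * S + 5 * ℓ * R ^ 2) + (5 * L * S + 2 * ℓ ^ 3 * L ^ 2 * R ^ 2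
      + ε ^ 2 * (c1 + c0)) ≤ (4 * (K * Λ + 5 * L) + K * 5 * ℓ + 2 * ℓ ^ 3 * L ^ 2 + 1)
        * (Y0 + Y1 + R ^ 2) := by
    have u1 := mul_le_mul_of_nonneg_left hSY (by positivity : 0 ≤ K * Λ + 5 * L)
    have u2 : ε ^ 2 * (c1 + c0) ≤ Y0 + Y1 := by rw [y0, y1]; linarith
    have u3 : 0 ≤ (K * 5 * ℓ + 2 * ℓ ^ 3 * L ^ 2) * (Y0 + Y1) := by positivity
    have u4 : 0 ≤ (4 * (K * Λ + 5 * L) + 1) * R ^ 2 := by positivity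
    linarith
  have c' := mul_le_mul_of_nonneg_left c hτ.le
  linarith

/-- The energy between the levels `0` and `1`. The velocity of `q` at the start is only of size
`τ + R`, and again the weight `ε ^ 2` of the potential makes its energy `O(R ^ 2)`. -/
lemma totalEnergy_zero_le (H : IsErrorSystem h M τ ε L R n e f p) (hn : 1 ≤ n) (hh : 0 < h)
    (hτ : 0 < τ) (hτ1 : τ ≤ 1) (hL : 0 ≤ L) (hε : 0 < ε) (hε1 : ε ≤ 1)
    (hεR : ε ≤ R) (hτR : τ ^ 2 ≤ R) :
    totalEnergy h M τ ε L e p (fun k j => f k j - p k j) 0 ≤ initConst L (M * h) * R ^ 2 := by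
  have hR : 0 ≤ R := hε.le.trans hεR
  have e0 : ∀ j ≤ M, e 0 j = 0 := fun j hj => (H.init j hj).1
  have p0 : ∀ j ∈ Finset.Ico 1 M, p 0 j = 0 := fun j hj => by
    have h1 := H.source 0 (by omega) j hj
    rw [e0 j (Finset.mem_Ico.1 hj).2.le] at h1
    simpa using h1
  have q0 : ∀ j ∈ Finset.Ico 1 M, f 0 j - p 0 j = 0 := fun j hj => by
    rw [p0 j hj, (H.init j (Finset.mem_Ico.1 hj).2.le).2, sub_zero]
  have e1 : ∀ j ∈ Finset.Ico 1 M, |e 1 j| ≤ R := fun j hj =>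
    (H.first_e hn j hj).trans (by nlinarith)
  have p1 : ∀ j ∈ Finset.Ico 1 M, |p 1 j| ≤ L * (τ * R) := fun j hj =>
    (H.source 1 hn j hj).trans (mul_le_mul_of_nonneg_left (H.first_e hn j hj) hL)
  have p1' : ∀ j ∈ Finset.Ico 1 M, |p 1 j| ≤ L * R := fun j hj =>
    (H.source 1 hn j hj).trans (mul_le_mul_of_nonneg_left (e1 j hj) hL)
  have q1 : ∀ j ∈ Finset.Ico 1 M, |f 1 j - p 1 j| ≤ τ * (L * τ + L * R) := fun j hj => by
    have h1 := H.first_f hn j hj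
    have h2 := p1 j hj
    rw [abs_le] at h1 h2 ⊢
    constructor <;> nlinarith
  have q1' : ∀ j ∈ Finset.Ico 1 M, |f 1 j - p 1 j| ≤ 2 * L * R := fun j hj => by
    have h1 := H.first_f hn j hj
    have h2 := p1' j hj
    have h3 := mul_le_mul_of_nonneg_left hτR hL
    rw [abs_le] at h1 h2 ⊢
    constructor <;> nlinarith
  have A : kgEnergy h M τ e 0 ≤ 2 * (M * h) * R ^ 2 := by
    have a1 : sqNorm h M (fun j => (e (0 + 1) j - e 0 j) / τ) ≤ M * h * R ^ 2 := by
      refine sqNorm_le_of_abs_le hh.le fun j hj => ?_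
      rw [e0 j (Finset.mem_Ico.1 hj).2.le, sub_zero, abs_div, abs_of_pos hτ, div_le_iff₀ hτ,
        mul_comm]
      exact H.first_e hn j hj
    have a2 : cellSq h M (dxPlus h (e (0 + 1))) ≤ M * h * R ^ 2 :=
      cellSq_le_of_abs_le hh.le fun j hj => H.first_dx hn j hj
    have a3 : cellSq h M (dxPlus h (e 0)) ≤ M * h * 0 ^ 2 :=
      cellSq_le_of_abs_le hh.le fun j hj => by
        unfold dxPlus; rw [e0 _ hj, e0 _ hj.le]; simp
    have a4 : sqNorm h M (e (0 + 1)) ≤ M * h * R ^ 2 := sqNorm_le_of_abs_le hh.le e1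
    have a5 : sqNorm h M (e 0) ≤ M * h * 0 ^ 2 := sqNorm_le_of_abs_le hh.le fun j hj => by
        rw [e0 _ (Finset.mem_Ico.1 hj).2.le]; simp
    unfold kgEnergy
    linarith
  have B1 : ε ^ 2 * cellSq h M (potential h M τ (fun k j => f k j - p k j) 0)
      ≤ M * h * (2 * (M * h) * (2 * L)) ^ 2 * R ^ 2 := by
    have b1 : cellSq h M (potential h M τ (fun k j => f k j - p k j) 0)
        ≤ M * h * (2 * (M * h * (L * τ + L * R))) ^ 2 := by
      refine cellSq_le_of_abs_le hh.le fun j hj =>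
        abs_meanPrim_le hh.le _ (by positivity) (fun i hi => ?_) hj
      beta_reduce
      rw [q0 i hi, sub_zero, abs_div, abs_of_pos hτ, div_le_iff₀ hτ, mul_comm]
      exact q1 i hi
    have b2 : ε * (L * τ + L * R) ≤ 2 * L * R := by
      have : ε * τ ≤ R := by nlinarith
      have : ε * R ≤ R := by nlinarith
      nlinarith
    have b3 : (ε * (L * τ + L * R)) ^ 2 ≤ (2 * L * R) ^ 2 :=
      pow_le_pow_left₀ (by positivity) b2 2
    have b4 : 0 ≤ 4 * (M * h) ^ 3 := by positivity
    calc _ ≤ ε ^ 2 * (M * h * (2 * (M * h * (L * τ + L * R))) ^ 2) := by gcongr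
      _ = 4 * (M * h) ^ 3 * (ε * (L * τ + L * R)) ^ 2 := by ring
      _ ≤ 4 * (M * h) ^ 3 * (2 * L * R) ^ 2 := mul_le_mul_of_nonneg_left b3 b4
      _ = _ := by ring
  have B2 : sqNorm h M (fun j => f (0 + 1) j - p (0 + 1) j) ≤ M * h * (2 * L * R) ^ 2 :=
    sqNorm_le_of_abs_le hh.le q1'
  have B3 : sqNorm h M (fun j => f 0 j - p 0 j) ≤ M * h * 0 ^ 2 :=
    sqNorm_le_of_abs_le hh.le fun j hj => by rw [q0 j hj]; simp
  have B4 : h * ∑ j ∈ Finset.Ico 1 M, (p (0 + 1) j + p 0 j)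
      * ((f (0 + 1) j - p (0 + 1) j) + (f 0 j - p 0 j)) / 2
      ≤ (sqNorm h M (p 1) + sqNorm h M (fun j => f 1 j - p 1 j)) / 4 := by
    have : (sqNorm h M (p 1) + sqNorm h M (fun j => f 1 j - p 1 j)) / 4
        = h * ∑ j ∈ Finset.Ico 1 M, (p 1 j ^ 2 + (f 1 j - p 1 j) ^ 2) / 4 := by
      unfold sqNorm
      rw [← Finset.sum_div, Finset.sum_add_distrib]
      ring
    rw [this]
    refine mul_le_mul_of_nonneg_left (Finset.sum_le_sum fun j hj => ?_) hh.le
    rw [p0 j hj, (H.init j (Finset.mem_Ico.1 hj).2.le).2]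
    nlinarith [sq_nonneg (p 1 j - (f 1 j - p 1 j))]
  have B5 : sqNorm h M (p 1) ≤ M * h * (L * R) ^ 2 := sqNorm_le_of_abs_le hh.le p1'
  have A' := mul_le_mul_of_nonneg_left A (by positivity : 0 ≤ 2 * L ^ 2 + 1)
  have pos : 0 ≤ M * h * (L * R) ^ 2 := by positivity
  unfold totalEnergy waveEnergy initConst
  simp only [zero_add] at *
  linarith

/-- Stability: the errors are bounded by the consistency error. -/
theorem bound (H : IsErrorSystem h M τ ε L R n e f p) (hh : 0 < h) (hM : 1 ≤ M)
    (hτ : 0 < τ) (hτ1 : τ ≤ 1) (hL : 0 ≤ L) (hε : 0 < ε) (hε1 : ε ≤ 1)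
    (hεR : ε ≤ R) (hτR : τ ^ 2 ≤ R) (hτG : τ * growthConst L (M * h) ≤ 1 / 2) {T : ℝ}
    (hnT : n * τ ≤ T) (k : ℕ) (hk : k ≤ n) :
    sqNorm h M (e k) + cellSq h M (dxPlus h (e k)) + sqNorm h M (f k)
      ≤ (12 + 4 * L ^ 2) * (Real.exp (4 * growthConst L (M * h) * T)
        * (initConst L (M * h) + 1)) * R ^ 2 := by
  have hI : 0 ≤ initConst L (M * h) := by unfold initConst; positivity
  have hG : 0 ≤ growthConst L (M * h) :=
    zero_le_one.trans (growthConst_ge_one hL (by positivity))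
  obtain _ | m := k
  · have a1 : sqNorm h M (e 0) ≤ M * h * 0 ^ 2 := sqNorm_le_of_abs_le hh.le fun j hj => by
      rw [(H.init j (Finset.mem_Ico.1 hj).2.le).1]; simp
    have a2 : sqNorm h M (f 0) ≤ M * h * 0 ^ 2 := sqNorm_le_of_abs_le hh.le fun j hj => by
      rw [(H.init j (Finset.mem_Ico.1 hj).2.le).2]; simp
    have a3 : cellSq h M (dxPlus h (e 0)) ≤ M * h * 0 ^ 2 :=
      cellSq_le_of_abs_le hh.le fun j hj => by
        unfold dxPlus; rw [(H.init _ hj).1, (H.init _ hj.le).1]; simp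
    have a4 : 0 ≤ (12 + 4 * L ^ 2) * (Real.exp (4 * growthConst L (M * h) * T)
        * (initConst L (M * h) + 1)) * R ^ 2 := by positivity
    linarith
  set q : ℕ → ℕ → ℝ := fun k j => f k j - p k j with hq
  have hYX : ∀ k, k + 1 ≤ n → coerciveEnergy h M τ ε e q k ≤ totalEnergy h M τ ε L e p q k :=
    fun k hk => coerciveEnergy_le_totalEnergy hh.le M τ ε L e p q k
      (H.source k (by omega)) (H.source (k + 1) hk)
  have hY : ∀ k, (sqNorm h M (e (k + 1)) + cellSq h M (dxPlus h (e (k + 1)))) / 2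
      + sqNorm h M (q (k + 1)) / 4 ≤ coerciveEnergy h M τ ε e q k := fun k => by
    have n1 := sqNorm_nonneg hh.le M (fun j => (e (k + 1) j - e k j) / τ)
    have n2 := sqNorm_nonneg hh.le M (e k)
    have n3 := cellSq_nonneg hh.le M (dxPlus h (e k))
    have n4 := sqNorm_nonneg hh.le M (q k)
    have n5 := mul_nonneg (sq_nonneg ε) (cellSq_nonneg hh.le M (potential h M τ q k))
    unfold coerciveEnergy kgEnergy
    linarith
  have hX0 : ∀ k, k + 1 ≤ n → 0 ≤ totalEnergy h M τ ε L e p q k := fun k hk => by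
    have n1 := sqNorm_nonneg hh.le M (e (k + 1))
    have n2 := cellSq_nonneg hh.le M (dxPlus h (e (k + 1)))
    have n3 := sqNorm_nonneg hh.le M (q (k + 1))
    linarith [hY k, hYX k hk]
  have hc : 0 ≤ τ * growthConst L (M * h) := by positivity
  have key := gronwall_discrete hc hτG (sq_nonneg R) (n := n - 1)
    (X := fun k => totalEnergy h M τ ε L e p q k) (fun k hk => hX0 k (by omega))
    (fun k hk => by
      have h1 := H.totalEnergy_step hh hM hτ hL hε hεR k (by omega)
      refine h1.trans ?_
      gcongr
      · exact hYX k (by omega)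
      · exact hYX (k + 1) (by omega)) m (by omega)
  have i0 := H.totalEnergy_zero_le (by omega) hh hτ hτ1 hL hε hε1 hεR hτR
  have hm : (m : ℝ) * τ ≤ T := by
    have : (m : ℝ) ≤ n := by exact_mod_cast (by omega)
    nlinarith
  have ex : Real.exp (4 * (τ * growthConst L (M * h)) * m)
      ≤ Real.exp (4 * growthConst L (M * h) * T) := by
    refine Real.exp_le_exp.2 ?_
    calc _ = 4 * growthConst L (M * h) * (m * τ) := by ring
      _ ≤ _ := by gcongr
  have hXm : totalEnergy h M τ ε L e p q m ≤ Real.exp (4 * growthConst L (M * h) * T)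
        * (initConst L (M * h) + 1) * R ^ 2 := by
    have h1 : totalEnergy h M τ ε L e p q 0 + R ^ 2 ≤ (initConst L (M * h) + 1) * R ^ 2 := by
      linarith
    have h2 : 0 ≤ (initConst L (M * h) + 1) * R ^ 2 := by positivity
    have h3 : Real.exp (4 * (τ * growthConst L (M * h)) * m)
        * (totalEnergy h M τ ε L e p q 0 + R ^ 2)
        ≤ Real.exp (4 * growthConst L (M * h) * T) * ((initConst L (M * h) + 1) * R ^ 2) :=
      (mul_le_mul_of_nonneg_left h1 (Real.exp_pos _).le).trans
        (mul_le_mul_of_nonneg_right ex h2)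
    linarith [sq_nonneg R]
  have hf : sqNorm h M (f (m + 1))
      ≤ 2 * sqNorm h M (q (m + 1)) + 2 * L ^ 2 * sqNorm h M (e (m + 1)) := by
    have : 2 * sqNorm h M (q (m + 1)) + 2 * L ^ 2 * sqNorm h M (e (m + 1))
        = h * ∑ j ∈ Finset.Ico 1 M, (2 * q (m + 1) j ^ 2 + 2 * L ^ 2 * e (m + 1) j ^ 2) := by
      unfold sqNorm
      rw [Finset.sum_add_distrib, ← Finset.mul_sum, ← Finset.mul_sum]
      ring
    rw [this]
    refine mul_le_mul_of_nonneg_left (Finset.sum_le_sum fun j hj => ?_) hh.le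
    have h1 : p (m + 1) j ^ 2 ≤ L ^ 2 * e (m + 1) j ^ 2 := by
      rw [← sq_abs (p (m + 1) j), ← sq_abs (e (m + 1) j), ← mul_pow]
      exact pow_le_pow_left₀ (abs_nonneg _) (H.source (m + 1) hk j hj) 2
    have h2 : f (m + 1) j = q (m + 1) j + p (m + 1) j := by simp only [hq]; ring
    rw [h2]
    nlinarith [sq_nonneg (q (m + 1) j - p (m + 1) j)]
  have n1 := sqNorm_nonneg hh.le M (e (m + 1))
  have n2 := cellSq_nonneg hh.le M (dxPlus h (e (m + 1)))
  have n3 := sqNorm_nonneg hh.le M (q (m + 1))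
  have y := (hY m).trans (hYX m hk)
  have e1 : sqNorm h M (e (m + 1)) ≤ 2 * totalEnergy h M τ ε L e p q m := by linarith
  have e2 := mul_le_mul_of_nonneg_left e1 (by positivity : 0 ≤ 2 * L ^ 2)
  calc _ ≤ (12 + 4 * L ^ 2) * totalEnergy h M τ ε L e p q m := by linarith
    _ ≤ (12 + 4 * L ^ 2) * (Real.exp (4 * growthConst L (M * h) * T)
        * (initConst L (M * h) + 1) * R ^ 2) := by gcongr
    _ = _ := by ring

end IsErrorSystem

/-! ### Solvability of one time step -/

/-- Extension by zero of a function on the interior grid points. -/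
def extendZero (M : ℕ) (y : Finset.Ico 1 M → ℝ) (j : ℕ) : ℝ :=
  if hj : j ∈ Finset.Ico 1 M then y ⟨j, hj⟩ else 0

lemma continuous_extendZero (M j : ℕ) : Continuous fun y => extendZero M y j := by
  unfold extendZero
  split_ifs with hj
  · exact continuous_apply _
  · exact continuous_const

lemma extendZero_add_smul (M : ℕ) (y v : Finset.Ico 1 M → ℝ) (t : ℝ) (j : ℕ) :
    extendZero M (y + t • v) j = extendZero M y j + t * extendZero M v j := by
  unfold extendZero
  split_ifs <;> simp

/-- A discrete elliptic equation with a bounded continuous nonlinearity `φ j` that acts at each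
grid point separately has a solution: a minimiser of the associated coercive functional. -/
theorem exists_elliptic_solution {h : ℝ} (hh : 0 < h) {M : ℕ} (hM : 1 ≤ M) {c : ℝ} (hc : 0 ≤ c)
    (d K : ℕ → ℝ) (hd : ∀ j ∈ Finset.Ico 1 M, 0 < d j) (φ : ℕ → ℝ → ℝ) (hφ : ∀ j, Continuous (φ j))
    (hK : ∀ j ∈ Finset.Ico 1 M, ∀ s, |φ j s| ≤ K j) :
    ∃ y : ℕ → ℝ, y 0 = 0 ∧ y M = 0 ∧
      ∀ j ∈ Finset.Ico 1 M, d j * y j - c * dxx h y j = φ j (y j) := by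
  have hprim : ∀ j s, HasDerivAt (fun s => ∫ r in (0 : ℝ)..s, φ j r) (φ j s) s := fun j s =>
    intervalIntegral.integral_hasDerivAt_right ((hφ j).intervalIntegrable _ _)
      (hφ j).aestronglyMeasurable.stronglyMeasurableAtFilter (hφ j).continuousAt
  set Φ : (Finset.Ico 1 M → ℝ) → ℝ := fun y =>
    ∑ j ∈ Finset.Ico 1 M, (d j * extendZero M y j ^ 2 / 2
      - ∫ r in (0 : ℝ)..extendZero M y j, φ j r)
    + c / 2 * ∑ i ∈ Finset.range M, dxPlus h (extendZero M y) i ^ 2 with hΦ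
  have hcont : Continuous Φ := by
    have h1 : ∀ j, Continuous fun y => ∫ r in (0 : ℝ)..extendZero M y j, φ j r := fun j =>
      (continuous_iff_continuousAt.2 fun s => (hprim j s).continuousAt).comp
        (continuous_extendZero M j)
    have h2 := continuous_extendZero M
    simp only [hΦ, dxPlus]
    fun_prop
  -- `-Q` bounds the functional from below; it is nonnegative where `‖y‖ > √Q'`
  set Q : ℝ := ∑ j ∈ Finset.Ico 1 M, K j ^ 2 / d j with hQ
  set Q' : ℝ := ∑ j ∈ Finset.Ico 1 M, 4 * Q / d j with hQ'
  have hQ0 : 0 ≤ Q := Finset.sum_nonneg fun j hj => div_nonneg (sq_nonneg (K j)) (hd j hj).le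
  have hlow : ∀ y, ∑ j ∈ Finset.Ico 1 M, d j * extendZero M y j ^ 2 / 4 - Q ≤ Φ y := by
    intro y
    rw [hQ, ← Finset.sum_sub_distrib]
    have hpos : 0 ≤ c / 2 * ∑ i ∈ Finset.range M, dxPlus h (extendZero M y) i ^ 2 :=
      mul_nonneg (by linarith) (Finset.sum_nonneg fun _ _ => sq_nonneg _)
    refine le_trans (Finset.sum_le_sum fun j hj => ?_) (le_add_of_nonneg_right hpos)
    have hdj := hd j hj
    have hb : ‖∫ r in (0 : ℝ)..extendZero M y j, φ j r‖ ≤ K j * |extendZero M y j - 0| :=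
      intervalIntegral.norm_integral_le_of_norm_le_const fun s _ => hK j hj s
    rw [sub_zero, Real.norm_eq_abs] at hb
    have hb' := (le_abs_self _).trans hb
    have hsq : K j * |extendZero M y j| ≤ d j * |extendZero M y j| ^ 2 / 4 + K j ^ 2 / d j := by
      have : d j * |extendZero M y j| ^ 2 / 4 + K j ^ 2 / d j - K j * |extendZero M y j|
          = (d j * |extendZero M y j| / 2 - K j) ^ 2 / d j := by
        field_simp; ring
      have h2 : 0 ≤ (d j * |extendZero M y j| / 2 - K j) ^ 2 / d j := by positivity
      linarith
    rw [sq_abs] at hsq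
    linarith
  have hzero : Φ 0 = 0 := by
    have : ∀ j, extendZero M 0 j = 0 := fun j => by unfold extendZero; simp
    simp [hΦ, dxPlus, this]
  obtain ⟨y, hy⟩ := hcont.exists_forall_le' 0 (by
    refine Filter.mem_of_superset
      (isCompact_closedBall (0 : Finset.Ico 1 M → ℝ) (√Q')).compl_mem_cocompact fun y hy => ?_
    change Φ 0 ≤ Φ y
    rw [hzero]
    by_contra hneg
    refine hy (mem_closedBall_zero_iff.2 ((pi_norm_le_iff_of_nonneg (Real.sqrt_nonneg _)).2
      fun i => ?_))
    have h1 : ∑ j ∈ Finset.Ico 1 M, d j * extendZero M y j ^ 2 / 4 ≤ Q := by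
      linarith [hlow y]
    have h2 : d i * extendZero M y i ^ 2 / 4 ≤ Q :=
      (Finset.single_le_sum (f := fun j => d j * extendZero M y j ^ 2 / 4)
        (fun j hj => by have := hd j hj; positivity) i.2).trans h1
    have h3 : extendZero M y i ^ 2 ≤ 4 * Q / d i := by
      rw [le_div_iff₀ (hd i i.2)]; linarith
    have h4 : extendZero M y i ^ 2 ≤ Q' := h3.trans
      (Finset.single_le_sum (f := fun j => 4 * Q / d j)
        (fun j hj => by have := hd j hj; positivity) i.2)
    have h5 : extendZero M y i = y i := by
      unfold extendZero; rw [dif_pos i.2]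
    rw [h5] at h4
    exact Real.abs_le_sqrt h4)
  refine ⟨extendZero M y, by simp [extendZero], by simp [extendZero], fun j hj => ?_⟩
  -- the Euler-Lagrange equation, tested with the unit vector at the grid point `j`
  set v : Finset.Ico 1 M → ℝ := Pi.single ⟨j, hj⟩ 1 with hv
  have hve : ∀ i, extendZero M v i = if i = j then 1 else 0 := by
    intro i
    unfold extendZero
    by_cases hij : i = j
    · subst hij; rw [dif_pos hj, hv]; simp
    · split_ifs
      · rw [hv, Pi.single_apply, if_neg]; simpa using hij
      · rfl
  set z := extendZero M y with hz
  set w := extendZero M v with hw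
  have hder : HasDerivAt (fun t : ℝ => Φ (y + t • v))
      (∑ i ∈ Finset.Ico 1 M, (d i * z i * w i - φ i (z i) * w i)
        + c * ∑ i ∈ Finset.range M, dxPlus h z i * dxPlus h w i) 0 := by
    have hl : ∀ i, HasDerivAt (fun t : ℝ => extendZero M (y + t • v) i) (w i) 0 := fun i => by
      simp only [extendZero_add_smul]
      simpa using ((hasDerivAt_id (0 : ℝ)).mul_const (w i)).const_add (z i)
    have h0 : ∀ i, extendZero M (y + (0 : ℝ) • v) i = z i := fun i => by simp [hz]
    have s1 : HasDerivAt (fun t : ℝ => ∑ j ∈ Finset.Ico 1 M,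
        (d j * extendZero M (y + t • v) j ^ 2 / 2
          - ∫ r in (0 : ℝ)..extendZero M (y + t • v) j, φ j r))
        (∑ i ∈ Finset.Ico 1 M, (d i * z i * w i - φ i (z i) * w i)) 0 := by
      refine HasDerivAt.fun_sum fun i _ => ?_
      have a1 := (((hl i).pow 2).const_mul (d i)).div_const 2
      have a2 : HasDerivAt (fun t : ℝ => ∫ r in (0 : ℝ)..extendZero M (y + t • v) i, φ i r)
          (φ i (z i) * w i) 0 := by
        have := hprim i (extendZero M (y + (0 : ℝ) • v) i)
        have := this.comp 0 (hl i)
        rwa [h0] at this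
      refine (a1.sub a2).congr_deriv ?_
      simp only [h0]
      push_cast
      ring
    have s2 : HasDerivAt (fun t : ℝ => ∑ i ∈ Finset.range M,
        dxPlus h (extendZero M (y + t • v)) i ^ 2)
        (∑ i ∈ Finset.range M, 2 * (dxPlus h z i * dxPlus h w i)) 0 := by
      refine HasDerivAt.fun_sum fun i _ => ?_
      have a1 := (((hl (i + 1)).sub (hl i)).div_const h).pow 2
      refine a1.congr_deriv ?_
      simp only [Pi.sub_apply, h0, dxPlus]
      push_cast
      ring
    refine (s1.add (s2.const_mul (c / 2))).congr_deriv ?_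
    rw [← Finset.mul_sum]
    ring
  have hmin : IsLocalMin (fun t : ℝ => Φ (y + t • v)) 0 :=
    Filter.Eventually.of_forall fun t => by simpa using hy (y + t • v)
  have hcrit := hmin.hasDerivAt_eq_zero hder
  rw [sum_dxPlus_mul_dxPlus hh.ne' hM z w (by simp [hw, extendZero]) (by simp [hw, extendZero]),
    mul_neg, Finset.mul_sum, ← sub_eq_add_neg, ← Finset.sum_sub_distrib,
    Finset.sum_eq_single_of_mem j hj (fun i _ hi => by rw [hve, if_neg hi]; ring), hve,
    if_pos rfl] at hcrit
  linarith

/-- One time step from the levels `(u₀, v₀)` and `(u, v)` to `(y, z)`: the equation for `y` does not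
contain `z`, and the one for `z` is linear once `y` is known. -/
lemma exists_scheme_step {h : ℝ} (hh : 0 < h) {M : ℕ} (hM : 1 ≤ M) {τ ε : ℝ} (hτ : 0 < τ)
    {r : ℝ → ℝ} {g : ℝ → ℝ → ℝ} {K : ℝ} (hg : ∀ y, Continuous fun x => g x y)
    (hgK : ∀ x y, |g x y| ≤ K) (H : ℕ → ℝ)
    (hH : ∀ j ∈ Finset.Ico 1 M, 0 < 1 / τ ^ 2 + (1 + H j) / 2) (u₀ v₀ u v : ℕ → ℝ) :
    ∃ y z : ℕ → ℝ, y 0 = 0 ∧ y M = 0 ∧ z 0 = 0 ∧ z M = 0 ∧ ∀ j ∈ Finset.Ico 1 M,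
      (y j - 2 * u j + u₀ j) / τ ^ 2 = dxx h (fun i => (y i + u₀ i) / 2) j - (y j + u₀ j) / 2
        - H j * ((y j + u₀ j) / 2) + (r (u j) - v j) * g (y j) (u₀ j) ∧
      (z j - 2 * v j + v₀ j) / τ ^ 2 = 1 / ε ^ 2 * dxx h (fun i => (z i + v₀ i) / 2) j
        + (r (y j) - 2 * r (u j) + r (u₀ j)) / τ ^ 2 := by
  obtain ⟨y, y0, y1, hy⟩ := exists_elliptic_solution hh hM (c := 1 / 2) (by norm_num)
    (fun j => 1 / τ ^ 2 + (1 + H j) / 2)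
    (fun j => |(2 * u j - u₀ j) / τ ^ 2 + dxx h u₀ j / 2 - (1 + H j) / 2 * u₀ j|
      + |r (u j) - v j| * K) hH
    (fun j x => ((2 * u j - u₀ j) / τ ^ 2 + dxx h u₀ j / 2 - (1 + H j) / 2 * u₀ j)
      + (r (u j) - v j) * g x (u₀ j))
    (fun j => continuous_const.add (continuous_const.mul (hg _)))
    (fun j _ s => (abs_add_le _ _).trans (by
      rw [abs_mul]
      gcongr
      exact hgK _ _))
  obtain ⟨z, z0, z1, hz⟩ := exists_elliptic_solution hh hM (c := 1 / (2 * ε ^ 2)) (by positivity)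
    (fun _ => 1 / τ ^ 2)
    (fun j => |(2 * v j - v₀ j) / τ ^ 2 + 1 / (2 * ε ^ 2) * dxx h v₀ j
      + (r (y j) - 2 * r (u j) + r (u₀ j)) / τ ^ 2|) (fun _ _ => by positivity)
    (fun j _ => (2 * v j - v₀ j) / τ ^ 2 + 1 / (2 * ε ^ 2) * dxx h v₀ j
      + (r (y j) - 2 * r (u j) + r (u₀ j)) / τ ^ 2)
    (fun j => continuous_const) (fun j _ s => le_rfl)
  refine ⟨y, z, y0, y1, z0, z1, fun j hj => ⟨?_, ?_⟩⟩
  · have e : dxx h (fun i => (y i + u₀ i) / 2) j = (dxx h y j + dxx h u₀ j) / 2 := by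
      unfold dxx; ring
    rw [e]
    linear_combination hy j hj
  · have e : dxx h (fun i => (z i + v₀ i) / 2) j = (dxx h z j + dxx h v₀ j) / 2 := by
      unfold dxx; ring
    rw [e]
    linear_combination hz j hj

/-! ### The grid, and existence of numerical solutions -/

section grid

variable {a b : ℝ} {M : ℕ}

lemma mesh_pos (hab : a < b) (hM : 1 ≤ M) : 0 < mesh a b M :=
  div_pos (sub_pos.2 hab) (by exact_mod_cast hM)

lemma natCast_mul_mesh (hM : 1 ≤ M) : M * mesh a b M = b - a := by
  have : (M : ℝ) ≠ 0 := by positivity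
  unfold mesh; field_simp

lemma node_zero : node a b M 0 = a := by simp [node]

lemma node_last (hM : 1 ≤ M) : node a b M M = b := by
  unfold node; rw [natCast_mul_mesh hM]; ring

lemma node_succ (j : ℕ) : node a b M (j + 1) = node a b M j + mesh a b M := by
  unfold node; push_cast; ring

lemma node_pred {j : ℕ} (hj : 1 ≤ j) : node a b M (j - 1) = node a b M j - mesh a b M := by
  obtain ⟨i, rfl⟩ := Nat.exists_eq_add_of_le' hj
  rw [Nat.add_sub_cancel, node_succ]; ring

lemma node_mem (hab : a < b) (hM : 1 ≤ M) {j : ℕ} (hj : j ≤ M) : node a b M j ∈ Icc a b := by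
  have hm := (mesh_pos hab hM).le
  have h1 : (j : ℝ) * mesh a b M ≤ M * mesh a b M := by gcongr
  rw [natCast_mul_mesh hM] at h1
  have h2 : 0 ≤ (j : ℝ) * mesh a b M := by positivity
  unfold node
  constructor <;> linarith

lemma node_stencil (hab : a < b) (hM : 1 ≤ M) {j : ℕ} (hj : j ∈ Finset.Ico 1 M) :
    a ≤ node a b M j - mesh a b M ∧ node a b M j + mesh a b M ≤ b := by
  obtain ⟨h1, h2⟩ := Finset.mem_Ico.1 hj
  rw [← node_pred h1, ← node_succ]
  exact ⟨(node_mem hab hM (by omega)).1, (node_mem hab hM (by omega)).2⟩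

end grid

/-- The scheme has a solution as soon as the implicit operator is positive: each time step is a
semilinear elliptic problem for `E`, followed by a linear one for `F`. -/
theorem exists_cutoffScheme {a b T α ε τ : ℝ} (hab : a < b) {M : ℕ} (hM : 1 ≤ M) (hτ : 0 < τ)
    {ρ : ℝ → ℝ} {B K : ℝ} {E₀ E₁ ω₀ : ℝ → ℝ} {G : ℝ → ℝ → ℝ}
    (hg : ∀ y, Continuous fun x => gB ρ B x y) (hgK : ∀ x y, |gB ρ B x y| ≤ K)
    (h0 : E₀ a = 0) (h1 : E₀ b = 0)
    (hG : ∀ k : ℕ, 1 ≤ k → ((k + 1 : ℕ) : ℝ) ≤ T / τ → ∀ j ∈ Finset.Ico 1 M,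
      0 < 1 / τ ^ 2 + (1 + avgPotential τ G (node a b M j) k) / 2) :
    ∃ U V : ℕ → ℕ → ℝ, IsCutoffScheme a b T α ε τ M ρ B E₀ E₁ ω₀ G U V := by
  have hh := mesh_pos hab hM
  have step : ∀ (k : ℕ) (u₀ v₀ u v : ℕ → ℝ),
      ∃ y z : ℕ → ℝ, y 0 = 0 ∧ y M = 0 ∧ z 0 = 0 ∧ z M = 0 ∧
        (1 ≤ k → ((k + 1 : ℕ) : ℝ) ≤ T / τ → ∀ j ∈ Finset.Ico 1 M,
      (y j - 2 * u j + u₀ j) / τ ^ 2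
        = dxx (mesh a b M) (fun i => (y i + u₀ i) / 2) j - (y j + u₀ j) / 2
        - avgPotential τ G (node a b M j) k * ((y j + u₀ j) / 2)
        + (rhoB ρ B (u j) - v j) * gB ρ B (y j) (u₀ j) ∧
      (z j - 2 * v j + v₀ j) / τ ^ 2
        = 1 / ε ^ 2 * dxx (mesh a b M) (fun i => (z i + v₀ i) / 2) j
        + (rhoB ρ B (y j) - 2 * rhoB ρ B (u j) + rhoB ρ B (u₀ j)) / τ ^ 2) := by
    intro k u₀ v₀ u v
    by_cases hk : 1 ≤ k ∧ ((k + 1 : ℕ) : ℝ) ≤ T / τ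
    · obtain ⟨y, z, a1, a2, a3, a4, a5⟩ := exists_scheme_step (ε := ε) hh hM hτ
        (r := rhoB ρ B) hg hgK (fun j => avgPotential τ G (node a b M j) k)
        (hG k hk.1 hk.2) u₀ v₀ u v
      exact ⟨y, z, a1, a2, a3, a4, fun _ _ => a5⟩
    · exact ⟨0, 0, rfl, rfl, rfl, rfl, fun k1 k2 => (hk ⟨k1, k2⟩).elim⟩
  choose y z y0 y1 z0 z1 hyz using step
  -- the two latest time levels of both unknowns
  let s : ℕ → (ℕ → ℝ) × (ℕ → ℝ) × (ℕ → ℝ) × (ℕ → ℝ) := fun k => Nat.rec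
    (fun j => E₀ (node a b M j), fun _ => 0,
      fun j => if j ∈ Finset.Ico 1 M then E₀ (node a b M j) + τ * E₁ (node a b M j)
        + τ ^ 2 / 2 * initDttE α ε E₀ ω₀ (node a b M j) else 0,
      fun j => if j ∈ Finset.Ico 1 M then τ ^ 2 / 2 * initDttF α ε E₀ E₁ ω₀ (node a b M j) else 0)
    (fun k p => (p.2.2.1, p.2.2.2, y (k + 1) p.1 p.2.1 p.2.2.1 p.2.2.2,
      z (k + 1) p.1 p.2.1 p.2.2.1 p.2.2.2)) k
  refine ⟨fun k => (s k).1, fun k => (s k).2.1, ⟨?_, ?_, ?_, ?_⟩⟩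
  · intro k
    match k with
    | 0 => exact ⟨by simp [s, node_zero, h0], by simp [s, node_last hM, h1], rfl, rfl⟩
    | 1 => simp [s]
    | k + 2 => exact ⟨y0 _ _ _ _ _, y1 _ _ _ _ _, z0 _ _ _ _ _, z1 _ _ _ _ _⟩
  · exact fun j _ => ⟨rfl, rfl⟩
  · intro j hj
    exact ⟨if_pos hj, if_pos hj⟩
  · intro k hk hkT j hj
    obtain ⟨m, rfl⟩ : ∃ m, k = m + 1 := ⟨k - 1, by omega⟩
    exact hyz (m + 1) (s m).1 (s m).2.1 (s m).2.2.1 (s m).2.2.2 hk hkT j hj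

/-! ### Finite differences of functions with bounded weak derivatives -/

open scoped Convolution

lemma iteratedDeriv_comp_const_sub_eq (ψ : ℝ → ℝ) (x : ℝ) (i : ℕ) :
    iteratedDeriv i (fun t => ψ (x - t)) = fun t => (-1) ^ i * iteratedDeriv i ψ (x - t) := by
  induction i with
  | zero => simp
  | succ i ih =>
    rw [iteratedDeriv_succ, ih, iteratedDeriv_succ]
    funext t
    rw [deriv_const_mul_field, deriv_comp_const_sub (f := iteratedDeriv i ψ)]
    ring

/-- Mollification of a function with a bounded weak derivative: the classical derivative of the
mollified function obeys the same bound. -/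
lemma abs_convolution_iteratedDeriv_le {a b : ℝ} {i : ℕ} {v vbar w : ℝ → ℝ} {C : ℝ} (hC : 0 ≤ C)
    (hw : IsWeakDeriv a b i v w) (hv : ∀ x ∈ Ioo a b, vbar x = v x)
    (hwC : ∀ᵐ x ∂volume.restrict (Ioo a b), |w x| ≤ C) (φ : ContDiffBump (0 : ℝ)) {x : ℝ}
    (hx : a < x - φ.rOut) (hx' : x + φ.rOut < b) :
    |(iteratedDeriv i (φ.normed volume) ⋆[ContinuousLinearMap.lsmul ℝ ℝ] vbar) x| ≤ C := by
  set ψ := φ.normed volume with hψ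
  have hψs : ContDiff ℝ ∞ ψ := φ.contDiff_normed
  have hsup : tsupport (fun t => ψ (x - t)) ⊆ Ioo a b := by
    have h1 : tsupport (fun t => ψ (x - t)) ⊆ Icc (x - φ.rOut) (x + φ.rOut) := by
      refine closure_minimal (fun t ht => ?_) isClosed_Icc
      have h2 : x - t ∈ Function.support ψ := ht
      rw [φ.support_normed_eq, mem_ball_zero_iff, Real.norm_eq_abs, abs_lt] at h2
      constructor <;> linarith
    exact h1.trans fun t ht => ⟨hx.trans_le ht.1, ht.2.trans_lt hx'⟩
  have hcs : HasCompactSupport (fun t => ψ (x - t)) :=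
    (φ.hasCompactSupport_normed (μ := volume)).comp_homeomorph (Homeomorph.subLeft x)
  have hsm : ContDiff ℝ ∞ (fun t => ψ (x - t)) := hψs.comp (contDiff_const.sub contDiff_id)
  have h1 := hw.2.2 _ hsm hcs hsup
  have hD : ∀ t ∉ Ioo a b, iteratedDeriv i ψ (x - t) = 0 := by
    intro t ht
    have h2 : iteratedDeriv i (fun t => ψ (x - t)) t = 0 := by
      by_contra h3
      have h4 := support_iteratedFDeriv_subset (𝕜 := ℝ) (f := fun t => ψ (x - t)) i
      refine ht (hsup (h4 ?_))
      intro h5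
      rw [iteratedDeriv_eq_iteratedFDeriv, h5] at h3
      simp at h3
    rw [iteratedDeriv_comp_const_sub_eq] at h2
    rcases mul_eq_zero.1 h2 with h3 | h3
    · exact absurd h3 (by simp)
    · exact h3
  have e1 : (iteratedDeriv i ψ ⋆[ContinuousLinearMap.lsmul ℝ ℝ] vbar) x
      = ∫ t in Ioo a b, w t * ψ (x - t) := by
    rw [convolution_lsmul_swap]
    have : ∫ t, iteratedDeriv i ψ (x - t) • vbar t
        = ∫ t in Ioo a b, iteratedDeriv i ψ (x - t) * vbar t := by
      rw [setIntegral_eq_integral_of_forall_compl_eq_zero]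
      · rfl
      · intro t ht; rw [hD t ht, zero_mul]
    rw [this]
    rw [iteratedDeriv_comp_const_sub_eq] at h1
    have h2 : ∫ t in Ioo a b, v t * ((-1) ^ i * iteratedDeriv i ψ (x - t))
        = (-1) ^ i * ∫ t in Ioo a b, iteratedDeriv i ψ (x - t) * vbar t := by
      rw [← integral_const_mul]
      refine setIntegral_congr_fun measurableSet_Ioo fun t ht => ?_
      simp only [hv t ht]
      ring
    rw [h2] at h1
    exact mul_left_cancel₀ (by simp) h1
  rw [e1]
  have hint : Integrable (fun t => C * ψ (x - t)) :=
    (hsm.continuous.integrable_of_hasCompactSupport hcs).const_mul C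
  have h3 := norm_integral_le_of_norm_le (f := fun t => w t * ψ (x - t))
    (hint.mono_measure Measure.restrict_le_self : Integrable _ (volume.restrict (Ioo a b)))
    (hwC.mono fun t ht => by
      rw [norm_mul, Real.norm_eq_abs, Real.norm_of_nonneg (φ.nonneg_normed _)]
      exact mul_le_mul_of_nonneg_right ht (φ.nonneg_normed _))
  refine h3.trans ?_
  have h4 : ∫ t in Ioo a b, C * ψ (x - t) ≤ ∫ t, C * ψ (x - t) :=
    setIntegral_le_integral hint (Filter.Eventually.of_forall fun t =>
      mul_nonneg hC (φ.nonneg_normed _))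
  refine h4.trans (le_of_eq ?_)
  rw [integral_const_mul, integral_sub_left_eq_self ψ volume x, hψ, φ.integral_normed, mul_one]

lemma hasDerivAt_convolution_iteratedDeriv (φ : ContDiffBump (0 : ℝ)) {vbar : ℝ → ℝ}
    (hv : Continuous vbar) (i : ℕ) (x : ℝ) :
    HasDerivAt (iteratedDeriv i (φ.normed volume) ⋆[ContinuousLinearMap.lsmul ℝ ℝ] vbar)
      ((iteratedDeriv (i + 1) (φ.normed volume) ⋆[ContinuousLinearMap.lsmul ℝ ℝ] vbar) x) x := by
  rw [iteratedDeriv_succ]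
  have hcs : ∀ i, HasCompactSupport (iteratedDeriv i (φ.normed (volume : Measure ℝ))) := fun i => by
    induction i with
    | zero => simpa using φ.hasCompactSupport_normed
    | succ i ih => rw [iteratedDeriv_succ]; exact ih.deriv
  have hs : ContDiff ℝ ∞ (φ.normed (volume : Measure ℝ)) := φ.contDiff_normed
  have hsi : ContDiff ℝ ∞ (iteratedDeriv i (φ.normed (volume : Measure ℝ))) := by
    rw [iteratedDeriv_eq_iterate]; exact hs.iterate_deriv i
  exact (hcs i).hasDerivAt_convolution_left _ (hsi.of_le (by simp)) hv.locallyIntegrable x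

lemma exists_contDiffBump_seq :
    ∃ φ : ℕ → ContDiffBump (0 : ℝ), Filter.Tendsto (fun n => (φ n).rOut) Filter.atTop (nhds 0) := by
  have hp : ∀ n : ℕ, 0 < 1 / ((n : ℝ) + 1) := fun n => Nat.one_div_pos_of_nat
  exact ⟨fun n => ⟨1 / ((n : ℝ) + 1) / 2, 1 / ((n : ℝ) + 1), half_pos (hp n), half_lt_self (hp n)⟩,
    tendsto_one_div_add_atTop_nhds_zero_nat⟩

/-- Mean value inequality on `[0, s]`. -/
lemma abs_sub_le_of_hasDerivWithinAt {g g' : ℝ → ℝ} {K S : ℝ}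
    (hg : ∀ s ∈ Icc 0 S, HasDerivWithinAt g (g' s) (Icc 0 S) s)
    (hK : ∀ s ∈ Icc 0 S, |g' s| ≤ K) {s : ℝ} (hs : s ∈ Icc 0 S) : |g s - g 0| ≤ K * s := by
  have := (convex_Icc 0 S).norm_image_sub_le_of_norm_hasDerivWithin_le hg hK
    (left_mem_Icc.2 (hs.1.trans hs.2)) hs
  rwa [sub_zero, Real.norm_eq_abs, Real.norm_of_nonneg hs.1] at this

section weakDerivatives

variable {a b C : ℝ} {v w : ℝ → ℝ}

/-- A continuous function `v` with a weak derivative of order `i` bounded by `C` is approximated,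
away from the end points, by smooth functions `u n 0` with classical derivatives `u n m` and the
same bound of the `i`-th one. -/
lemma exists_approximation_of_isWeakDeriv {i : ℕ} (hab : a < b) (hv : ContinuousOn v (Icc a b)) (hC : 0 ≤ C)
    (hw : IsWeakDeriv a b i v w) (hwC : ∀ᵐ x ∂volume.restrict (Ioo a b), |w x| ≤ C)
    {c d : ℝ} (hc : a < c) (hd : d < b) :
    ∃ u : ℕ → ℕ → ℝ → ℝ,
      (∀ x ∈ Icc c d, Filter.Tendsto (fun n => u n 0 x) Filter.atTop (nhds (v x))) ∧
      (∀ n m x, HasDerivAt (u n m) (u n (m + 1) x) x) ∧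
      ∀ᶠ n in Filter.atTop, ∀ x ∈ Icc c d, |u n i x| ≤ C := by
  obtain ⟨φ, hφ⟩ := exists_contDiffBump_seq
  set vbar : ℝ → ℝ := IccExtend hab.le ((Icc a b).domRestrict v) with hvb
  have hvc : Continuous vbar := hv.domRestrict.Icc_extend'
  have hvv : ∀ x ∈ Icc a b, vbar x = v x := fun x hx => by
    rw [hvb, IccExtend_of_mem _ _ hx]; rfl
  refine ⟨fun n m => iteratedDeriv m ((φ n).normed volume)
    ⋆[ContinuousLinearMap.lsmul ℝ ℝ] vbar, fun x hx => ?_,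
    fun n m x => hasDerivAt_convolution_iteratedDeriv (φ n) hvc m x, ?_⟩
  · have := ContDiffBump.convolution_tendsto_right_of_continuous (μ := volume) hφ hvc x
    rw [hvv x ⟨(hc.trans_le hx.1).le, (hx.2.trans_lt hd).le⟩] at this
    simpa only [iteratedDeriv_zero] using this
  · have h1 : ∀ᶠ n in Filter.atTop, (φ n).rOut < min (c - a) (b - d) :=
      hφ.eventually_lt_const (lt_min (sub_pos.2 hc) (sub_pos.2 hd))
    filter_upwards [h1] with n hn x hx
    have h2 := hn.trans_le (min_le_left _ _)
    have h3 := hn.trans_le (min_le_right _ _)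
    exact abs_convolution_iteratedDeriv_le hC hw (fun x hx => hvv x (Ioo_subset_Icc_self hx)) hwC
      (φ n) (by linarith [hx.1]) (by linarith [hx.2])

lemma abs_le_of_isWeakDeriv (hab : a < b) (hv : ContinuousOn v (Icc a b)) (hC : 0 ≤ C)
    (hw : IsWeakDeriv a b 0 v w) (hwC : ∀ᵐ x ∂volume.restrict (Ioo a b), |w x| ≤ C)
    {x : ℝ} (hx : x ∈ Icc a b) : |v x| ≤ C := by
  rw [← closure_Ioo hab.ne] at hv hx
  refine le_on_closure (f := fun x => |v x|) (g := fun _ => C) (fun x hx => ?_)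
    hv.abs continuousOn_const hx
  rw [closure_Ioo hab.ne] at hv
  obtain ⟨u, h1, -, h3⟩ := exists_approximation_of_isWeakDeriv hab hv hC hw hwC hx.1 hx.2
  exact le_of_tendsto (h1 x (by simp)).abs (h3.mono fun n hn => hn x (by simp))

lemma abs_sub_le_of_isWeakDeriv (hab : a < b) (hv : ContinuousOn v (Icc a b)) (hC : 0 ≤ C)
    (hw : IsWeakDeriv a b 1 v w) (hwC : ∀ᵐ x ∂volume.restrict (Ioo a b), |w x| ≤ C)
    {x y : ℝ} (hx : x ∈ Icc a b) (hy : y ∈ Icc a b) : |v y - v x| ≤ C * |y - x| := by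
  have key : ∀ x ∈ Ioo a b, ∀ y ∈ Ioo a b, |v y - v x| ≤ C * |y - x| := by
    intro x hx y hy
    obtain ⟨u, h1, h2, h3⟩ := exists_approximation_of_isWeakDeriv (c := min x y) (d := max x y)
      hab hv hC hw hwC
      (lt_min hx.1 hy.1) (max_lt hx.2 hy.2)
    have mx : x ∈ Icc (min x y) (max x y) := ⟨min_le_left _ _, le_max_left _ _⟩
    have my : y ∈ Icc (min x y) (max x y) := ⟨min_le_right _ _, le_max_right _ _⟩
    refine le_of_tendsto ((h1 y my).sub (h1 x mx)).abs (h3.mono fun n hn => ?_)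
    exact (convex_Icc _ _).norm_image_sub_le_of_norm_hasDerivWithin_le
      (fun z _ => (h2 n 0 z).hasDerivWithinAt) (fun z hz => hn z hz) mx my
  have hc := closure_Ioo hab.ne
  rw [← hc] at hv hx hy
  have key2 : ∀ x ∈ Ioo a b, |v y - v x| ≤ C * |y - x| := fun x hx =>
    le_on_closure (f := fun y => |v y - v x|) (g := fun y => C * |y - x|) (key x hx)
      (hv.sub continuousOn_const).abs (by fun_prop) hy
  exact le_on_closure (f := fun x => |v y - v x|) (g := fun x => C * |y - x|) key2
      (continuousOn_const.sub hv).abs (by fun_prop) hx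

lemma abs_second_diff_le_of_isWeakDeriv (hab : a < b) (hv : ContinuousOn v (Icc a b)) (hC : 0 ≤ C)
    (hw : IsWeakDeriv a b 2 v w) (hwC : ∀ᵐ x ∂volume.restrict (Ioo a b), |w x| ≤ C)
    {x s : ℝ} (hs : 0 ≤ s) (hx : a ≤ x - s) (hx' : x + s ≤ b) :
    |v (x + s) - 2 * v x + v (x - s)| ≤ 2 * C * s ^ 2 := by
  rcases hs.eq_or_lt with rfl | hs
  · simp; ring_nf
  have key : ∀ r ∈ Ioo 0 s, |v (x + r) - 2 * v x + v (x - r)| ≤ 2 * C * r ^ 2 := by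
    intro r hr
    obtain ⟨u, h1, h2, h3⟩ := exists_approximation_of_isWeakDeriv (c := x - r) (d := x + r)
      hab hv hC hw hwC
      (by linarith [hr.2]) (by linarith [hr.2])
    have hr0 := hr.1.le
    refine le_of_tendsto (((h1 (x + r) ⟨by linarith, le_rfl⟩).sub
      ((h1 x ⟨by linarith, by linarith⟩).const_mul 2)).add
        (h1 (x - r) ⟨le_rfl, by linarith⟩)).abs (h3.mono fun n hn => ?_)
    have d1 : ∀ t ∈ Icc 0 r, |u n 1 (x + t) - u n 1 (x - t)| ≤ 2 * C * r := fun t ht => by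
      have := (convex_Icc (x - r) (x + r)).norm_image_sub_le_of_norm_hasDerivWithin_le
        (fun z _ => (h2 n 1 z).hasDerivWithinAt) (fun z hz => hn z hz)
        (x := x - t) (y := x + t) ⟨by linarith [ht.2], by linarith [ht.1]⟩
        ⟨by linarith [ht.1], by linarith [ht.2]⟩
      rw [Real.norm_eq_abs, Real.norm_eq_abs, add_sub_sub_cancel,
        abs_of_nonneg (a := t + t) (by linarith [ht.1])] at this
      have := mul_le_mul_of_nonneg_left ht.2 hC
      linarith
    have d2 := abs_sub_le_of_hasDerivWithinAt (S := r)
      (g := fun t => u n 0 (x + t) + u n 0 (x - t))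
      (g' := fun t => u n 1 (x + t) - u n 1 (x - t)) (fun t _ => by
        have e1 := (h2 n 0 (x + t)).comp_const_add x t
        have e2 := (h2 n 0 (x - t)).comp_const_sub x t
        exact (e1.add e2).hasDerivWithinAt) d1 (s := r) ⟨hr0, le_rfl⟩
    simp only [add_zero, sub_zero] at d2
    calc _ = |u n 0 (x + r) + u n 0 (x - r) - (u n 0 x + u n 0 x)| := by congr 1; ring
      _ ≤ _ := d2
      _ = _ := by ring
  have hcl := closure_Ioo hs.ne
  refine le_on_closure (f := fun r => |v (x + r) - 2 * v x + v (x - r)|)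
    (g := fun r => 2 * C * r ^ 2) key ?_ (by fun_prop) (hcl ▸ right_mem_Icc.2 hs.le)
  rw [hcl]
  refine ContinuousOn.abs (ContinuousOn.add (ContinuousOn.sub ?_ continuousOn_const) ?_)
  · exact hv.comp (by fun_prop) fun r hr => ⟨by linarith [hr.1], by linarith [hr.2]⟩
  · exact hv.comp (by fun_prop) fun r hr => ⟨by linarith [hr.2], by linarith [hr.1]⟩

/-- A weak derivative of order four of a `C²` function is a weak derivative of order two of its
second derivative. -/
lemma isWeakDeriv_two_of_four {v₁ v₂ : ℝ → ℝ} (hab : a < b)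
    (h1 : ∀ x ∈ Icc a b, HasDerivWithinAt v (v₁ x) (Icc a b) x)
    (h2 : ∀ x ∈ Icc a b, HasDerivWithinAt v₁ (v₂ x) (Icc a b) x)
    (hv₂ : ContinuousOn v₂ (Icc a b)) (hw : IsWeakDeriv a b 4 v w) : IsWeakDeriv a b 2 v₂ w := by
  refine ⟨(hv₂.mono Ioo_subset_Icc_self).locallyIntegrableOn measurableSet_Ioo, hw.2.1,
    fun φ hφ hφc hφs => ?_⟩
  have h4 := hw.2.2 φ hφ hφc hφs
  set θ := iteratedDeriv 2 φ with hθ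
  have hθ' : ContDiff ℝ ∞ θ := by
    rw [hθ, iteratedDeriv_eq_iterate]; exact hφ.iterate_deriv 2
  have hd : ∀ x, HasDerivAt θ (deriv θ x) x := fun x =>
    (hθ'.differentiable (by simp) x).hasDerivAt
  have hθ'' : ContDiff ℝ ∞ (deriv θ) := hθ'.iterate_deriv 1
  have hd' : ∀ x, HasDerivAt (deriv θ) (deriv (deriv θ) x) x := fun x =>
    (hθ''.differentiable (by simp) x).hasDerivAt
  have hθ3 : Continuous (deriv (deriv θ)) := (hθ''.iterate_deriv 1).continuous
  have e4 : iteratedDeriv 4 φ = deriv (deriv θ) := by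
    rw [hθ, iteratedDeriv_succ, iteratedDeriv_succ]
  have ts : tsupport θ ⊆ Ioo a b := by
    rw [hθ, iteratedDeriv_succ, iteratedDeriv_succ, iteratedDeriv_zero]
    exact (tsupport_deriv_subset.trans tsupport_deriv_subset).trans hφs
  have ts' : tsupport (deriv θ) ⊆ Ioo a b := tsupport_deriv_subset.trans ts
  have hc0 : ContinuousOn v (Icc a b) := fun x hx => (h1 x hx).continuousWithinAt
  have hc1 : ContinuousOn v₁ (Icc a b) := fun x hx => (h2 x hx).continuousWithinAt
  have F := intervalIntegral.integral_eq_sub_of_hasDerivAt_of_le hab.le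
    (f := fun x => v x * deriv θ x - v₁ x * θ x)
    (f' := fun x => v x * deriv (deriv θ) x - v₂ x * θ x)
    ((hc0.mul hθ''.continuous.continuousOn).sub (hc1.mul hθ'.continuous.continuousOn))
    (fun x hx => by
      have n := Icc_mem_nhds hx.1 hx.2
      have a1 := (h1 x (Ioo_subset_Icc_self hx)).hasDerivAt n
      have a2 := (h2 x (Ioo_subset_Icc_self hx)).hasDerivAt n
      refine ((a1.mul (hd' x)).sub (a2.mul (hd x))).congr_deriv ?_
      ring)
    (ContinuousOn.intervalIntegrable (by
      rw [uIcc_of_le hab.le]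
      exact (hc0.mul hθ3.continuousOn).sub (hv₂.mul hθ'.continuous.continuousOn)))
  have z1 : ∀ x ∉ Ioo a b, θ x = 0 := fun x hx =>
    image_eq_zero_of_notMem_tsupport fun h => hx (ts h)
  have z2 : ∀ x ∉ Ioo a b, deriv θ x = 0 := fun x hx =>
    image_eq_zero_of_notMem_tsupport fun h => hx (ts' h)
  rw [z1 a (by simp), z1 b (by simp), z2 a (by simp), z2 b (by simp),
    intervalIntegral.integral_of_le hab.le, integral_Ioc_eq_integral_Ioo, integral_sub] at F
  · rw [e4] at h4
    linarith
  · exact ((hc0.mul hθ3.continuousOn).integrableOn_Icc).mono_set Ioo_subset_Icc_self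
  · exact ((hv₂.mul hθ'.continuous.continuousOn).integrableOn_Icc).mono_set Ioo_subset_Icc_self

/-- Consistency of the second difference quotient. -/
lemma abs_second_diff_sub_le {v₁ v₂ : ℝ → ℝ} (hab : a < b)
    (h1 : ∀ x ∈ Icc a b, HasDerivWithinAt v (v₁ x) (Icc a b) x)
    (h2 : ∀ x ∈ Icc a b, HasDerivWithinAt v₁ (v₂ x) (Icc a b) x)
    (hv₂ : ContinuousOn v₂ (Icc a b)) (hC : 0 ≤ C) (hw : IsWeakDeriv a b 4 v w)
    (hwC : ∀ᵐ x ∂volume.restrict (Ioo a b), |w x| ≤ C)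
    {x s : ℝ} (hs : 0 ≤ s) (hx : a ≤ x - s) (hx' : x + s ≤ b) :
    |v (x + s) - 2 * v x + v (x - s) - s ^ 2 * v₂ x| ≤ 2 * C * s ^ 4 := by
  have hw2 := isWeakDeriv_two_of_four hab h1 h2 hv₂ hw
  have ip : ∀ t ∈ Icc 0 s, x + t ∈ Icc a b := fun t ht =>
    ⟨by linarith [ht.1], by linarith [ht.2]⟩
  have im : ∀ t ∈ Icc 0 s, x - t ∈ Icc a b := fun t ht =>
    ⟨by linarith [ht.2], by linarith [ht.1]⟩
  have dp : ∀ {f f' : ℝ → ℝ}, (∀ x ∈ Icc a b, HasDerivWithinAt f (f' x) (Icc a b) x) →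
      ∀ t ∈ Icc 0 s, HasDerivWithinAt (fun t => f (x + t)) (f' (x + t)) (Icc 0 s) t :=
    fun hf t ht => by
      have := (hf _ (ip t ht)).comp t (((hasDerivAt_id t).const_add x).hasDerivWithinAt) ip
      exact this.congr_deriv (by simp)
  have dm : ∀ {f f' : ℝ → ℝ}, (∀ x ∈ Icc a b, HasDerivWithinAt f (f' x) (Icc a b) x) →
      ∀ t ∈ Icc 0 s, HasDerivWithinAt (fun t => f (x - t)) (-f' (x - t)) (Icc 0 s) t :=
    fun hf t ht => by
      have := (hf _ (im t ht)).comp t (((hasDerivAt_id t).const_sub x).hasDerivWithinAt) im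
      exact this.congr_deriv (by simp)
  have b2 : ∀ t ∈ Icc 0 s, |v₂ (x + t) + v₂ (x - t) - 2 * v₂ x| ≤ 2 * C * s ^ 2 := fun t ht => by
    have := abs_second_diff_le_of_isWeakDeriv hab hv₂ hC hw2 hwC ht.1
      (x := x) (by linarith [ht.2]) (by linarith [ht.2])
    have e : v₂ (x + t) + v₂ (x - t) - 2 * v₂ x = v₂ (x + t) - 2 * v₂ x + v₂ (x - t) := by ring
    rw [e]
    refine this.trans ?_
    have := ht.1
    have := ht.2
    gcongr
  have b1 : ∀ t ∈ Icc 0 s, |v₁ (x + t) - v₁ (x - t) - 2 * t * v₂ x| ≤ 2 * C * s ^ 3 := by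
    intro t ht
    have := abs_sub_le_of_hasDerivWithinAt (g := fun t => v₁ (x + t) - v₁ (x - t) - 2 * t * v₂ x)
      (g' := fun t => v₂ (x + t) + v₂ (x - t) - 2 * v₂ x) (fun t ht => by
        have e := ((dp h2 t ht).sub (dm h2 t ht)).sub
          ((((hasDerivAt_id t).const_mul 2).mul_const (v₂ x)).hasDerivWithinAt)
        refine e.congr_deriv ?_
        ring) b2 ht
    simp only [add_zero, sub_zero, sub_self, mul_zero, zero_mul] at this
    refine this.trans ?_
    have : 2 * C * s ^ 2 * t ≤ 2 * C * s ^ 2 * s := by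
      have := ht.2
      gcongr
    linarith
  have b0 := abs_sub_le_of_hasDerivWithinAt
      (g := fun t => v (x + t) + v (x - t) - t ^ 2 * v₂ x)
      (g' := fun t => v₁ (x + t) - v₁ (x - t) - 2 * t * v₂ x) (fun t ht => by
        have e := ((dp h1 t ht).add (dm h1 t ht)).sub
          ((((hasDerivAt_id t).pow 2).mul_const (v₂ x)).hasDerivWithinAt)
        refine e.congr_deriv ?_
        simp
        ring) b1 ⟨hs, le_rfl⟩
  simp only [add_zero, sub_zero] at b0
  calc _ = |v (x + s) + v (x - s) - s ^ 2 * v₂ x - (v x + v x - 0 ^ 2 * v₂ x)| := by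
        congr 1; ring
    _ ≤ _ := b0
    _ = _ := by ring

end weakDerivatives

lemma ae_abs_le_of_linftyNorm_le {a b : ℝ} {w : ℝ → ℝ} {K : ℝ}
    (h : LinftyNorm a b w ≤ ENNReal.ofReal K) (hK : 0 ≤ K) :
    ∀ᵐ x ∂volume.restrict (Ioo a b), |w x| ≤ K := by
  have h1 := ae_le_eLpNormEssSup (f := w) (μ := volume.restrict (Ioo a b))
  unfold LinftyNorm at h
  rw [eLpNorm_exponent_top] at h
  filter_upwards [h1] with x hx
  have h2 := hx.trans h
  rw [Real.enorm_eq_ofReal_abs] at h2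
  exact (ENNReal.ofReal_le_ofReal_iff hK).1 h2

/-- The Sobolev norm is an infimum over weak derivatives, whence the margin `δ`. -/
lemma exists_isWeakDeriv_of_sobolevNorm_le {a b : ℝ} {m : ℕ} {v : ℝ → ℝ} {K : ℝ} (hK : 0 ≤ K)
    (h : sobolevNorm a b m v ≤ ENNReal.ofReal K) {δ : ℝ} (hδ : 0 < δ) :
    ∃ w : ℕ → ℝ → ℝ, ∀ i ≤ m, IsWeakDeriv a b i v (w i) ∧
      ∀ᵐ x ∂volume.restrict (Ioo a b), |w i x| ≤ K + δ := by
  have h1 : sobolevNorm a b m v < ENNReal.ofReal (K + δ) :=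
    h.trans_lt ((ENNReal.ofReal_lt_ofReal_iff (by linarith)).2 (by linarith))
  simp only [sobolevNorm, iInf_lt_iff] at h1
  obtain ⟨w, hw, hs⟩ := h1
  refine ⟨w, fun i hi => ⟨hw i hi, ae_abs_le_of_linftyNorm_le ?_ (by linarith)⟩⟩
  exact (Finset.single_le_sum (f := fun i => LinftyNorm a b (w i)) (fun _ _ => zero_le)
    (Finset.mem_range.2 (Nat.lt_succ_of_le hi))).trans hs.le

/-! ### Functions that are twice continuously differentiable on the closed rectangle -/

/-- Derivative of `f`, relative to `S`, in the direction `e`. -/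
noncomputable def dirDeriv (S : Set (ℝ × ℝ)) (e : ℝ × ℝ) (f : ℝ × ℝ → ℝ) (p : ℝ × ℝ) : ℝ :=
  fderivWithin ℝ f S p e

section slices

variable {S : Set (ℝ × ℝ)} {I : Set ℝ} {γ : ℝ → ℝ × ℝ} {e : ℝ × ℝ} {f : ℝ × ℝ → ℝ}

lemma contDiffOn_dirDeriv (hS : UniqueDiffOn ℝ S) (hf : ContDiffOn ℝ 2 f S) (e : ℝ × ℝ) :
    ContDiffOn ℝ 1 (dirDeriv S e f) S :=
  (hf.fderivWithin hS (m := 1) (by norm_num)).clm_apply contDiffOn_const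

lemma continuousOn_dirDeriv (hS : UniqueDiffOn ℝ S) (hf : ContDiffOn ℝ 1 f S) (e : ℝ × ℝ) :
    ContinuousOn (dirDeriv S e f) S :=
  (hf.continuousOn_fderivWithin hS le_rfl).clm_apply continuousOn_const

lemma hasDerivWithinAt_slice (hf : ContDiffOn ℝ 1 f S)
    (hγ : ∀ t ∈ I, HasDerivWithinAt γ e I t) (hm : MapsTo γ I S) {t : ℝ} (ht : t ∈ I) :
    HasDerivWithinAt (fun s => f (γ s)) (dirDeriv S e f (γ t)) I t :=
  ((hf.differentiableOn (by norm_num) _ (hm ht)).hasFDerivWithinAt).comp_hasDerivWithinAt t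
    (hγ t ht) hm

lemma iteratedDerivWithin_one_slice (hI : UniqueDiffOn ℝ I) (hf : ContDiffOn ℝ 1 f S)
    (hγ : ∀ t ∈ I, HasDerivWithinAt γ e I t) (hm : MapsTo γ I S) {t : ℝ} (ht : t ∈ I) :
    iteratedDerivWithin 1 (fun s => f (γ s)) I t = dirDeriv S e f (γ t) := by
  rw [iteratedDerivWithin_one]
  exact (hasDerivWithinAt_slice hf hγ hm ht).derivWithin (hI t ht)

lemma iteratedDerivWithin_two_slice (hS : UniqueDiffOn ℝ S) (hI : UniqueDiffOn ℝ I)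
    (hf : ContDiffOn ℝ 2 f S)
    (hγ : ∀ t ∈ I, HasDerivWithinAt γ e I t) (hm : MapsTo γ I S) {t : ℝ} (ht : t ∈ I) :
    iteratedDerivWithin 2 (fun s => f (γ s)) I t = dirDeriv S e (dirDeriv S e f) (γ t) := by
  rw [iteratedDerivWithin_succ, derivWithin_congr
    (fun s hs => iteratedDerivWithin_one_slice hI (hf.of_le (by norm_num)) hγ hm hs)
    (iteratedDerivWithin_one_slice hI (hf.of_le (by norm_num)) hγ hm ht)]
  exact (hasDerivWithinAt_slice (contDiffOn_dirDeriv hS hf e) hγ hm ht).derivWithin (hI t ht)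

end slices

section rectangle

variable {a b T : ℝ} {u : ℝ → ℝ → ℝ}

lemma uniqueDiffOn_rect (hab : a < b) (hT : 0 < T) : UniqueDiffOn ℝ (Icc a b ×ˢ Icc 0 T) :=
  (uniqueDiffOn_Icc hab).prod (uniqueDiffOn_Icc hT)

lemma hasDerivWithinAt_mk_right (x t : ℝ) (I : Set ℝ) :
    HasDerivWithinAt (fun s : ℝ => (x, s)) (0, 1) I t :=
  (hasDerivWithinAt_const t I x).prodMk (hasDerivWithinAt_id t I)

lemma hasDerivWithinAt_mk_left (x t : ℝ) (I : Set ℝ) :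
    HasDerivWithinAt (fun y : ℝ => (y, t)) (1, 0) I x :=
  (hasDerivWithinAt_id x I).prodMk (hasDerivWithinAt_const x I t)

/-- The function of two variables that belongs to the curried function `u`. -/
def unc (u : ℝ → ℝ → ℝ) (p : ℝ × ℝ) : ℝ := u p.1 p.2

namespace IsC2

lemma dt_one (hu : IsC2 a b T u) (hT : 0 < T) {x t : ℝ} (hx : x ∈ Icc a b) (ht : t ∈ Icc 0 T) :
    dt T 1 u x t = dirDeriv (Icc a b ×ˢ Icc 0 T) (0, 1) (unc u) (x, t) :=
  iteratedDerivWithin_one_slice (f := unc u) (γ := fun s => (x, s)) (uniqueDiffOn_Icc hT)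
    (ContDiffOn.of_le hu (by norm_num)) (fun t _ => hasDerivWithinAt_mk_right x t _)
    (fun _ hs => ⟨hx, hs⟩) ht

lemma dt_two (hu : IsC2 a b T u) (hab : a < b) (hT : 0 < T) {x t : ℝ} (hx : x ∈ Icc a b)
    (ht : t ∈ Icc 0 T) :
    dt T 2 u x t = dirDeriv (Icc a b ×ˢ Icc 0 T) (0, 1)
      (dirDeriv (Icc a b ×ˢ Icc 0 T) (0, 1) (unc u)) (x, t) :=
  iteratedDerivWithin_two_slice (f := unc u) (γ := fun s => (x, s)) (uniqueDiffOn_rect hab hT)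
    (uniqueDiffOn_Icc hT) hu (fun t _ => hasDerivWithinAt_mk_right x t _)
    (fun _ hs => ⟨hx, hs⟩) ht

lemma dx_one (hu : IsC2 a b T u) (hab : a < b) {x t : ℝ} (hx : x ∈ Icc a b) (ht : t ∈ Icc 0 T) :
    dx a b 1 u x t = dirDeriv (Icc a b ×ˢ Icc 0 T) (1, 0) (unc u) (x, t) :=
  iteratedDerivWithin_one_slice (f := unc u) (γ := fun y => (y, t)) (uniqueDiffOn_Icc hab)
    (ContDiffOn.of_le hu (by norm_num)) (fun x _ => hasDerivWithinAt_mk_left x t _)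
    (fun _ hs => ⟨hs, ht⟩) hx

lemma dx_two (hu : IsC2 a b T u) (hab : a < b) (hT : 0 < T) {x t : ℝ} (hx : x ∈ Icc a b)
    (ht : t ∈ Icc 0 T) :
    dx a b 2 u x t = dirDeriv (Icc a b ×ˢ Icc 0 T) (1, 0)
      (dirDeriv (Icc a b ×ˢ Icc 0 T) (1, 0) (unc u)) (x, t) :=
  iteratedDerivWithin_two_slice (f := unc u) (γ := fun y => (y, t)) (uniqueDiffOn_rect hab hT)
    (uniqueDiffOn_Icc hab) hu (fun x _ => hasDerivWithinAt_mk_left x t _)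
    (fun _ hs => ⟨hs, ht⟩) hx

lemma continuousOn (hu : IsC2 a b T u) :
    ContinuousOn (fun p : ℝ × ℝ => u p.1 p.2) (Icc a b ×ˢ Icc 0 T) :=
  ContDiffOn.continuousOn hu

lemma continuousOn_dt_one (hu : IsC2 a b T u) (hab : a < b) (hT : 0 < T) :
    ContinuousOn (fun p : ℝ × ℝ => dt T 1 u p.1 p.2) (Icc a b ×ˢ Icc 0 T) :=
  (contDiffOn_dirDeriv (uniqueDiffOn_rect hab hT) hu _).continuousOn.congr
    fun _ hp => hu.dt_one hT hp.1 hp.2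

lemma continuousOn_dt_two (hu : IsC2 a b T u) (hab : a < b) (hT : 0 < T) :
    ContinuousOn (fun p : ℝ × ℝ => dt T 2 u p.1 p.2) (Icc a b ×ˢ Icc 0 T) :=
  (continuousOn_dirDeriv (uniqueDiffOn_rect hab hT)
    (contDiffOn_dirDeriv (uniqueDiffOn_rect hab hT) hu _) _).congr
    fun _ hp => hu.dt_two hab hT hp.1 hp.2

lemma continuousOn_dx_one (hu : IsC2 a b T u) (hab : a < b) (hT : 0 < T) :
    ContinuousOn (fun p : ℝ × ℝ => dx a b 1 u p.1 p.2) (Icc a b ×ˢ Icc 0 T) :=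
  (contDiffOn_dirDeriv (uniqueDiffOn_rect hab hT) hu _).continuousOn.congr
    fun _ hp => hu.dx_one hab hp.1 hp.2

lemma continuousOn_dx_two (hu : IsC2 a b T u) (hab : a < b) (hT : 0 < T) :
    ContinuousOn (fun p : ℝ × ℝ => dx a b 2 u p.1 p.2) (Icc a b ×ˢ Icc 0 T) :=
  (continuousOn_dirDeriv (uniqueDiffOn_rect hab hT)
    (contDiffOn_dirDeriv (uniqueDiffOn_rect hab hT) hu _) _).congr
    fun _ hp => hu.dx_two hab hT hp.1 hp.2

lemma hasDerivWithinAt_dt_zero (hu : IsC2 a b T u) (hT : 0 < T) {x t : ℝ} (hx : x ∈ Icc a b)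
    (ht : t ∈ Icc 0 T) : HasDerivWithinAt (fun s => u x s) (dt T 1 u x t) (Icc 0 T) t := by
  rw [hu.dt_one hT hx ht]
  exact hasDerivWithinAt_slice (f := unc u) (ContDiffOn.of_le hu (by norm_num))
    (fun t _ => hasDerivWithinAt_mk_right x t _) (fun _ hs => ⟨hx, hs⟩) ht

lemma hasDerivWithinAt_dt_one (hu : IsC2 a b T u) (hab : a < b) (hT : 0 < T) {x t : ℝ}
    (hx : x ∈ Icc a b) (ht : t ∈ Icc 0 T) :
    HasDerivWithinAt (fun s => dt T 1 u x s) (dt T 2 u x t) (Icc 0 T) t := by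
  rw [hu.dt_two hab hT hx ht]
  exact (hasDerivWithinAt_slice (contDiffOn_dirDeriv (uniqueDiffOn_rect hab hT) hu _)
    (fun t _ => hasDerivWithinAt_mk_right x t _) (fun _ hs => ⟨hx, hs⟩) ht).congr
    (fun s hs => hu.dt_one hT hx hs) (hu.dt_one hT hx ht)

lemma hasDerivWithinAt_dx_zero (hu : IsC2 a b T u) (hab : a < b) {x t : ℝ} (hx : x ∈ Icc a b)
    (ht : t ∈ Icc 0 T) : HasDerivWithinAt (fun y => u y t) (dx a b 1 u x t) (Icc a b) x := by
  rw [hu.dx_one hab hx ht]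
  exact hasDerivWithinAt_slice (f := unc u) (γ := fun y => (y, t))
    (ContDiffOn.of_le hu (by norm_num))
    (fun x _ => hasDerivWithinAt_mk_left x t _) (fun _ hs => ⟨hs, ht⟩) hx

lemma hasDerivWithinAt_dx_one (hu : IsC2 a b T u) (hab : a < b) (hT : 0 < T) {x t : ℝ}
    (hx : x ∈ Icc a b) (ht : t ∈ Icc 0 T) :
    HasDerivWithinAt (fun y => dx a b 1 u y t) (dx a b 2 u x t) (Icc a b) x := by
  rw [hu.dx_two hab hT hx ht]
  exact (hasDerivWithinAt_slice (γ := fun y => (y, t))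
    (contDiffOn_dirDeriv (uniqueDiffOn_rect hab hT) hu _)
    (fun x _ => hasDerivWithinAt_mk_left x t _) (fun _ hs => ⟨hs, ht⟩) hx).congr
    (fun s hs => hu.dx_one hab hs ht) (hu.dx_one hab hx ht)

end IsC2

lemma continuousOn_slice_right {w : ℝ → ℝ → ℝ}
    (hw : ContinuousOn (fun p : ℝ × ℝ => w p.1 p.2) (Icc a b ×ˢ Icc 0 T)) {x : ℝ}
    (hx : x ∈ Icc a b) : ContinuousOn (fun t => w x t) (Icc 0 T) :=
  hw.comp (f := fun t => (x, t)) (by fun_prop) fun _ ht => ⟨hx, ht⟩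

lemma continuousOn_slice_left {w : ℝ → ℝ → ℝ}
    (hw : ContinuousOn (fun p : ℝ × ℝ => w p.1 p.2) (Icc a b ×ˢ Icc 0 T)) {t : ℝ}
    (ht : t ∈ Icc 0 T) : ContinuousOn (fun x => w x t) (Icc a b) :=
  hw.comp (f := fun x => (x, t)) (by fun_prop) fun _ hx => ⟨hx, ht⟩

end rectangle

/-! ### The energy identity of the wave equation -/

section wave

variable {a b T : ℝ} {u : ℝ → ℝ → ℝ}

lemma dirDeriv_eq_fderiv {S : Set (ℝ × ℝ)} {p : ℝ × ℝ} (hp : S ∈ nhds p) (e : ℝ × ℝ)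
    (f : ℝ × ℝ → ℝ) : dirDeriv S e f p = fderiv ℝ f p e := by
  unfold dirDeriv
  rw [fderivWithin_of_mem_nhds hp]

/-- Equality of mixed partial derivatives in the interior. -/
lemma dirDeriv_comm {S : Set (ℝ × ℝ)} {p : ℝ × ℝ} (hp : S ∈ nhds p) {f : ℝ × ℝ → ℝ}
    (hf : ContDiffOn ℝ 2 f S) (e e' : ℝ × ℝ) :
    fderiv ℝ (dirDeriv S e f) p e' = fderiv ℝ (dirDeriv S e' f) p e := by
  have hfp : ContDiffAt ℝ 2 f p := hf.contDiffAt hp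
  have h1 : ∀ e e', fderiv ℝ (dirDeriv S e f) p e' = fderiv ℝ (fderiv ℝ f) p e' e := by
    intro e e'
    have h2 : dirDeriv S e f =ᶠ[nhds p] fun q => fderiv ℝ f q e := by
      filter_upwards [eventually_mem_nhds_iff.2 hp] with q hq using dirDeriv_eq_fderiv hq e f
    rw [h2.fderiv_eq]
    have h3 : DifferentiableAt ℝ (fderiv ℝ f) p :=
      (hfp.fderiv_right (m := 1) (by norm_num)).differentiableAt (by norm_num)
    rw [fderiv_clm_apply h3 (differentiableAt_const e)]
    simp
  rw [h1, h1]
  exact hfp.isSymmSndFDerivAt (by simp) e' e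

/-- Conservation of energy, by the divergence theorem for the field
`(-2 c ∂ₜu ∂ₓu, (∂ₜu)² + c (∂ₓu)²)`. It only involves first derivatives of `∂ₜu` and `∂ₓu`, so
that `C²` regularity is enough. -/
theorem wave_energy_eq (hab : a < b) (hT : 0 < T) (hu : IsC2 a b T u) {c : ℝ}
    (pde : ∀ x ∈ Ioo a b, ∀ t ∈ Ioc 0 T, dt T 2 u x t - c * dx a b 2 u x t = 0)
    (hb : Dirichlet a b T u) {t : ℝ} (ht : t ∈ Icc 0 T) :
    ∫ x in a..b, (dt T 1 u x t ^ 2 + c * dx a b 1 u x t ^ 2)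
      = ∫ x in a..b, (dt T 1 u x 0 ^ 2 + c * dx a b 1 u x 0 ^ 2) := by
  set S := Icc a b ×ˢ Icc 0 T with hS
  set ft := dirDeriv S (0, 1) (unc u) with hft
  set fx := dirDeriv S (1, 0) (unc u) with hfx
  have hSu := uniqueDiffOn_rect hab hT
  have cft : ContDiffOn ℝ 1 ft S := contDiffOn_dirDeriv hSu hu _
  have cfx : ContDiffOn ℝ 1 fx S := contDiffOn_dirDeriv hSu hu _
  have hnhds : ∀ p ∈ Ioo a b ×ˢ Ioo 0 t, S ∈ nhds p := fun p hp =>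
    prod_mem_nhds (Icc_mem_nhds hp.1.1 hp.1.2) (Icc_mem_nhds hp.2.1 (hp.2.2.trans_le ht.2))
  set F : ℝ × ℝ → ℝ := fun p => -(2 * c) * (ft p * fx p) with hF
  set g : ℝ × ℝ → ℝ := fun p => ft p ^ 2 + c * fx p ^ 2 with hg
  have cF : ContDiffOn ℝ 1 F S := contDiffOn_const.mul (cft.mul cfx)
  have cg : ContDiffOn ℝ 1 g S := (cft.pow 2).add (contDiffOn_const.mul (cfx.pow 2))
  have hsub : uIcc a b ×ˢ uIcc 0 t ⊆ S := by
    rw [uIcc_of_le hab.le, uIcc_of_le ht.1]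
    exact prod_mono le_rfl (Icc_subset_Icc le_rfl ht.2)
  classical
  -- extended by zero, so that the divergence vanishes everywhere
  set F' : ℝ × ℝ → ℝ × ℝ →L[ℝ] ℝ := fun p => if p ∈ Ioo a b ×ˢ Ioo 0 t then fderiv ℝ F p else 0
    with hF'
  set g' : ℝ × ℝ → ℝ × ℝ →L[ℝ] ℝ := fun p => if p ∈ Ioo a b ×ˢ Ioo 0 t then fderiv ℝ g p else 0
    with hg'
  have hz : ∀ p, F' p (1, 0) + g' p (0, 1) = 0 := by
    intro p
    by_cases hp : p ∈ Ioo a b ×ˢ Ioo 0 t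
    · have n := hnhds p hp
      have dft : DifferentiableAt ℝ ft p := (cft.contDiffAt n).differentiableAt (by norm_num)
      have dfx : DifferentiableAt ℝ fx p := (cfx.contDiffAt n).differentiableAt (by norm_num)
      have e1 := ((dft.hasFDerivAt.mul dfx.hasFDerivAt).const_mul (-(2 * c))).fderiv
      have e2 := ((dft.hasFDerivAt.pow 2).add ((dfx.hasFDerivAt.pow 2).const_mul c)).fderiv
      have px : p.1 ∈ Ioo a b := hp.1
      have pt : p.2 ∈ Ioc 0 T := ⟨hp.2.1, (hp.2.2.trans_le ht.2).le⟩
      have hpde := pde p.1 px p.2 pt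
      rw [hu.dt_two hab hT (Ioo_subset_Icc_self px) (Ioc_subset_Icc_self pt),
        hu.dx_two hab hT (Ioo_subset_Icc_self px) (Ioc_subset_Icc_self pt),
        dirDeriv_eq_fderiv n, dirDeriv_eq_fderiv n] at hpde
      have hsym := dirDeriv_comm n hu (0, 1) (1, 0)
      change fderiv ℝ ft p (0, 1) - c * fderiv ℝ fx p (1, 0) = 0 at hpde
      change fderiv ℝ ft p (1, 0) = fderiv ℝ fx p (0, 1) at hsym
      simp only [hF', hg', if_pos hp]
      have e1' : fderiv ℝ F p (1, 0)
          = -(2 * c) * (ft p * fderiv ℝ fx p (1, 0) + fx p * fderiv ℝ ft p (1, 0)) := by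
        have : fderiv ℝ F p = _ := e1
        rw [this]; simp; ring
      have e2' : fderiv ℝ g p (0, 1)
          = 2 * ft p * fderiv ℝ ft p (0, 1) + c * (2 * fx p * fderiv ℝ fx p (0, 1)) := by
        have : fderiv ℝ g p = _ := e2
        rw [this]; simp
      rw [e1', e2']
      linear_combination 2 * ft p * hpde - 2 * c * fx p * hsym
    · simp only [hF', hg', if_neg hp]; simp
  have key := integral2_divergence_prod_of_hasFDerivAt_off_countable F g F' g' a 0 b t ∅
    countable_empty (cF.continuousOn.mono hsub) (cg.continuousOn.mono hsub)
    (fun p hp => by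
      rw [min_eq_left hab.le, max_eq_right hab.le, min_eq_left ht.1, max_eq_right ht.1] at hp
      simp only [hF', if_pos hp.1]
      exact ((cF.contDiffAt (hnhds p hp.1)).differentiableAt (by norm_num)).hasFDerivAt)
    (fun p hp => by
      rw [min_eq_left hab.le, max_eq_right hab.le, min_eq_left ht.1, max_eq_right ht.1] at hp
      simp only [hg', if_pos hp.1]
      exact ((cg.contDiffAt (hnhds p hp.1)).differentiableAt (by norm_num)).hasFDerivAt)
    (by simp only [hz]; exact integrableOn_zero)
  -- the lateral flux vanishes because of the boundary condition
  have hbd : ∀ x ∈ Icc a b, (∀ s ∈ Icc 0 T, u x s = 0) → ∀ s ∈ Icc 0 T, F (x, s) = 0 := by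
    intro x hx hxs s hs
    have h1 := (hu.hasDerivWithinAt_dt_zero hT hx hs).derivWithin (uniqueDiffOn_Icc hT s hs)
    rw [derivWithin_congr (f := fun _ => (0 : ℝ)) hxs (hxs s hs), derivWithin_fun_const,
      hu.dt_one hT hx hs] at h1
    have h2 : ft (x, s) = 0 := h1.symm
    simp [hF, h2]
  have hI : ∀ s ∈ uIcc 0 t, s ∈ Icc 0 T := fun s hs => by
    rw [uIcc_of_le ht.1] at hs; exact ⟨hs.1, hs.2.trans ht.2⟩
  have k1 : ∫ s in (0 : ℝ)..t, F (b, s) = 0 := by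
    rw [intervalIntegral.integral_congr (g := fun _ => (0 : ℝ)) fun s hs =>
      hbd b (right_mem_Icc.2 hab.le) (fun s hs => (hb s hs).2) s (hI s hs)]
    simp
  have k2 : ∫ s in (0 : ℝ)..t, F (a, s) = 0 := by
    rw [intervalIntegral.integral_congr (g := fun _ => (0 : ℝ)) fun s hs =>
      hbd a (left_mem_Icc.2 hab.le) (fun s hs => (hb s hs).1) s (hI s hs)]
    simp
  simp only [hz, k1, k2, intervalIntegral.integral_zero] at key
  have hcongr : ∀ s ∈ Icc 0 T, ∫ x in a..b, (dt T 1 u x s ^ 2 + c * dx a b 1 u x s ^ 2)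
      = ∫ x in a..b, g (x, s) := fun s hs =>
    intervalIntegral.integral_congr fun x hx => by
      rw [uIcc_of_le hab.le] at hx
      simp only [hg, hu.dt_one hT hx hs, hu.dx_one hab hx hs]
      rfl
  rw [hcongr t ht, hcongr 0 (left_mem_Icc.2 hT.le)]
  linarith

/-- The initial layer has size `ε ^ α*`: the energy controls `∂ₓG` in `L²`, hence `G` in `L^∞`. -/
theorem exists_wave_bound {α β : ℝ} {ω₀ ω₁ : ℝ → ℝ} {G : ℝ → ℝ → ℝ → ℝ} (hab : a < b) (hT : 0 < T)
    (hG : ∀ ε ∈ Ioc (0 : ℝ) 1, IsWaveSolution a b T α β ε ω₀ ω₁ (G ε)) :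
    ∃ C ≥ 0, ∀ ε ∈ Ioc (0 : ℝ) 1, ∀ x ∈ Icc a b, ∀ t ∈ Icc 0 T,
      |G ε x t| ≤ C * ε ^ alphaStar α β := by
  have t0 : (0 : ℝ) ∈ Icc 0 T := left_mem_Icc.2 hT.le
  -- the data of the solution for `ε = 1` are `ω₀` and `ω₁` themselves
  have h1 := hG 1 (by norm_num)
  obtain ⟨K₁, hK₁⟩ := isCompact_Icc.exists_bound_of_continuousOn
    ((continuousOn_slice_left (h1.regular.continuousOn_dt_one hab hT) t0))
  obtain ⟨K₂, hK₂⟩ := isCompact_Icc.exists_bound_of_continuousOn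
    ((continuousOn_slice_left (h1.regular.continuousOn_dx_one hab hT) t0))
  set K := max K₁ K₂
  refine ⟨(b - a) * (1 / 2 + K ^ 2), by have := sub_pos.2 hab; positivity,
    fun ε hε x hx t ht => ?_⟩
  have hGε := hG ε hε
  have hε0 := hε.1
  set l := ε ^ alphaStar α β with hl
  have hl0 : 0 < l := Real.rpow_pos_of_pos hε0 _
  have hα : ε ^ α ≤ l := Real.rpow_le_rpow_of_exponent_ge hε0 hε.2 (min_le_left _ _)
  have hβ : ε * ε ^ β ≤ l := by
    have : ε * ε ^ β = ε ^ (1 + β) := by rw [Real.rpow_add hε0, Real.rpow_one]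
    rw [this]
    exact Real.rpow_le_rpow_of_exponent_ge hε0 hε.2 (min_le_right _ _)
  have hb0 : 0 ≤ ε ^ β := Real.rpow_nonneg hε0.le _
  have ha0 : 0 ≤ ε ^ α := Real.rpow_nonneg hε0.le _
  have i1 : ∀ y ∈ Icc a b, (ε * dt T 1 (G ε) y 0) ^ 2 ≤ l ^ 2 * K ^ 2 := fun y hy => by
    have e1 : dt T 1 (G ε) y 0 = ε ^ β * dt T 1 (G 1) y 0 := by
      rw [hGε.init_dt y hy, h1.init_dt y hy, Real.one_rpow, one_mul]
    have b1 : |dt T 1 (G 1) y 0| ≤ K := (hK₁ y hy).trans (le_max_left _ _)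
    rw [e1, ← sq_abs, ← mul_assoc, abs_mul, abs_of_nonneg (by positivity), ← mul_pow]
    gcongr
  have i2 : ∀ y ∈ Icc a b, dx a b 1 (G ε) y 0 ^ 2 ≤ l ^ 2 * K ^ 2 := fun y hy => by
    have e0 : ∀ z ∈ Icc a b, G ε z 0 = ε ^ α * G 1 z 0 := fun z hz => by
      rw [hGε.init z hz, h1.init z hz, Real.one_rpow, one_mul]
    have e1 : dx a b 1 (G ε) y 0 = ε ^ α * dx a b 1 (G 1) y 0 := by
      have d1 := ((h1.regular.hasDerivWithinAt_dx_zero hab hy t0).const_mul (ε ^ α)).congr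
        e0 (e0 y hy)
      exact (uniqueDiffOn_Icc hab y hy).eq_deriv _
        (hGε.regular.hasDerivWithinAt_dx_zero hab hy t0) d1
    have b1 : |dx a b 1 (G 1) y 0| ≤ K := (hK₂ y hy).trans (le_max_right _ _)
    rw [e1, ← sq_abs, abs_mul, abs_of_nonneg ha0, ← mul_pow]
    gcongr
  have hen := wave_energy_eq hab hT hGε.regular hGε.pde hGε.boundary ht
  have ct : ∀ s ∈ Icc 0 T, ContinuousOn (fun x => dt T 1 (G ε) x s) (uIcc a b) := fun s hs => by
    rw [uIcc_of_le hab.le]; exact continuousOn_slice_left (hGε.regular.continuousOn_dt_one hab hT) hs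
  have cx : ∀ s ∈ Icc 0 T, ContinuousOn (fun x => dx a b 1 (G ε) x s) (uIcc a b) := fun s hs => by
    rw [uIcc_of_le hab.le]; exact continuousOn_slice_left (hGε.regular.continuousOn_dx_one hab hT) hs
  have up : ∫ x in a..b, (dt T 1 (G ε) x 0 ^ 2 + 1 / ε ^ 2 * dx a b 1 (G ε) x 0 ^ 2)
      ≤ ∫ x in a..b, 1 / ε ^ 2 * (2 * (l ^ 2 * K ^ 2)) := by
    refine intervalIntegral.integral_mono_on hab.le
      (((ct 0 t0).pow 2).add (((cx 0 t0).pow 2).const_smul (1 / ε ^ 2))).intervalIntegrable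
      intervalIntegrable_const fun y hy => ?_
    have e : dt T 1 (G ε) y 0 ^ 2 = 1 / ε ^ 2 * (ε * dt T 1 (G ε) y 0) ^ 2 := by field_simp
    rw [e, ← mul_add, two_mul]
    have := i1 y hy
    have := i2 y hy
    gcongr
  have lo : ∫ x in a..b, 1 / ε ^ 2 * dx a b 1 (G ε) x t ^ 2
      ≤ ∫ x in a..b, (dt T 1 (G ε) x t ^ 2 + 1 / ε ^ 2 * dx a b 1 (G ε) x t ^ 2) := by
    refine intervalIntegral.integral_mono_on hab.le
      (((cx t ht).pow 2).const_smul (1 / ε ^ 2)).intervalIntegrable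
      (((ct t ht).pow 2).add (((cx t ht).pow 2).const_smul (1 / ε ^ 2))).intervalIntegrable
      fun y hy => ?_
    linarith [sq_nonneg (dt T 1 (G ε) y t)]
  have hsq : ∫ x in a..b, dx a b 1 (G ε) x t ^ 2 ≤ (b - a) * (2 * (l ^ 2 * K ^ 2)) := by
    have h3 := lo.trans (hen.le.trans up)
    rw [intervalIntegral.integral_const_mul, intervalIntegral.integral_const_mul,
      intervalIntegral.integral_const, smul_eq_mul] at h3
    exact le_of_mul_le_mul_left h3 (by positivity)
  have hftc : ∫ y in a..x, dx a b 1 (G ε) y t = G ε x t := by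
    have hsub : Icc a x ⊆ Icc a b := Icc_subset_Icc le_rfl hx.2
    have := intervalIntegral.integral_eq_sub_of_hasDerivAt_of_le hx.1
      (f := fun y => G ε y t) (f' := fun y => dx a b 1 (G ε) y t)
      ((continuousOn_slice_left hGε.regular.continuousOn ht).mono hsub)
      (fun y hy => (hGε.regular.hasDerivWithinAt_dx_zero hab
        (hsub (Ioo_subset_Icc_self hy)) ht).hasDerivAt
          (Icc_mem_nhds hy.1 (hy.2.trans_le hx.2)))
      (ContinuousOn.intervalIntegrable (by
        rw [uIcc_of_le hx.1]
        exact (continuousOn_slice_left (hGε.regular.continuousOn_dx_one hab hT) ht).mono hsub))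
    rw [this, (hGε.boundary t ht).1, sub_zero]
  have ha : |G ε x t| ≤ ∫ y in a..b, |dx a b 1 (G ε) y t| := by
    rw [← hftc]
    refine (intervalIntegral.abs_integral_le_integral_abs hx.1).trans ?_
    exact intervalIntegral.integral_mono_interval le_rfl hx.1 hx.2
      (Filter.Eventually.of_forall fun _ => abs_nonneg _) (cx t ht).abs.intervalIntegrable
  -- Young's inequality with the weight `l`, in place of the Cauchy-Schwarz inequality
  have hy : ∫ y in a..b, |dx a b 1 (G ε) y t|
      ≤ ∫ y in a..b, (l / 2 + 1 / (2 * l) * dx a b 1 (G ε) y t ^ 2) := by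
    refine intervalIntegral.integral_mono_on hab.le (cx t ht).abs.intervalIntegrable
      (continuousOn_const.add (((cx t ht).pow 2).const_smul (1 / (2 * l)))).intervalIntegrable
      fun y _ => ?_
    have e : l / 2 + 1 / (2 * l) * dx a b 1 (G ε) y t ^ 2 - |dx a b 1 (G ε) y t|
        = 1 / (2 * l) * (l - |dx a b 1 (G ε) y t|) ^ 2 := by
      rw [← sq_abs (dx a b 1 (G ε) y t)]; field_simp; ring
    have : 0 ≤ 1 / (2 * l) * (l - |dx a b 1 (G ε) y t|) ^ 2 := by positivity
    linarith
  have hint : IntervalIntegrable (fun y => 1 / (2 * l) * dx a b 1 (G ε) y t ^ 2) volume a b :=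
    (((cx t ht).pow 2).const_smul (1 / (2 * l))).intervalIntegrable
  rw [intervalIntegral.integral_add intervalIntegrable_const hint,
    intervalIntegral.integral_const_mul, intervalIntegral.integral_const, smul_eq_mul] at hy
  calc |G ε x t| ≤ (b - a) * (l / 2) + 1 / (2 * l) * ((b - a) * (2 * (l ^ 2 * K ^ 2))) := by
        refine ha.trans (hy.trans ?_)
        gcongr
    _ = (b - a) * (1 / 2 + K ^ 2) * l := by field_simp

end wave

/-! ### The cut-off nonlinearity -/

section cutoff

variable {ρ : ℝ → ℝ} {B : ℝ}

lemma contDiff_rhoB (hρ : IsCutoff ρ) (B : ℝ) : ContDiff ℝ ∞ (rhoB ρ B) :=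
  (contDiff_id.pow 2).mul (hρ.smooth.comp (contDiff_id.div_const B))

lemma rhoB_eq_sq (hρ : IsCutoff ρ) (hB : 0 < B) {s : ℝ} (hs : |s| ≤ B) : rhoB ρ B s = s ^ 2 := by
  unfold rhoB
  rw [hρ.eq_one, mul_one]
  rwa [abs_div, abs_of_pos hB, div_le_one hB]

lemma deriv_rhoB_eq (hρ : IsCutoff ρ) (hB : 0 < B) {s : ℝ} (hs : |s| < B) :
    deriv (rhoB ρ B) s = 2 * s := by
  have : rhoB ρ B =ᶠ[nhds s] fun r => r ^ 2 := by
    filter_upwards [continuous_abs.continuousAt.eventually_lt_const hs] with r hr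
    exact rhoB_eq_sq hρ hB hr.le
  rw [this.deriv_eq]
  simp

lemma hasCompactSupport_rhoB (hρ : IsCutoff ρ) (hB : 0 < B) : HasCompactSupport (rhoB ρ B) := by
  refine HasCompactSupport.intro (isCompact_Icc (a := -(2 * B)) (b := 2 * B)) fun s hs => ?_
  unfold rhoB
  rw [hρ.eq_zero, mul_zero]
  rw [abs_div, abs_of_pos hB, le_div_iff₀ hB]
  by_contra h
  exact hs (abs_le.1 (not_le.1 h).le)

lemma exists_rhoB_bound (hρ : IsCutoff ρ) (hB : 0 < B) :
    ∃ L ≥ 0, (∀ s, |rhoB ρ B s| ≤ L) ∧ (∀ s, |deriv (rhoB ρ B) s| ≤ L) ∧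
      ∀ s r, |deriv (rhoB ρ B) s - deriv (rhoB ρ B) r| ≤ L * |s - r| := by
  have h0 := contDiff_rhoB hρ B
  have h1 : ContDiff ℝ ∞ (deriv (rhoB ρ B)) := h0.iterate_deriv 1
  have h2 : ContDiff ℝ ∞ (deriv (deriv (rhoB ρ B))) := h1.iterate_deriv 1
  have c0 := hasCompactSupport_rhoB hρ hB
  obtain ⟨L0, hL0⟩ := h0.continuous.bounded_above_of_compact_support c0
  obtain ⟨L1, hL1⟩ := h1.continuous.bounded_above_of_compact_support c0.deriv
  obtain ⟨L2, hL2⟩ := h2.continuous.bounded_above_of_compact_support c0.deriv.deriv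
  refine ⟨max L0 (max L1 L2), ((norm_nonneg _).trans (hL0 0)).trans (le_max_left _ _),
    fun s => (hL0 s).trans (le_max_left _ _),
    fun s => (hL1 s).trans ((le_max_left _ _).trans (le_max_right _ _)), fun s r => ?_⟩
  have := convex_univ.norm_image_sub_le_of_norm_hasDerivWithin_le (f := deriv (rhoB ρ B))
    (fun x _ => (h1.differentiable (by simp) x).hasDerivAt.hasDerivWithinAt) (fun x _ => hL2 x)
    (mem_univ r) (mem_univ s)
  refine this.trans (mul_le_mul_of_nonneg_right
    ((le_max_right _ _).trans (le_max_right _ _)) (norm_nonneg _))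

lemma continuous_deriv_rhoB (hρ : IsCutoff ρ) (B : ℝ) : Continuous (deriv (rhoB ρ B)) :=
  ((contDiff_rhoB hρ B).iterate_deriv 1).continuous

lemma abs_gB_le {L : ℝ} (hL : ∀ s, |deriv (rhoB ρ B) s| ≤ L) (y z : ℝ) : |gB ρ B y z| ≤ L := by
  have h1 := intervalIntegral.norm_integral_le_of_norm_le_const (a := 0) (b := 1) (C := L)
    (f := fun s => deriv (rhoB ρ B) (s * y + (1 - s) * z)) fun s _ => hL _
  rw [Real.norm_eq_abs, sub_zero, abs_one, mul_one] at h1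
  unfold gB
  rw [abs_mul, abs_of_pos (by norm_num : (0 : ℝ) < 1 / 2)]
  linarith [abs_nonneg (∫ s in (0 : ℝ)..1, deriv (rhoB ρ B) (s * y + (1 - s) * z))]

lemma abs_gB_sub_le (hρ : IsCutoff ρ) {L : ℝ} (hL0 : 0 ≤ L)
    (hL : ∀ s r, |deriv (rhoB ρ B) s - deriv (rhoB ρ B) r| ≤ L * |s - r|) (y z y' z' : ℝ) :
    |gB ρ B y z - gB ρ B y' z'| ≤ L * (|y - y'| + |z - z'|) := by
  have hc := continuous_deriv_rhoB hρ B
  have hi : ∀ y z, IntervalIntegrable (fun s => deriv (rhoB ρ B) (s * y + (1 - s) * z))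
      volume 0 1 := fun y z => (hc.comp (by fun_prop)).intervalIntegrable _ _
  have h1 := intervalIntegral.norm_integral_le_of_norm_le_const (a := 0) (b := 1)
    (C := L * (|y - y'| + |z - z'|))
    (f := fun s => deriv (rhoB ρ B) (s * y + (1 - s) * z)
      - deriv (rhoB ρ B) (s * y' + (1 - s) * z')) fun s hs => by
    rw [uIoc_of_le zero_le_one] at hs
    refine (hL _ _).trans (mul_le_mul_of_nonneg_left ?_ hL0)
    have e : s * y + (1 - s) * z - (s * y' + (1 - s) * z') = s * (y - y') + (1 - s) * (z - z') := by
      ring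
    rw [e]
    refine (abs_add_le _ _).trans ?_
    rw [abs_mul, abs_mul, abs_of_pos hs.1, abs_of_nonneg (sub_nonneg.2 hs.2)]
    nlinarith [abs_nonneg (y - y'), abs_nonneg (z - z'), hs.1, hs.2]
  rw [intervalIntegral.integral_sub (hi y z) (hi y' z'), Real.norm_eq_abs, sub_zero, abs_one,
    mul_one] at h1
  unfold gB
  rw [← mul_sub, abs_mul, abs_of_pos (by norm_num : (0 : ℝ) < 1 / 2)]
  linarith [abs_nonneg ((∫ s in (0 : ℝ)..1, deriv (rhoB ρ B) (s * y + (1 - s) * z))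
    - ∫ s in (0 : ℝ)..1, deriv (rhoB ρ B) (s * y' + (1 - s) * z'))]

lemma continuous_gB_left (hρ : IsCutoff ρ) {L : ℝ} (hL0 : 0 ≤ L)
    (hL : ∀ s r, |deriv (rhoB ρ B) s - deriv (rhoB ρ B) r| ≤ L * |s - r|) (z : ℝ) :
    Continuous fun y => gB ρ B y z := by
  refine (LipschitzWith.of_dist_le_mul (K := ⟨L, hL0⟩) fun y y' => ?_).continuous
  have := abs_gB_sub_le hρ hL0 hL y z y' z
  rw [sub_self, abs_zero, add_zero] at this
  exact this

/-- The discrete gradient property of `g`. -/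
lemma rhoB_sub_eq (hρ : IsCutoff ρ) (y z : ℝ) :
    rhoB ρ B y - rhoB ρ B z = 2 * gB ρ B y z * (y - z) := by
  have hd := (contDiff_rhoB hρ B).differentiable (by simp)
  have h1 := intervalIntegral.integral_eq_sub_of_hasDerivAt (a := 0) (b := 1)
    (f := fun s => rhoB ρ B (s * y + (1 - s) * z))
    (f' := fun s => deriv (rhoB ρ B) (s * y + (1 - s) * z) * (y - z)) (fun s _ => by
      have h2 : HasDerivAt (fun s : ℝ => s * y + (1 - s) * z) (y - z) s := by
        have := ((hasDerivAt_id s).mul_const y).add (((hasDerivAt_id s).const_sub 1).mul_const z)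
        exact this.congr_deriv (by ring)
      exact (hd _).hasDerivAt.comp s h2)
    (((continuous_deriv_rhoB hρ B).comp (by fun_prop)).mul continuous_const
      |>.intervalIntegrable _ _)
  rw [intervalIntegral.integral_mul_const] at h1
  simp only [one_mul, sub_self, zero_mul, add_zero, sub_zero, zero_add] at h1
  unfold gB
  linarith

/-- Without effect of the cut-off, `g` is the average that the exact solution sees. -/
lemma gB_eq_avg (hρ : IsCutoff ρ) (hB : 0 < B) {y z : ℝ} (hy : |y| < B) (hz : |z| < B) :
    gB ρ B y z = (y + z) / 2 := by
  have h1 : ∫ s in (0 : ℝ)..1, deriv (rhoB ρ B) (s * y + (1 - s) * z)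
      = ∫ s in (0 : ℝ)..1, 2 * (s * (y - z) + z) := by
    refine intervalIntegral.integral_congr fun s hs => ?_
    rw [uIcc_of_le zero_le_one] at hs
    have : |s * y + (1 - s) * z| < B := by
      have := (convex_ball (0 : ℝ) B) (x := y) (by simpa using hy) (y := z) (by simpa using hz)
        hs.1 (sub_nonneg.2 hs.2) (by ring)
      simpa using this
    simp only [deriv_rhoB_eq hρ hB this]
    ring
  unfold gB
  rw [h1, intervalIntegral.integral_const_mul, intervalIntegral.integral_add (by simp) (by simp),
    intervalIntegral.integral_mul_const, integral_id, intervalIntegral.integral_const]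
  norm_num
  ring

end cutoff

/-! ### Averages in time -/

/-- The weighted average of `φ` over `[t - τ, t + τ]`. -/
noncomputable def timeAvg (τ : ℝ) (φ : ℝ → ℝ) (t : ℝ) : ℝ :=
  ∫ s in (-1 : ℝ)..1, (1 - |s|) * φ (t + s * τ)

section timeAvg

variable {T τ t : ℝ} {φ ψ : ℝ → ℝ}

lemma add_mul_mem_Icc (hτ : 0 < τ) (h0 : 0 ≤ t - τ) (h1 : t + τ ≤ T) {s : ℝ}
    (hs : s ∈ Icc (-1 : ℝ) 1) : t + s * τ ∈ Icc 0 T := by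
  constructor <;> nlinarith [hs.1, hs.2]

lemma intervalIntegrable_timeAvg (hφ : ContinuousOn φ (Icc 0 T)) (hτ : 0 < τ) (h0 : 0 ≤ t - τ)
    (h1 : t + τ ≤ T) {c d : ℝ} (hc : c ∈ Icc (-1 : ℝ) 1) (hd : d ∈ Icc (-1 : ℝ) 1) :
    IntervalIntegrable (fun s => (1 - |s|) * φ (t + s * τ)) volume c d := by
  refine ContinuousOn.intervalIntegrable (ContinuousOn.mul (by fun_prop)
    (hφ.comp (by fun_prop) fun s hs => add_mul_mem_Icc hτ h0 h1 ?_))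
  exact ordConnected_Icc.uIcc_subset hc hd hs

lemma timeAvg_sub (hφ : ContinuousOn φ (Icc 0 T)) (hψ : ContinuousOn ψ (Icc 0 T)) (hτ : 0 < τ)
    (h0 : 0 ≤ t - τ) (h1 : t + τ ≤ T) :
    timeAvg τ (fun s => φ s - ψ s) t = timeAvg τ φ t - timeAvg τ ψ t := by
  unfold timeAvg
  rw [← intervalIntegral.integral_sub
    (intervalIntegrable_timeAvg hφ hτ h0 h1 (by simp) (by simp))
    (intervalIntegrable_timeAvg hψ hτ h0 h1 (by simp) (by simp))]
  simp only [mul_sub]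

lemma timeAvg_add (hφ : ContinuousOn φ (Icc 0 T)) (hψ : ContinuousOn ψ (Icc 0 T)) (hτ : 0 < τ)
    (h0 : 0 ≤ t - τ) (h1 : t + τ ≤ T) :
    timeAvg τ (fun s => φ s + ψ s) t = timeAvg τ φ t + timeAvg τ ψ t := by
  unfold timeAvg
  rw [← intervalIntegral.integral_add
    (intervalIntegrable_timeAvg hφ hτ h0 h1 (by simp) (by simp))
    (intervalIntegrable_timeAvg hψ hτ h0 h1 (by simp) (by simp))]
  simp only [mul_add]

lemma timeAvg_mul_const (c : ℝ) : timeAvg τ (fun s => φ s * c) t = timeAvg τ φ t * c := by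
  unfold timeAvg
  rw [← intervalIntegral.integral_mul_const]
  simp only [mul_assoc]

lemma abs_timeAvg_le {K : ℝ} (h : ∀ s ∈ Icc (-1 : ℝ) 1, |φ (t + s * τ)| ≤ K) :
    |timeAvg τ φ t| ≤ 2 * K := by
  have := intervalIntegral.norm_integral_le_of_norm_le_const (a := -1) (b := 1) (C := K)
    (f := fun s => (1 - |s|) * φ (t + s * τ)) fun s hs => by
    rw [uIoc_of_le (by norm_num)] at hs
    have h1 := h s (Ioc_subset_Icc_self hs)
    have h2 : |s| ≤ 1 := abs_le.2 ⟨hs.1.le, hs.2⟩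
    rw [norm_mul, Real.norm_of_nonneg (by linarith), Real.norm_eq_abs]
    nlinarith [abs_nonneg s, abs_nonneg (φ (t + s * τ))]
  rw [Real.norm_eq_abs] at this
  refine this.trans (le_of_eq ?_)
  norm_num
  ring

/-- The second difference quotient in time is exactly an average of the second derivative. -/
lemma timeAvg_second_deriv {φ₁ φ₂ : ℝ → ℝ}
    (d1 : ∀ s ∈ Icc 0 T, HasDerivWithinAt φ (φ₁ s) (Icc 0 T) s)
    (d2 : ∀ s ∈ Icc 0 T, HasDerivWithinAt φ₁ (φ₂ s) (Icc 0 T) s)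
    (hφ₂ : ContinuousOn φ₂ (Icc 0 T)) (hτ : 0 < τ) (h0 : 0 ≤ t - τ) (h1 : t + τ ≤ T) :
    timeAvg τ φ₂ t = (φ (t + τ) - 2 * φ t + φ (t - τ)) / τ ^ 2 := by
  have m : ∀ s ∈ Icc (-1 : ℝ) 1, t + s * τ ∈ Icc 0 T := fun s hs => add_mul_mem_Icc hτ h0 h1 hs
  have comp : ∀ {f f' : ℝ → ℝ}, (∀ s ∈ Icc 0 T, HasDerivWithinAt f (f' s) (Icc 0 T) s) →
      ∀ s ∈ Ioo (-1 : ℝ) 1, HasDerivAt (fun s => f (t + s * τ)) (f' (t + s * τ) * τ) s := by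
    intro f f' hf s hs
    have ms := m s (Ioo_subset_Icc_self hs)
    have n : Icc 0 T ∈ nhds (t + s * τ) :=
      Icc_mem_nhds (by nlinarith [hs.1]) (by nlinarith [hs.2])
    have l : HasDerivAt (fun s : ℝ => t + s * τ) τ s := by
      simpa using ((hasDerivAt_id s).mul_const τ).const_add t
    exact ((hf _ ms).hasDerivAt n).comp s l
  have cc : ∀ {f f' : ℝ → ℝ}, (∀ s ∈ Icc 0 T, HasDerivWithinAt f (f' s) (Icc 0 T) s) →
      ContinuousOn (fun s => f (t + s * τ)) (Icc (-1) 1) := fun hf =>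
    ContinuousOn.comp (t := Icc 0 T) (fun s hs => (hf s hs).continuousWithinAt) (by fun_prop) m
  have sr : Icc (0 : ℝ) 1 ⊆ Icc (-1) 1 := Icc_subset_Icc (by norm_num) le_rfl
  have sl : Icc (-1 : ℝ) 0 ⊆ Icc (-1) 1 := Icc_subset_Icc le_rfl (by norm_num)
  have ir := intervalIntegrable_timeAvg hφ₂ hτ h0 h1 (c := 0) (d := 1) (by simp) (by simp)
  have il := intervalIntegrable_timeAvg hφ₂ hτ h0 h1 (c := -1) (d := 0) (by simp) (by simp)
  have R := intervalIntegral.integral_eq_sub_of_hasDerivAt_of_le zero_le_one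
    (f := fun s => (1 - s) * (φ₁ (t + s * τ) / τ) + φ (t + s * τ) / τ ^ 2)
    (f' := fun s => (1 - |s|) * φ₂ (t + s * τ))
    (ContinuousOn.add (ContinuousOn.mul (by fun_prop) (((cc d2).mono sr).div_const τ))
      (((cc d1).mono sr).div_const _))
    (fun s hs => by
      have ms : s ∈ Ioo (-1 : ℝ) 1 := ⟨by linarith [hs.1], hs.2⟩
      have e := (((hasDerivAt_id s).const_sub 1).mul ((comp d2 s ms).div_const τ)).add
        ((comp d1 s ms).div_const (τ ^ 2))
      refine e.congr_deriv ?_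
      rw [abs_of_pos hs.1]
      simp only [id]
      field_simp
      ring) ir
  have L := intervalIntegral.integral_eq_sub_of_hasDerivAt_of_le (by norm_num : (-1 : ℝ) ≤ 0)
    (f := fun s => (1 + s) * (φ₁ (t + s * τ) / τ) - φ (t + s * τ) / τ ^ 2)
    (f' := fun s => (1 - |s|) * φ₂ (t + s * τ))
    (ContinuousOn.sub (ContinuousOn.mul (by fun_prop) (((cc d2).mono sl).div_const τ))
      (((cc d1).mono sl).div_const _))
    (fun s hs => by
      have ms : s ∈ Ioo (-1 : ℝ) 1 := ⟨hs.1, by linarith [hs.2]⟩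
      have e := (((hasDerivAt_id s).const_add 1).mul ((comp d2 s ms).div_const τ)).sub
        ((comp d1 s ms).div_const (τ ^ 2))
      refine e.congr_deriv ?_
      rw [abs_of_neg hs.2]
      simp only [id]
      field_simp
      ring) il
  unfold timeAvg
  rw [← intervalIntegral.integral_add_adjacent_intervals il ir, L, R]
  have e1 : t + -1 * τ = t - τ := by ring
  simp only [zero_mul, add_zero, one_mul, e1]
  field_simp
  ring

/-- The weight `1 - |s|` has mass one and is even. -/
lemma timeAvg_sub_affine (hφ : ContinuousOn φ (Icc 0 T)) (hτ : 0 < τ) (h0 : 0 ≤ t - τ)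
    (h1 : t + τ ≤ T) (c : ℝ) :
    timeAvg τ (fun s => φ s - (φ t + (s - t) * c)) t = timeAvg τ φ t - φ t := by
  rw [timeAvg_sub hφ (by fun_prop) hτ h0 h1]
  congr 1
  have := timeAvg_second_deriv (T := T) (φ := fun s => s ^ 2 / 2 * φ t + (s - t) ^ 3 / 6 * c)
    (φ₁ := fun s => s * φ t + (s - t) ^ 2 / 2 * c) (φ₂ := fun s => φ t + (s - t) * c)
    (fun s _ => by
      have e := (((hasDerivAt_pow 2 s).div_const 2).mul_const (φ t)).add
        (((((hasDerivAt_id s).sub_const t).pow 3).div_const 6).mul_const c)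
      refine (e.congr_deriv ?_).hasDerivWithinAt
      push_cast
      simp only [id]
      ring)
    (fun s _ => by
      have e := ((hasDerivAt_id s).mul_const (φ t)).add
        (((((hasDerivAt_id s).sub_const t).pow 2).div_const 2).mul_const c)
      refine (e.congr_deriv ?_).hasDerivWithinAt
      simp)
    (by fun_prop) hτ h0 h1
  rw [this]
  field_simp
  ring

lemma abs_timeAvg_sub_le (hφ : ContinuousOn φ (Icc 0 T)) (hτ : 0 < τ) (h0 : 0 ≤ t - τ)
    (h1 : t + τ ≤ T) {c K : ℝ} (hK : 0 ≤ K)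
    (h : ∀ s ∈ Icc 0 T, |φ s - (φ t + (s - t) * c)| ≤ K * (s - t) ^ 2) :
    |timeAvg τ φ t - φ t| ≤ 2 * (K * τ ^ 2) := by
  rw [← timeAvg_sub_affine hφ hτ h0 h1 c]
  refine abs_timeAvg_le fun s hs => (h _ (add_mul_mem_Icc hτ h0 h1 hs)).trans ?_
  have : s ^ 2 ≤ 1 := by nlinarith [hs.1, hs.2]
  have e : K * (t + s * τ - t) ^ 2 = K * τ ^ 2 * s ^ 2 := by ring
  rw [e]
  nlinarith [mul_nonneg hK (sq_nonneg τ)]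

/-- Taylor's formula of second order with a bound for the oscillation of the second derivative. -/
lemma abs_taylor_le {φ₁ φ₂ : ℝ → ℝ} {c K : ℝ} {t' : ℝ} (hK : 0 ≤ K)
    (ht : t ∈ Icc 0 T) (ht' : t' ∈ Icc 0 T)
    (d1 : ∀ s ∈ Icc 0 T, HasDerivWithinAt φ (φ₁ s) (Icc 0 T) s)
    (d2 : ∀ s ∈ Icc 0 T, HasDerivWithinAt φ₁ (φ₂ s) (Icc 0 T) s)
    (h : ∀ s ∈ uIcc t t', |φ₂ s - c| ≤ K) :
    |φ t' - (φ t + (t' - t) * φ₁ t + (t' - t) ^ 2 / 2 * c)| ≤ K * (t' - t) ^ 2 := by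
  have sub : uIcc t t' ⊆ Icc 0 T := ordConnected_Icc.uIcc_subset ht ht'
  have b1 : ∀ s ∈ uIcc t t', |φ₁ s - φ₁ t - (s - t) * c| ≤ K * |t' - t| := fun s hs => by
    have := (convex_uIcc t t').norm_image_sub_le_of_norm_hasDerivWithin_le
      (f := fun s => φ₁ s - s * c) (f' := fun s => φ₂ s - c) (fun r hr => by
        have := ((d2 r (sub hr)).mono sub).sub ((hasDerivAt_id r).mul_const c).hasDerivWithinAt
        exact this.congr_deriv (by ring)) h left_mem_uIcc hs
    rw [Real.norm_eq_abs, Real.norm_eq_abs] at this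
    calc _ = |φ₁ s - s * c - (φ₁ t - t * c)| := by congr 1; ring
      _ ≤ _ := this.trans (mul_le_mul_of_nonneg_left (abs_sub_left_of_mem_uIcc hs) hK)
  have := (convex_uIcc t t').norm_image_sub_le_of_norm_hasDerivWithin_le
      (f := fun s => φ s - s * φ₁ t - (s - t) ^ 2 / 2 * c)
      (f' := fun s => φ₁ s - φ₁ t - (s - t) * c) (fun r hr => by
        have := (((d1 r (sub hr)).mono sub).sub
          ((hasDerivAt_id r).mul_const (φ₁ t)).hasDerivWithinAt).sub
          (((((hasDerivAt_id r).sub_const t).pow 2).div_const 2).mul_const c).hasDerivWithinAt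
        refine this.congr_deriv ?_
        simp) b1 left_mem_uIcc right_mem_uIcc
  rw [Real.norm_eq_abs, Real.norm_eq_abs, mul_assoc, ← sq, sq_abs] at this
  refine le_trans (le_of_eq ?_) this
  congr 1
  ring

end timeAvg

/-! ### Pointwise consequences of the regularity assumptions -/

/-- The pointwise bounds on a solution `E` that the error analysis uses: all of them are stated
by differences in space. -/
structure IsRegular (a b T K : ℝ) (E : ℝ → ℝ → ℝ) : Prop where
  isC2 : IsC2 a b T E
  bound : ∀ x ∈ Icc a b, ∀ t ∈ Icc 0 T, |E x t| ≤ K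
  dt_one : ∀ x ∈ Icc a b, ∀ t ∈ Icc 0 T, |dt T 1 E x t| ≤ K
  dt_two : ∀ x ∈ Icc a b, ∀ t ∈ Icc 0 T, |dt T 2 E x t| ≤ K
  dt_two_sub : ∀ x ∈ Icc a b, ∀ y ∈ Icc a b, ∀ t ∈ Icc 0 T,
    |dt T 2 E y t - dt T 2 E x t| ≤ K * |y - x|
  second_diff_dt_one : ∀ x s, 0 ≤ s → a ≤ x - s → x + s ≤ b → ∀ t ∈ Icc 0 T,
    |dt T 1 E (x + s) t - 2 * dt T 1 E x t + dt T 1 E (x - s) t| ≤ K * s ^ 2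
  second_diff_dt_two : ∀ x s, 0 ≤ s → a ≤ x - s → x + s ≤ b → ∀ t ∈ Icc 0 T,
    |dt T 2 E (x + s) t - 2 * dt T 2 E x t + dt T 2 E (x - s) t| ≤ K * s ^ 2
  second_diff : ∀ x s, 0 ≤ s → a ≤ x - s → x + s ≤ b → ∀ t ∈ Icc 0 T,
    |E (x + s) t - 2 * E x t + E (x - s) t - s ^ 2 * dx a b 2 E x t| ≤ K * s ^ 4

lemma dt_zero (T : ℝ) (u : ℝ → ℝ → ℝ) (x t : ℝ) : dt T 0 u x t = u x t := by
  unfold dt; rw [iteratedDerivWithin_zero]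

lemma isRegular_of_dtNorm_le {a b T K : ℝ} {E : ℝ → ℝ → ℝ} (hab : a < b) (hT : 0 < T) (hK : 0 ≤ K)
    (hE : IsC2 a b T E)
    (h0 : ∀ t ∈ Icc 0 T, dtNorm a b T 0 4 E t ≤ ENNReal.ofReal K)
    (h1 : ∀ t ∈ Icc 0 T, dtNorm a b T 1 2 E t ≤ ENNReal.ofReal K)
    (h2 : ∀ t ∈ Icc 0 T, dtNorm a b T 2 2 E t ≤ ENNReal.ofReal K) :
    IsRegular a b T (2 * (K + 1)) E := by
  have K1 : 0 ≤ K + 1 := by linarith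
  have c0 : ∀ t ∈ Icc 0 T, ContinuousOn (fun x => E x t) (Icc a b) := fun t ht =>
    continuousOn_slice_left hE.continuousOn ht
  have c1 : ∀ t ∈ Icc 0 T, ContinuousOn (fun x => dt T 1 E x t) (Icc a b) := fun t ht =>
    continuousOn_slice_left (hE.continuousOn_dt_one hab hT) ht
  have c2 : ∀ t ∈ Icc 0 T, ContinuousOn (fun x => dt T 2 E x t) (Icc a b) := fun t ht =>
    continuousOn_slice_left (hE.continuousOn_dt_two hab hT) ht
  have w0 : ∀ t ∈ Icc 0 T, ∃ w : ℕ → ℝ → ℝ, ∀ i ≤ 4, IsWeakDeriv a b i (fun x => E x t) (w i) ∧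
      ∀ᵐ x ∂volume.restrict (Ioo a b), |w i x| ≤ K + 1 := fun t ht => by
    have := exists_isWeakDeriv_of_sobolevNorm_le hK (h0 t ht) one_pos
    simpa only [dt_zero] using this
  have w1 := fun t ht => exists_isWeakDeriv_of_sobolevNorm_le hK (h1 t ht) one_pos
  have w2 := fun t ht => exists_isWeakDeriv_of_sobolevNorm_le hK (h2 t ht) one_pos
  refine ⟨hE, fun x hx t ht => ?_, fun x hx t ht => ?_, fun x hx t ht => ?_,
    fun x hx y hy t ht => ?_, fun x s hs hx hx' t ht => ?_, fun x s hs hx hx' t ht => ?_,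
    fun x s hs hx hx' t ht => ?_⟩
  · obtain ⟨w, hw⟩ := w0 t ht
    linarith [abs_le_of_isWeakDeriv hab (c0 t ht) K1 (hw 0 (by norm_num)).1 (hw 0 (by norm_num)).2 hx]
  · obtain ⟨w, hw⟩ := w1 t ht
    linarith [abs_le_of_isWeakDeriv hab (c1 t ht) K1 (hw 0 (by norm_num)).1 (hw 0 (by norm_num)).2 hx]
  · obtain ⟨w, hw⟩ := w2 t ht
    linarith [abs_le_of_isWeakDeriv hab (c2 t ht) K1 (hw 0 (by norm_num)).1 (hw 0 (by norm_num)).2 hx]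
  · obtain ⟨w, hw⟩ := w2 t ht
    have := abs_sub_le_of_isWeakDeriv hab (c2 t ht) K1 (hw 1 (by norm_num)).1
      (hw 1 (by norm_num)).2 hx hy
    nlinarith [abs_nonneg (y - x)]
  · obtain ⟨w, hw⟩ := w1 t ht
    exact abs_second_diff_le_of_isWeakDeriv hab (c1 t ht) K1 (hw 2 le_rfl).1
      (hw 2 le_rfl).2 hs hx hx'
  · obtain ⟨w, hw⟩ := w2 t ht
    exact abs_second_diff_le_of_isWeakDeriv hab (c2 t ht) K1 (hw 2 le_rfl).1
      (hw 2 le_rfl).2 hs hx hx'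
  · obtain ⟨w, hw⟩ := w0 t ht
    exact abs_second_diff_sub_le hab (fun x hx => hE.hasDerivWithinAt_dx_zero hab hx ht)
      (fun x hx => hE.hasDerivWithinAt_dx_one hab hT hx ht)
      (continuousOn_slice_left (hE.continuousOn_dx_two hab hT) ht) K1 (hw 4 le_rfl).1
      (hw 4 le_rfl).2 hs hx hx'

lemma abs_le_of_dtNorm_le {a b T K δ : ℝ} {u : ℝ → ℝ → ℝ} {m : ℕ} (hab : a < b) (hK : 0 ≤ K)
    (hδ : 0 < δ) (hu : IsC2 a b T u) {t : ℝ} (ht : t ∈ Icc 0 T)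
    (h : dtNorm a b T 0 m u t ≤ ENNReal.ofReal K) {x : ℝ} (hx : x ∈ Icc a b) :
    |u x t| ≤ K + δ := by
  obtain ⟨w, hw⟩ := exists_isWeakDeriv_of_sobolevNorm_le hK h hδ
  simp only [dt_zero] at hw
  exact abs_le_of_isWeakDeriv hab (continuousOn_slice_left hu.continuousOn ht) (by linarith)
    (hw 0 (Nat.zero_le _)).1 (hw 0 (Nat.zero_le _)).2 hx

/-- The uniform bounds from the assumption. Infima in the Sobolev norms cost a margin, which for `F`
is taken to be `ε`, so that `F = O(ε)` is kept. -/
theorem exists_regular_bounds {a b T α β : ℝ} (hab : a < b) (hT : 0 < T)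
    {E F E' : ℝ → ℝ → ℝ → ℝ}
    (hE : ∀ ε ∈ Ioc (0 : ℝ) 1, IsC2 a b T (E ε)) (hF : ∀ ε ∈ Ioc (0 : ℝ) 1, IsC2 a b T (F ε))
    (hE' : ∀ ε ∈ Ioc (0 : ℝ) 1, IsC2 a b T (E' ε)) (hA : AssumptionA a b T α β E F E') :
    ∃ K ≥ 0, ∀ ε ∈ Ioc (0 : ℝ) 1, IsRegular a b T K (E ε) ∧
      ∀ x ∈ Icc a b, ∀ t ∈ Icc 0 T, |F ε x t| ≤ K * ε ∧ |E' ε x t| ≤ K := by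
  obtain ⟨-, C, hC⟩ := hA
  have hC0 : (0 : ℝ) ≤ C := C.2
  refine ⟨2 * (C + 1), by linarith, fun ε hε => ⟨?_, fun x hx t ht => ⟨?_, ?_⟩⟩⟩
  · refine isRegular_of_dtNorm_le hab hT hC0 (hE ε hε) (fun t ht => ?_) (fun t ht => ?_)
      (fun t ht => ?_) <;> rw [ENNReal.ofReal_coe_nnreal]
    · exact le_trans (le_self_add.trans (le_self_add.trans le_self_add)) (hC ε hε t ht).1
    · exact le_trans (le_add_self.trans (le_self_add.trans le_self_add)) (hC ε hε t ht).1
    · exact le_trans (le_add_self.trans le_self_add) (hC ε hε t ht).1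
  · have h1 := (hC ε hε t ht).2.2.2.1
    rw [← ENNReal.ofReal_coe_nnreal, ← ENNReal.ofReal_mul hC0] at h1
    have := abs_le_of_dtNorm_le hab (mul_nonneg hC0 hε.1.le) hε.1 (hF ε hε) ht h1 hx
    nlinarith [hε.1]
  · have h1 := (hC ε hε t ht).2.1
    rw [← ENNReal.ofReal_coe_nnreal] at h1
    have := abs_le_of_dtNorm_le hab hC0 one_pos (hE' ε hε) ht
      ((le_self_add.trans le_self_add).trans h1) hx
    linarith

/-- By the boundary condition the supremum over the open interval bounds `E` up to the boundary. -/
lemma abs_le_supBound {a b T K : ℝ} (hab : a < b) {E E' : ℝ → ℝ → ℝ → ℝ}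
    (hK : ∀ ε ∈ Ioc (0 : ℝ) 1, ∀ x ∈ Icc a b, ∀ t ∈ Icc 0 T, |E ε x t| ≤ K ∧ |E' ε x t| ≤ K)
    {ε : ℝ} (hε : ε ∈ Ioc (0 : ℝ) 1) (hb : Dirichlet a b T (E ε)) {x : ℝ} (hx : x ∈ Icc a b)
    {t : ℝ} (ht : t ∈ Icc 0 T) : |E ε x t| ≤ supBound a b T E E' := by
  have hbdd : BddAbove {r | ∃ ε ∈ Ioc (0 : ℝ) 1, ∃ x ∈ Ioo a b, ∃ t ∈ Icc 0 T,
      r = |E ε x t| ∨ r = |E' ε x t|} := by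
    refine ⟨K, ?_⟩
    rintro r ⟨ε, hε, x, hx, t, ht, rfl | rfl⟩
    · exact (hK ε hε x (Ioo_subset_Icc_self hx) t ht).1
    · exact (hK ε hε x (Ioo_subset_Icc_self hx) t ht).2
  have hI : ∀ y ∈ Ioo a b, |E ε y t| ≤ supBound a b T E E' := fun y hy =>
    le_csSup hbdd ⟨ε, hε, y, hy, t, ht, Or.inl rfl⟩
  have h0 : 0 ≤ supBound a b T E E' :=
    (abs_nonneg _).trans (hI ((a + b) / 2) ⟨by linarith, by linarith⟩)
  rcases eq_endpoints_or_mem_Ioo_of_mem_Icc hx with rfl | rfl | hx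
  · rw [(hb t ht).1, abs_zero]; exact h0
  · rw [(hb t ht).2, abs_zero]; exact h0
  · exact hI x hx

/-! ### The differential equation at time zero and on the boundary -/

section equation

variable {a b T ε : ℝ} {E₀ E₁ : ℝ → ℝ} {G E F : ℝ → ℝ → ℝ}

/-- The equation for `E`, solved for `∂ₜₜE`, up to the initial time. -/
lemma IsKGZSolution.dt_two_eq (hab : a < b) (hT : 0 < T) (h : IsKGZSolution a b T ε E₀ E₁ G E F)
    (hG : IsC2 a b T G) {x : ℝ} (hx : x ∈ Ioo a b) {t : ℝ} (ht : t ∈ Icc 0 T) :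
    dt T 2 E x t = dx a b 2 E x t - E x t + E x t ^ 3 - F x t * E x t - G x t * E x t := by
  have hx' := Ioo_subset_Icc_self hx
  have cE := continuousOn_slice_right h.regular_E.continuousOn hx'
  have cF := continuousOn_slice_right h.regular_F.continuousOn hx'
  have cG := continuousOn_slice_right hG.continuousOn hx'
  have cx := continuousOn_slice_right (h.regular_E.continuousOn_dx_two hab hT) hx'
  have ct := continuousOn_slice_right (h.regular_E.continuousOn_dt_two hab hT) hx'
  have key : EqOn (fun t => dt T 2 E x t)
      (fun t => dx a b 2 E x t - E x t + E x t ^ 3 - F x t * E x t - G x t * E x t) (Ioc 0 T) :=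
    fun s hs => by
      have := h.pde_E x hx s hs
      simp only
      linarith
  exact key.of_subset_closure ct
    ((((cx.sub cE).add (cE.pow 3)).sub (cF.mul cE)).sub (cG.mul cE)) Ioc_subset_Icc_self
    (closure_Ioc hT.ne).ge ht

lemma IsKGZSolution.initDttE_eq {α β : ℝ} {ω₀ ω₁ : ℝ → ℝ} (hab : a < b) (hT : 0 < T)
    (h : IsKGZSolution a b T ε E₀ E₁ G E F) (hG : IsWaveSolution a b T α β ε ω₀ ω₁ G)
    {x : ℝ} (hx : x ∈ Ioo a b) : initDttE α ε E₀ ω₀ x = dt T 2 E x 0 := by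
  have hx' := Ioo_subset_Icc_self hx
  have e1 : iteratedDeriv 2 E₀ x = dx a b 2 E x 0 := by
    have h1 : dx a b 2 E x 0 = iteratedDerivWithin 2 E₀ (Icc a b) x :=
      iteratedDerivWithin_congr h.init_E hx'
    rw [h1, iteratedDerivWithin_eq_iteratedFDerivWithin, iteratedDeriv_eq_iteratedFDeriv,
      ← iteratedFDerivWithin_univ]
    congr 1
    exact (iteratedFDerivWithin_congr_set
      (Filter.eventuallyEq_univ.2 (Icc_mem_nhds hx.1 hx.2)) 2).symm
  rw [h.dt_two_eq hab hT hG.regular hx (left_mem_Icc.2 hT.le), h.init_E x hx', h.init_F x hx',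
    hG.init x hx', ← e1]
  unfold initDttE
  ring

/-- At a point where `u` vanishes for all times, so do its time derivatives. -/
lemma IsC2.dt_eq_zero (hab : a < b) (hT : 0 < T) {u : ℝ → ℝ → ℝ} (hu : IsC2 a b T u) {x : ℝ}
    (hx : x ∈ Icc a b) (h : ∀ t ∈ Icc 0 T, u x t = 0) {t : ℝ} (ht : t ∈ Icc 0 T) :
    dt T 1 u x t = 0 ∧ dt T 2 u x t = 0 := by
  have h1 : ∀ t ∈ Icc 0 T, dt T 1 u x t = 0 := fun t ht =>
    (uniqueDiffOn_Icc hT t ht).eq_deriv _ (hu.hasDerivWithinAt_dt_zero hT hx ht)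
      ((hasDerivWithinAt_const t _ (0 : ℝ)).congr h (h t ht))
  exact ⟨h1 t ht, (uniqueDiffOn_Icc hT t ht).eq_deriv _ (hu.hasDerivWithinAt_dt_one hab hT hx ht)
      ((hasDerivWithinAt_const t _ (0 : ℝ)).congr h1 (h1 t ht))⟩

end equation

/-! ### Consistency of the scheme -/

section averages

variable {T τ t K : ℝ} {φ φ₁ φ₂ : ℝ → ℝ}

lemma abs_sub_affine_le (d1 : ∀ s ∈ Icc 0 T, HasDerivWithinAt φ (φ₁ s) (Icc 0 T) s)
    (d2 : ∀ s ∈ Icc 0 T, HasDerivWithinAt φ₁ (φ₂ s) (Icc 0 T) s) (hK : 0 ≤ K)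
    (h : ∀ s ∈ Icc 0 T, |φ₂ s| ≤ K) (ht : t ∈ Icc 0 T) {s : ℝ} (hs : s ∈ Icc 0 T) :
    |φ s - (φ t + (s - t) * φ₁ t)| ≤ K * (s - t) ^ 2 := by
  have := abs_taylor_le (c := 0) hK ht hs d1 d2 fun r hr => by
    rw [sub_zero]; exact h r (ordConnected_Icc.uIcc_subset ht hs hr)
  simpa using this

lemma abs_avg_sub_le (d1 : ∀ s ∈ Icc 0 T, HasDerivWithinAt φ (φ₁ s) (Icc 0 T) s)
    (d2 : ∀ s ∈ Icc 0 T, HasDerivWithinAt φ₁ (φ₂ s) (Icc 0 T) s) (hK : 0 ≤ K)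
    (h : ∀ s ∈ Icc 0 T, |φ₂ s| ≤ K) (hτ : 0 < τ) (h0 : 0 ≤ t - τ) (h1 : t + τ ≤ T) :
    |(φ (t + τ) + φ (t - τ)) / 2 - φ t| ≤ K * τ ^ 2 := by
  have ht : t ∈ Icc 0 T := ⟨by linarith, by linarith⟩
  have a1 := abs_sub_affine_le d1 d2 hK h ht (s := t + τ) ⟨by linarith, h1⟩
  have a2 := abs_sub_affine_le d1 d2 hK h ht (s := t - τ) ⟨h0, by linarith⟩
  have e1 : (t + τ - t) = τ := by ring
  have e2 : (t - τ - t) = -τ := by ring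
  rw [e1] at a1
  rw [e2, neg_sq] at a2
  rw [abs_le] at a1 a2 ⊢
  constructor <;> linarith [a1.1, a1.2, a2.1, a2.2]

lemma abs_timeAvg_sub_avg_le (d1 : ∀ s ∈ Icc 0 T, HasDerivWithinAt φ (φ₁ s) (Icc 0 T) s)
    (d2 : ∀ s ∈ Icc 0 T, HasDerivWithinAt φ₁ (φ₂ s) (Icc 0 T) s) (hK : 0 ≤ K)
    (h : ∀ s ∈ Icc 0 T, |φ₂ s| ≤ K) (hτ : 0 < τ) (h0 : 0 ≤ t - τ) (h1 : t + τ ≤ T) :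
    |timeAvg τ φ t - (φ (t + τ) + φ (t - τ)) / 2| ≤ 3 * (K * τ ^ 2) := by
  have ht : t ∈ Icc 0 T := ⟨by linarith, by linarith⟩
  have a1 := abs_timeAvg_sub_le (fun s hs => (d1 s hs).continuousWithinAt) hτ h0 h1 hK
    (c := φ₁ t) fun s hs => abs_sub_affine_le d1 d2 hK h ht hs
  have a2 := abs_avg_sub_le d1 d2 hK h hτ h0 h1
  rw [abs_le] at a1 a2 ⊢
  constructor <;> linarith [a1.1, a1.2, a2.1, a2.2]

lemma abs_cube_sub_le {u c σ y : ℝ} (hK : 0 ≤ K) (hu : |u| ≤ K) (hy : |y - u| ≤ 2 * K)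
    (h1 : |y - u| ≤ K * |σ|) (h2 : |y - (u + σ * c)| ≤ K * σ ^ 2) :
    |y ^ 3 - (u ^ 3 + σ * (3 * u ^ 2 * c))| ≤ 8 * K ^ 3 * σ ^ 2 := by
  have e : y ^ 3 - (u ^ 3 + σ * (3 * u ^ 2 * c))
      = 3 * u ^ 2 * (y - (u + σ * c)) + (3 * u + (y - u)) * (y - u) ^ 2 := by ring
  have hu2 : u ^ 2 ≤ K ^ 2 := by rw [← sq_abs]; exact pow_le_pow_left₀ (abs_nonneg _) hu 2
  have h3 : (y - u) ^ 2 ≤ K ^ 2 * σ ^ 2 := by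
    rw [← sq_abs, ← sq_abs σ, ← mul_pow]; exact pow_le_pow_left₀ (abs_nonneg _) h1 2
  have h4 : |3 * u + (y - u)| ≤ 5 * K := by
    refine (abs_add_le _ _).trans ?_
    rw [abs_mul, abs_of_pos (by norm_num : (0 : ℝ) < 3)]
    linarith
  rw [e]
  refine (abs_add_le _ _).trans ?_
  rw [abs_mul (3 * u ^ 2), abs_mul (3 * u + (y - u)),
    abs_of_nonneg (by positivity : 0 ≤ 3 * u ^ 2), abs_of_nonneg (sq_nonneg (y - u))]
  calc _ ≤ 3 * K ^ 2 * (K * σ ^ 2) + 5 * K * (K ^ 2 * σ ^ 2) := by gcongr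
    _ = _ := by ring

end averages

section consistency

variable {a b T ε K l : ℝ} {E₀ E₁ : ℝ → ℝ} {G E F : ℝ → ℝ → ℝ}

namespace IsRegular

lemma hasDeriv_zero (hE : IsRegular a b T K E) (hT : 0 < T) {x : ℝ} (hx : x ∈ Icc a b) :
    ∀ s ∈ Icc 0 T, HasDerivWithinAt (fun s => E x s) (dt T 1 E x s) (Icc 0 T) s :=
  fun _ hs => hE.isC2.hasDerivWithinAt_dt_zero hT hx hs

lemma hasDeriv_one (hE : IsRegular a b T K E) (hab : a < b) (hT : 0 < T) {x : ℝ}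
    (hx : x ∈ Icc a b) :
    ∀ s ∈ Icc 0 T, HasDerivWithinAt (fun s => dt T 1 E x s) (dt T 2 E x s) (Icc 0 T) s :=
  fun _ hs => hE.isC2.hasDerivWithinAt_dt_one hab hT hx hs

lemma abs_sub_le (hE : IsRegular a b T K E) (hT : 0 < T) {x : ℝ} (hx : x ∈ Icc a b) {s t : ℝ}
    (hs : s ∈ Icc 0 T) (ht : t ∈ Icc 0 T) : |E x s - E x t| ≤ K * |s - t| :=
  (convex_Icc 0 T).norm_image_sub_le_of_norm_hasDerivWithin_le (hE.hasDeriv_zero hT hx)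
    (hE.dt_one x hx) ht hs

end IsRegular

/-- Second difference quotient in space. -/
noncomputable def spaceDiff (h : ℝ) (u : ℝ → ℝ → ℝ) (x t : ℝ) : ℝ :=
  (u (x + h) t - 2 * u x t + u (x - h) t) / h ^ 2

lemma hasDerivWithinAt_spaceDiff {h x : ℝ} {u u' : ℝ → ℝ → ℝ} {I : Set ℝ} {s : ℝ}
    (hp : HasDerivWithinAt (fun s => u (x + h) s) (u' (x + h) s) I s)
    (h0 : HasDerivWithinAt (fun s => u x s) (u' x s) I s)
    (hm : HasDerivWithinAt (fun s => u (x - h) s) (u' (x - h) s) I s) :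
    HasDerivWithinAt (fun s => spaceDiff h u x s) (spaceDiff h u' x s) I s :=
  ((hp.sub (h0.const_mul 2)).add hm).div_const (h ^ 2)

namespace IsRegular

variable {h x : ℝ}

lemma spaceDiff_sub_le (hE : IsRegular a b T K E) (hh : 0 < h) (hx : a ≤ x - h) (hx' : x + h ≤ b)
    {s : ℝ} (hs : s ∈ Icc 0 T) : |dx a b 2 E x s - spaceDiff h E x s| ≤ K * h ^ 2 := by
  have := hE.second_diff x h hh.le hx hx' s hs
  have e : dx a b 2 E x s - spaceDiff h E x s
      = -((E (x + h) s - 2 * E x s + E (x - h) s - h ^ 2 * dx a b 2 E x s) / h ^ 2) := by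
    unfold spaceDiff; field_simp; ring
  rw [e, abs_neg, abs_div, abs_of_pos (by positivity : 0 < h ^ 2), div_le_iff₀ (by positivity)]
  linarith

lemma spaceDiff_hasDeriv_zero (hE : IsRegular a b T K E) (hT : 0 < T) (hh : 0 < h)
    (hx : a ≤ x - h) (hx' : x + h ≤ b) : ∀ s ∈ Icc 0 T,
      HasDerivWithinAt (fun s => spaceDiff h E x s) (spaceDiff h (dt T 1 E) x s) (Icc 0 T) s :=
  fun s hs => hasDerivWithinAt_spaceDiff
    (hE.hasDeriv_zero hT ⟨by linarith, by linarith⟩ s hs)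
    (hE.hasDeriv_zero hT ⟨by linarith, by linarith⟩ s hs)
    (hE.hasDeriv_zero hT ⟨by linarith, by linarith⟩ s hs)

lemma spaceDiff_hasDeriv_one (hE : IsRegular a b T K E) (hab : a < b) (hT : 0 < T) (hh : 0 < h)
    (hx : a ≤ x - h) (hx' : x + h ≤ b) : ∀ s ∈ Icc 0 T,
      HasDerivWithinAt (fun s => spaceDiff h (dt T 1 E) x s) (spaceDiff h (dt T 2 E) x s)
        (Icc 0 T) s :=
  fun s hs => hasDerivWithinAt_spaceDiff
    (hE.hasDeriv_one hab hT ⟨by linarith, by linarith⟩ s hs)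
    (hE.hasDeriv_one hab hT ⟨by linarith, by linarith⟩ s hs)
    (hE.hasDeriv_one hab hT ⟨by linarith, by linarith⟩ s hs)

lemma abs_spaceDiff_dt_one_le (hE : IsRegular a b T K E) (hh : 0 < h)
    (hx : a ≤ x - h) (hx' : x + h ≤ b) : ∀ s ∈ Icc 0 T, |spaceDiff h (dt T 1 E) x s| ≤ K :=
  fun s hs => by
    unfold spaceDiff
    rw [abs_div, abs_of_pos (by positivity : 0 < h ^ 2), div_le_iff₀ (by positivity)]
    exact hE.second_diff_dt_one x h hh.le hx hx' s hs

lemma abs_spaceDiff_dt_two_le (hE : IsRegular a b T K E) (hh : 0 < h)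
    (hx : a ≤ x - h) (hx' : x + h ≤ b) : ∀ s ∈ Icc 0 T, |spaceDiff h (dt T 2 E) x s| ≤ K :=
  fun s hs => by
    unfold spaceDiff
    rw [abs_div, abs_of_pos (by positivity : 0 < h ^ 2), div_le_iff₀ (by positivity)]
    exact hE.second_diff_dt_two x h hh.le hx hx' s hs

end IsRegular

/-- Constant in the bound of the consistency error. -/
noncomputable def consistencyConst (K : ℝ) : ℝ := 8 * K + 17 * K ^ 3 + 6 * K ^ 2

/-- The consistency error of the Klein-Gordon part. The source `F = O(ε)` is not resolved but
counted as an error. The averaged potential resolves the oscillations of `G` in time; what is left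
is the variation of `E`, of order `τ`, against the size `l` of `G`. -/
theorem consistency_E {τ t h x : ℝ} (hab : a < b) (hT : 0 < T) (hK : 0 ≤ K)
    (hE : IsRegular a b T K E) (hsol : IsKGZSolution a b T ε E₀ E₁ G E F) (hG : IsC2 a b T G)
    (hF : ∀ x ∈ Icc a b, ∀ t ∈ Icc 0 T, |F x t| ≤ K * ε)
    (hGl : ∀ x ∈ Icc a b, ∀ t ∈ Icc 0 T, |G x t| ≤ K * l)
    (hh : 0 < h) (hx : a ≤ x - h) (hx' : x + h ≤ b)
    (hτ : 0 < τ) (h0 : 0 ≤ t - τ) (h1 : t + τ ≤ T) (hε : 0 ≤ ε) (hl : 0 ≤ l) :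
    |(E x (t + τ) - 2 * E x t + E x (t - τ)) / τ ^ 2
      - ((spaceDiff h E x (t + τ) + spaceDiff h E x (t - τ)) / 2
        - (E x (t + τ) + E x (t - τ)) / 2
        - timeAvg τ (fun s => G x s) t * ((E x (t + τ) + E x (t - τ)) / 2)
        + E x t ^ 2 * ((E x (t + τ) + E x (t - τ)) / 2))|
      ≤ consistencyConst K * (h ^ 2 + τ ^ 2 + τ * l + ε) := by
  have xo : x ∈ Ioo a b := ⟨by linarith, by linarith⟩
  have xi := Ioo_subset_Icc_self xo
  have ht : t ∈ Icc 0 T := ⟨by linarith, by linarith⟩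
  have htp : t + τ ∈ Icc 0 T := ⟨by linarith, h1⟩
  have htm : t - τ ∈ Icc 0 T := ⟨h0, by linarith⟩
  have cE := continuousOn_slice_right hsol.regular_E.continuousOn xi
  have cF := continuousOn_slice_right hsol.regular_F.continuousOn xi
  have cG := continuousOn_slice_right hG.continuousOn xi
  have cx := continuousOn_slice_right (hE.isC2.continuousOn_dx_two hab hT) xi
  have ct := continuousOn_slice_right (hE.isC2.continuousOn_dt_two hab hT) xi
  have cQ : ContinuousOn (fun s => spaceDiff h E x s) (Icc 0 T) := fun s hs =>
    (hE.spaceDiff_hasDeriv_zero hT hh hx hx' s hs).continuousWithinAt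
  set A := (E x (t + τ) + E x (t - τ)) / 2 with hA
  have cE3 : ContinuousOn (fun s => E x s ^ 3) (Icc 0 T) := cE.pow 3
  have c1 : ContinuousOn (fun s => dx a b 2 E x s - E x s) (Icc 0 T) := cx.sub cE
  have c2 : ContinuousOn (fun s => dx a b 2 E x s - E x s + E x s ^ 3) (Icc 0 T) :=
    c1.add cE3
  have cFE : ContinuousOn (fun s => F x s * E x s) (Icc 0 T) := cF.mul cE
  have cGE : ContinuousOn (fun s => G x s * E x s) (Icc 0 T) := cG.mul cE
  have cGA : ContinuousOn (fun s => G x s * A) (Icc 0 T) := cG.mul continuousOn_const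
  have c3 : ContinuousOn (fun s => dx a b 2 E x s - E x s + E x s ^ 3 - F x s * E x s)
      (Icc 0 T) := c2.sub cFE
  have eTT : timeAvg τ (fun s => dt T 2 E x s) t
      = (E x (t + τ) - 2 * E x t + E x (t - τ)) / τ ^ 2 :=
    timeAvg_second_deriv (hE.hasDeriv_zero hT xi) (hE.hasDeriv_one hab hT xi) ct hτ h0 h1
  have split : timeAvg τ (fun s => dt T 2 E x s) t
      = timeAvg τ (fun s => dx a b 2 E x s) t - timeAvg τ (fun s => E x s) t
        + timeAvg τ (fun s => E x s ^ 3) t - timeAvg τ (fun s => F x s * E x s) t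
        - timeAvg τ (fun s => G x s * E x s) t := by
    have e1 : timeAvg τ (fun s => dt T 2 E x s) t = timeAvg τ (fun s => dx a b 2 E x s - E x s
        + E x s ^ 3 - F x s * E x s - G x s * E x s) t := by
      unfold timeAvg
      refine intervalIntegral.integral_congr fun s hs => ?_
      rw [uIcc_of_le (by norm_num)] at hs
      simp only [hsol.dt_two_eq hab hT hG xo (add_mul_mem_Icc hτ h0 h1 hs)]
    rw [e1, timeAvg_sub c3 cGE hτ h0 h1, timeAvg_sub c2 cFE hτ h0 h1,
      timeAvg_add c1 cE3 hτ h0 h1, timeAvg_sub cx cE hτ h0 h1]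
  have p1 : |timeAvg τ (fun s => dx a b 2 E x s) t - timeAvg τ (fun s => spaceDiff h E x s) t|
      ≤ 2 * (K * h ^ 2) := by
    rw [← timeAvg_sub cx cQ hτ h0 h1]
    exact abs_timeAvg_le fun s hs =>
      hE.spaceDiff_sub_le hh hx hx' (add_mul_mem_Icc hτ h0 h1 hs)
  have p2 := abs_timeAvg_sub_avg_le (hE.spaceDiff_hasDeriv_zero hT hh hx hx')
    (hE.spaceDiff_hasDeriv_one hab hT hh hx hx') hK (hE.abs_spaceDiff_dt_two_le hh hx hx') hτ h0 h1
  have p3 := abs_timeAvg_sub_avg_le (hE.hasDeriv_zero hT xi) (hE.hasDeriv_one hab hT xi) hK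
    (hE.dt_two x xi) hτ h0 h1
  have p4 : |timeAvg τ (fun s => E x s ^ 3) t - E x t ^ 3| ≤ 2 * (8 * K ^ 3 * τ ^ 2) := by
    refine abs_timeAvg_sub_le cE3 hτ h0 h1 (by positivity)
      (c := 3 * E x t ^ 2 * dt T 1 E x t) fun s hs => ?_
    refine abs_cube_sub_le hK (hE.bound x xi t ht) ?_ (hE.abs_sub_le hT xi hs ht)
      (abs_sub_affine_le (hE.hasDeriv_zero hT xi) (hE.hasDeriv_one hab hT xi) hK
        (hE.dt_two x xi) ht hs)
    have b1 := hE.bound x xi t ht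
    have b2 := hE.bound x xi s hs
    rw [abs_le] at b1 b2 ⊢
    constructor <;> linarith [b1.1, b1.2, b2.1, b2.2]
  have p5 : |E x t ^ 3 - E x t ^ 2 * A| ≤ K ^ 2 * (K * τ ^ 2) := by
    have b1 := abs_avg_sub_le (hE.hasDeriv_zero hT xi) (hE.hasDeriv_one hab hT xi) hK
      (hE.dt_two x xi) hτ h0 h1
    have e : E x t ^ 3 - E x t ^ 2 * A = E x t ^ 2 * -(A - E x t) := by ring
    have hu2 : E x t ^ 2 ≤ K ^ 2 := by
      rw [← sq_abs]; exact pow_le_pow_left₀ (abs_nonneg _) (hE.bound x xi t ht) 2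
    rw [e, abs_mul, abs_neg, abs_of_nonneg (sq_nonneg (E x t))]
    gcongr
  have p6 : |timeAvg τ (fun s => F x s * E x s) t| ≤ 2 * (K * ε * K) :=
    abs_timeAvg_le fun s hs => by
      have m := add_mul_mem_Icc hτ h0 h1 hs
      rw [abs_mul]
      exact mul_le_mul (hF x xi _ m) (hE.bound x xi _ m) (abs_nonneg _) (by positivity)
  have p7 : |timeAvg τ (fun s => G x s * E x s) t - timeAvg τ (fun s => G x s) t * A|
      ≤ 2 * (K * l * (2 * K * τ)) := by
    rw [← timeAvg_mul_const, ← timeAvg_sub cGE cGA hτ h0 h1]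
    refine abs_timeAvg_le fun s hs => ?_
    have m := add_mul_mem_Icc hτ h0 h1 hs
    rw [← mul_sub, abs_mul]
    refine mul_le_mul (hGl x xi _ m) ?_ (abs_nonneg _) (by positivity)
    have b1 := hE.abs_sub_le hT xi m htp
    have b2 := hE.abs_sub_le hT xi m htm
    have c1 : |t + s * τ - (t + τ)| ≤ 2 * τ := by
      rw [abs_le]; constructor <;> nlinarith [hs.1, hs.2]
    have c2 : |t + s * τ - (t - τ)| ≤ 2 * τ := by
      rw [abs_le]; constructor <;> nlinarith [hs.1, hs.2]
    have d1 := b1.trans (mul_le_mul_of_nonneg_left c1 hK)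
    have d2 := b2.trans (mul_le_mul_of_nonneg_left c2 hK)
    rw [abs_le] at d1 d2 ⊢
    constructor <;> linarith [d1.1, d1.2, d2.1, d2.2]
  rw [← eTT, split]
  have tot : ∀ {x1 x2 x3 x4 x5 x6 x7 x8 x9 x10 x11 c1 c2 c3 c4 c5 c6 c7 : ℝ},
      |x1 - x2| ≤ c1 → |x2 - x3| ≤ c2 → |x4 - x5| ≤ c3 → |x6 - x7| ≤ c4 → |x7 - x8| ≤ c5 →
      |x9| ≤ c6 → |x10 - x11| ≤ c7 →
      |x1 - x4 + x6 - x9 - x10 - (x3 - x5 - x11 + x8)| ≤ c1 + c2 + c3 + c4 + c5 + c6 + c7 := by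
    intros
    rw [abs_le] at *
    constructor <;> linarith
  refine (tot p1 p2 p3 p4 p5 p6 p7).trans ?_
  unfold consistencyConst
  have hτl : 0 ≤ τ * l := by positivity
  have K2 : 0 ≤ K ^ 2 := by positivity
  have K3 : 0 ≤ K ^ 3 := by positivity
  have q1 : 0 ≤ K * (τ * l + ε) := by positivity
  have q2 : 0 ≤ K ^ 3 * (h ^ 2 + τ * l + ε) := by positivity
  have q3 : 0 ≤ K ^ 2 * (h ^ 2 + τ ^ 2 + τ * l + ε) := by positivity
  have q4 : 0 ≤ K ^ 2 * (τ * l) := by positivity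
  have q5 : 0 ≤ K ^ 2 * ε := by positivity
  have q6 : 0 ≤ K ^ 2 * (h ^ 2 + τ ^ 2) := by positivity
  have q7 : 0 ≤ K * h ^ 2 := by positivity
  have q8 : 0 ≤ K * τ ^ 2 := by positivity
  linarith

end consistency

/-! ### The first time step -/

section first

variable {a b T ε K l : ℝ} {E₀ E₁ : ℝ → ℝ} {G E F : ℝ → ℝ → ℝ}

lemma IsRegular.mono {K' : ℝ} (hE : IsRegular a b T K E) (h : K ≤ K') : IsRegular a b T K' E where
  isC2 := hE.isC2
  bound x hx t ht := (hE.bound x hx t ht).trans h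
  dt_one x hx t ht := (hE.dt_one x hx t ht).trans h
  dt_two x hx t ht := (hE.dt_two x hx t ht).trans h
  dt_two_sub x hx y hy t ht := (hE.dt_two_sub x hx y hy t ht).trans (by gcongr)
  second_diff_dt_one x s hs hx hx' t ht :=
    (hE.second_diff_dt_one x s hs hx hx' t ht).trans (by gcongr)
  second_diff_dt_two x s hs hx hx' t ht :=
    (hE.second_diff_dt_two x s hs hx hx' t ht).trans (by gcongr)
  second_diff x s hs hx hx' t ht := (hE.second_diff x s hs hx hx' t ht).trans (by gcongr)

/-- The oscillation of `∂ₜₜE` near the initial time. It is bounded through the equation, since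
`∂ₜ³E` may be of size `1 / ε`. -/
lemma abs_dt_two_sub_init_le {s h x : ℝ} (hab : a < b) (hT : 0 < T) (hK : 0 ≤ K)
    (hE : IsRegular a b T K E) (hsol : IsKGZSolution a b T ε E₀ E₁ G E F) (hG : IsC2 a b T G)
    (hF : ∀ x ∈ Icc a b, ∀ t ∈ Icc 0 T, |F x t| ≤ K * ε)
    (hGl : ∀ x ∈ Icc a b, ∀ t ∈ Icc 0 T, |G x t| ≤ K * l)
    (hh : 0 < h) (hx : a ≤ x - h) (hx' : x + h ≤ b) (hs : s ∈ Icc 0 T) :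
    |dt T 2 E x s - dt T 2 E x 0|
      ≤ 2 * K * h ^ 2 + (2 * K + 3 * K ^ 3) * s + 2 * K ^ 2 * ε + 2 * K ^ 2 * l := by
  have xo : x ∈ Ioo a b := ⟨by linarith, by linarith⟩
  have xi := Ioo_subset_Icc_self xo
  have h0 : (0 : ℝ) ∈ Icc 0 T := left_mem_Icc.2 hT.le
  have e0 : |s - 0| = s := by rw [sub_zero, abs_of_nonneg hs.1]
  have p1 := hE.spaceDiff_sub_le hh hx hx' hs
  have p2 := hE.spaceDiff_sub_le hh hx hx' h0
  have p3 : |spaceDiff h E x s - spaceDiff h E x 0| ≤ K * s := by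
    have := (convex_Icc 0 T).norm_image_sub_le_of_norm_hasDerivWithin_le
      (hE.spaceDiff_hasDeriv_zero hT hh hx hx') (hE.abs_spaceDiff_dt_one_le hh hx hx') h0 hs
    rwa [Real.norm_eq_abs, Real.norm_eq_abs, e0] at this
  have p4 := hE.abs_sub_le hT xi hs h0
  rw [e0] at p4
  have b1 := hE.bound x xi s hs
  have b2 := hE.bound x xi 0 h0
  have p5 : |E x s ^ 3 - E x 0 ^ 3| ≤ 3 * K ^ 2 * (K * s) := by
    have e : E x s ^ 3 - E x 0 ^ 3
        = (E x s ^ 2 + E x s * E x 0 + E x 0 ^ 2) * (E x s - E x 0) := by ring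
    rw [e, abs_mul]
    have q1 : |E x s| ^ 2 ≤ K ^ 2 := pow_le_pow_left₀ (abs_nonneg _) b1 2
    have q2 : |E x 0| ^ 2 ≤ K ^ 2 := pow_le_pow_left₀ (abs_nonneg _) b2 2
    have q3 : |E x s| * |E x 0| ≤ K * K := mul_le_mul b1 b2 (abs_nonneg _) hK
    have q : |E x s ^ 2 + E x s * E x 0 + E x 0 ^ 2| ≤ 3 * K ^ 2 := by
      refine (abs_add_three _ _ _).trans ?_
      rw [abs_mul, abs_pow, abs_pow]
      linarith
    exact mul_le_mul q p4 (abs_nonneg _) (by positivity)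
  have pF : ∀ s ∈ Icc 0 T, |F x s * E x s| ≤ K * ε * K := fun s hs => by
    rw [abs_mul]
    exact mul_le_mul (hF x xi s hs) (hE.bound x xi s hs) (abs_nonneg _)
      ((abs_nonneg _).trans (hF x xi s hs))
  have pG : ∀ s ∈ Icc 0 T, |G x s * E x s| ≤ K * l * K := fun s hs => by
    rw [abs_mul]
    exact mul_le_mul (hGl x xi s hs) (hE.bound x xi s hs) (abs_nonneg _)
      ((abs_nonneg _).trans (hGl x xi s hs))
  have p6 := pF s hs
  have p7 := pF 0 h0
  have p8 := pG s hs
  have p9 := pG 0 h0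
  rw [hsol.dt_two_eq hab hT hG xo hs, hsol.dt_two_eq hab hT hG xo h0]
  rw [abs_le] at p1 p2 p3 p4 p5 p6 p7 p8 p9 ⊢
  constructor <;> linarith [p1.1, p1.2, p2.1, p2.2, p3.1, p3.2, p4.1, p4.2, p5.1, p5.2, p6.1,
    p6.2, p7.1, p7.2, p8.1, p8.2, p9.1, p9.2]

/-- The error of the second order Taylor polynomial of `E` at the initial time. -/
noncomputable def taylorError (T τ : ℝ) (E : ℝ → ℝ → ℝ) (x : ℝ) : ℝ :=
  E x τ - (E x 0 + τ * dt T 1 E x 0 + τ ^ 2 / 2 * dt T 2 E x 0)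

lemma abs_taylorError_le {τ h x : ℝ} (hab : a < b) (hT : 0 < T) (hK : 0 ≤ K)
    (hE : IsRegular a b T K E) (hsol : IsKGZSolution a b T ε E₀ E₁ G E F) (hG : IsC2 a b T G)
    (hF : ∀ x ∈ Icc a b, ∀ t ∈ Icc 0 T, |F x t| ≤ K * ε)
    (hGl : ∀ x ∈ Icc a b, ∀ t ∈ Icc 0 T, |G x t| ≤ K * l)
    (hh : 0 < h) (hx : a ≤ x - h) (hx' : x + h ≤ b)
    (hτ : 0 < τ) (hτ1 : τ ≤ 1) (hτT : τ ≤ T) (hε : 0 ≤ ε) (hl : 0 ≤ l) :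
    |taylorError T τ E x| ≤ τ * (consistencyConst K * (h ^ 2 + τ ^ 2 + τ * l + ε)) := by
  have xi : x ∈ Icc a b := ⟨by linarith, by linarith⟩
  have h0 : (0 : ℝ) ∈ Icc 0 T := left_mem_Icc.2 hT.le
  have key := abs_taylor_le (t := 0) (t' := τ) (c := dt T 2 E x 0)
    (K := 2 * K * h ^ 2 + (2 * K + 3 * K ^ 3) * τ + 2 * K ^ 2 * ε + 2 * K ^ 2 * l)
    (by positivity) h0 ⟨hτ.le, hτT⟩ (hE.hasDeriv_zero hT xi) (hE.hasDeriv_one hab hT xi)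
    fun s hs => by
      rw [uIcc_of_le hτ.le] at hs
      refine (abs_dt_two_sub_init_le hab hT hK hE hsol hG hF hGl hh hx hx'
        ⟨hs.1, hs.2.trans hτT⟩).trans ?_
      gcongr
      exact hs.2
  rw [sub_zero] at key
  refine key.trans ?_
  have e : (2 * K * h ^ 2 + (2 * K + 3 * K ^ 3) * τ + 2 * K ^ 2 * ε + 2 * K ^ 2 * l) * τ ^ 2
      = τ * (2 * K * (τ * h ^ 2) + (2 * K + 3 * K ^ 3) * τ ^ 2 + 2 * K ^ 2 * (τ * ε)
        + 2 * K ^ 2 * (τ * l)) := by ring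
  rw [e]
  have m1 : τ * h ^ 2 ≤ h ^ 2 := mul_le_of_le_one_left (sq_nonneg h) hτ1
  have m2 : τ * ε ≤ ε := mul_le_of_le_one_left hε hτ1
  have m3 : 0 ≤ τ * l := by positivity
  have c1 : 2 * K ≤ consistencyConst K := by
    unfold consistencyConst; nlinarith [pow_nonneg hK 3, sq_nonneg K]
  have c2 : 2 * K + 3 * K ^ 3 ≤ consistencyConst K := by
    unfold consistencyConst; nlinarith [pow_nonneg hK 3, sq_nonneg K]
  have c3 : 2 * K ^ 2 ≤ consistencyConst K := by
    unfold consistencyConst; nlinarith [pow_nonneg hK 3, sq_nonneg K]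
  have c0 : 0 ≤ consistencyConst K := by linarith
  refine mul_le_mul_of_nonneg_left ?_ hτ.le
  calc _ ≤ consistencyConst K * h ^ 2 + consistencyConst K * τ ^ 2 + consistencyConst K * ε
        + consistencyConst K * (τ * l) := by gcongr
    _ = _ := by ring

/-- Differences in space of the Taylor remainder: only the Lipschitz continuity of `∂ₜₜE` in space
enters, so the factor is `τ ^ 2` in place of `τ`. -/
lemma abs_taylorError_sub_le {τ x y : ℝ} (hab : a < b) (hT : 0 < T) (hK : 0 ≤ K)
    (hE : IsRegular a b T K E) (hx : x ∈ Icc a b) (hy : y ∈ Icc a b)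
    (hτ : 0 < τ) (hτT : τ ≤ T) :
    |taylorError T τ E y - taylorError T τ E x| ≤ 2 * K * |y - x| * τ ^ 2 := by
  have h0 : (0 : ℝ) ∈ Icc 0 T := left_mem_Icc.2 hT.le
  have key := abs_taylor_le (t := 0) (t' := τ) (c := dt T 2 E y 0 - dt T 2 E x 0)
    (K := 2 * K * |y - x|) (by positivity) h0 ⟨hτ.le, hτT⟩
    (fun s hs => (hE.hasDeriv_zero hT hy s hs).sub (hE.hasDeriv_zero hT hx s hs))
    (fun s hs => (hE.hasDeriv_one hab hT hy s hs).sub (hE.hasDeriv_one hab hT hx s hs))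
    fun s hs => by
      rw [uIcc_of_le hτ.le] at hs
      have p1 := hE.dt_two_sub x hx y hy s ⟨hs.1, hs.2.trans hτT⟩
      have p2 := hE.dt_two_sub x hx y hy 0 h0
      rw [abs_le] at p1 p2 ⊢
      constructor <;> linarith [p1.1, p1.2, p2.1, p2.2]
  rw [sub_zero] at key
  refine (le_of_eq ?_).trans key
  congr 1
  simp only [taylorError, Pi.sub_apply]
  ring

end first

/-! ### The errors of the scheme satisfy the error system -/

/-- The perturbation of the nonlinear source at a grid point. -/
noncomputable def sourceError (a b τ : ℝ) (M : ℕ) (ρ : ℝ → ℝ) (B : ℝ) (E : ℝ → ℝ → ℝ)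
    (U : ℕ → ℕ → ℝ) (k j : ℕ) : ℝ :=
  rhoB ρ B (E (node a b M j) (k * τ)) - rhoB ρ B (U k j)

/-- Constant of the error system, from a bound `K` on the solution and a bound `D` on the
derivatives of `ρ_B`. -/
noncomputable def systemConst (K D : ℝ) : ℝ :=
  6 * K ^ 2 + K + K ^ 2 * D + 2 * D ^ 2 + 2 * D + 2 * D * K

lemma systemConst_bounds {K D : ℝ} (hK : 0 ≤ K) (hD : 0 ≤ D) :
    6 * K ^ 2 ≤ systemConst K D ∧ K + K ^ 2 * D ≤ systemConst K D ∧ 2 * D ^ 2 ≤ systemConst K D ∧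
      2 * D ≤ systemConst K D ∧ 2 * D * K ≤ systemConst K D := by
  have h1 : 0 ≤ K ^ 2 := sq_nonneg K
  have h2 : 0 ≤ K ^ 2 * D := by positivity
  have h3 : 0 ≤ 2 * D ^ 2 := by positivity
  have h4 : 0 ≤ 2 * D * K := by positivity
  unfold systemConst
  refine ⟨?_, ?_, ?_, ?_, ?_⟩ <;> linarith

section source

variable {ρ : ℝ → ℝ} {B D : ℝ}

lemma abs_rhoB_sub_le (hρ : IsCutoff ρ) (hD : ∀ s, |deriv (rhoB ρ B) s| ≤ D) (y z : ℝ) :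
    |rhoB ρ B y - rhoB ρ B z| ≤ 2 * D * |y - z| := by
  rw [rhoB_sub_eq hρ, abs_mul, abs_mul, abs_of_pos (by norm_num : (0 : ℝ) < 2)]
  gcongr
  exact abs_gB_le hD y z

/-- The reaction term of the error equation: `y, z, w` are exact values at the time levels
`k, k + 1, k - 1`, with the exact source `y²`, and `y', z', w', v` numerical ones. -/
lemma abs_reaction_sub_le (hρ : IsCutoff ρ) (hB : 0 < B) {K : ℝ} (hD0 : 0 ≤ D)
    (hD : ∀ s, |deriv (rhoB ρ B) s| ≤ D)
    (hD' : ∀ s r, |deriv (rhoB ρ B) s - deriv (rhoB ρ B) r| ≤ D * |s - r|)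
    {y z w y' z' w' v : ℝ} (hy : |y| < B) (hz : |z| < B) (hw : |w| < B) (hyK : |y| ≤ K) :
    |y ^ 2 * ((z + w) / 2) - (rhoB ρ B y' - v) * gB ρ B z' w'|
      ≤ K ^ 2 * D * (|z - z'| + |w - w'|) + 2 * D ^ 2 * |y - y'| + D * |v| := by
  have e : y ^ 2 * ((z + w) / 2) - (rhoB ρ B y' - v) * gB ρ B z' w'
      = y ^ 2 * (gB ρ B z w - gB ρ B z' w') + (rhoB ρ B y - rhoB ρ B y') * gB ρ B z' w'
        + v * gB ρ B z' w' := by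
    rw [gB_eq_avg hρ hB hz hw, rhoB_eq_sq hρ hB hy.le]; ring
  have g1 := abs_gB_sub_le hρ hD0 hD' z w z' w'
  have g2 := abs_gB_le hD z' w'
  have r1 := abs_rhoB_sub_le hρ hD y y'
  have y2 : y ^ 2 ≤ K ^ 2 := by rw [← sq_abs]; exact pow_le_pow_left₀ (abs_nonneg _) hyK 2
  rw [e]
  refine (abs_add_three _ _ _).trans ?_
  rw [abs_mul, abs_mul, abs_mul, abs_of_nonneg (sq_nonneg y)]
  calc _ ≤ K ^ 2 * (D * (|z - z'| + |w - w'|)) + 2 * D * |y - y'| * D + |v| * D := by gcongr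
    _ = _ := by ring

/-- Increments of the perturbation of the source: no bound on the numerical values is needed. -/
lemma abs_source_incr_le (hρ : IsCutoff ρ) {r : ℝ} (hD0 : 0 ≤ D)
    (hD : ∀ s, |deriv (rhoB ρ B) s| ≤ D)
    (hD' : ∀ s r, |deriv (rhoB ρ B) s - deriv (rhoB ρ B) r| ≤ D * |s - r|)
    {y z y' z' : ℝ} (hr : |z - y| ≤ r) :
    |(rhoB ρ B z - rhoB ρ B z') - (rhoB ρ B y - rhoB ρ B y')|
      ≤ 2 * D * |(z - z') - (y - y')| + 2 * D * r * (|y - y'| + |z - z'|) := by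
  have e : (rhoB ρ B z - rhoB ρ B z') - (rhoB ρ B y - rhoB ρ B y')
      = 2 * gB ρ B z' y' * ((z - z') - (y - y'))
        + 2 * (gB ρ B z y - gB ρ B z' y') * (z - y) := by
    have h1 := rhoB_sub_eq (B := B) hρ z y
    have h2 := rhoB_sub_eq (B := B) hρ z' y'
    linear_combination h1 - h2
  have g1 := abs_gB_sub_le hρ hD0 hD' z y z' y'
  have g2 := abs_gB_le hD z' y'
  rw [e]
  refine (abs_add_le _ _).trans ?_
  rw [abs_mul, abs_mul, abs_mul, abs_mul, abs_of_pos (by norm_num : (0 : ℝ) < 2)]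
  calc _ ≤ 2 * D * |(z - z') - (y - y')| + 2 * (D * (|z - z'| + |y - y'|)) * r := by gcongr
    _ = _ := by ring

end source

section system

variable {a b T α β ε τ K D B l : ℝ} {M n : ℕ} {ρ : ℝ → ℝ} {E₀ E₁ ω₀ ω₁ : ℝ → ℝ}
    {G E F : ℝ → ℝ → ℝ} {U V : ℕ → ℕ → ℝ}

/-- The residual of the Klein-Gordon part is the consistency error, plus reaction and potential
terms that are Lipschitz continuous in the errors. -/
lemma scheme_residual_E (hab : a < b)
    (hT : 0 < T)
    (hM : 1 ≤ M)
    (hρ : IsCutoff ρ)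
    (hB : 0 < B)
    (hD0 : 0 ≤ D)
    (hD : ∀ s, |deriv (rhoB ρ B) s| ≤ D)
    (hD' : ∀ s r, |deriv (rhoB ρ B) s - deriv (rhoB ρ B) r| ≤ D * |s - r|)
    (hG : IsC2 a b T G)
    (hsol : IsKGZSolution a b T ε E₀ E₁ G E F)
    (hE : IsRegular a b T K E)
    (hEB : ∀ x ∈ Icc a b, ∀ t ∈ Icc 0 T, |E x t| < B)
    (hF : ∀ x ∈ Icc a b, ∀ t ∈ Icc 0 T, |F x t| ≤ K * ε)
    (hGl : ∀ x ∈ Icc a b, ∀ t ∈ Icc 0 T, |G x t| ≤ K * l)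
    (hK : 0 ≤ K)
    (hε : 0 < ε)
    (hl : 0 ≤ l)
    (hl1 : l ≤ 1)
    (hτ : 0 < τ)
    (hn : n * τ ≤ T)
    (hS : IsCutoffScheme a b T α ε τ M ρ B E₀ E₁ ω₀ G U V)
    {k : ℕ} (hk : k + 2 ≤ n) {j : ℕ} (hj : j ∈ Finset.Ico 1 M) :
    |dtt τ (gridError a b τ M E U) (k + 1) j
        - dxx (mesh a b M) (avg (gridError a b τ M E U) (k + 1)) j
        + avg (gridError a b τ M E U) (k + 1) j|
      ≤ systemConst K D * (|gridError a b τ M E U (k + 2) j| + |gridError a b τ M E U (k + 1) j|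
          + |gridError a b τ M E U k j| + |-V (k + 1) j|)
        + consistencyConst K * (mesh a b M ^ 2 + τ ^ 2 + τ * l + ε) := by
  have hh := mesh_pos hab hM
  have time : ∀ k ≤ n, (k : ℝ) * τ ∈ Icc 0 T := fun k hk =>
    ⟨by positivity, le_trans (by gcongr) hn⟩
  have hj1 := (Finset.mem_Ico.1 hj).1
  have st := node_stencil hab hM hj
  have xi := node_mem hab hM (Finset.mem_Ico.1 hj).2.le
  set x := node a b M j with hx
  have tp := time (k + 2) hk
  have tc := time (k + 1) (by omega)
  have tm := time k (by omega)
  have ep : ((k + 2 : ℕ) : ℝ) * τ = ((k + 1 : ℕ) : ℝ) * τ + τ := by push_cast; ring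
  have em : (k : ℝ) * τ = ((k + 1 : ℕ) : ℝ) * τ - τ := by push_cast; ring
  have hkT : ((k + 1 + 1 : ℕ) : ℝ) ≤ T / τ := by
    rw [le_div_iff₀ hτ]; exact tp.2
  have sch := (hS.step (k + 1) (by omega) hkT j hj).1
  have con := consistency_E hab hT hK hE hsol hG hF hGl hh st.1 st.2 hτ
    (by rw [← em]; exact tm.1) (by rw [← ep]; exact tp.2) hε.le hl
  rw [← ep, ← em] at con
  have rea := abs_reaction_sub_le hρ hB hD0 hD hD' (y' := U (k + 1) j) (z' := U (k + 2) j)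
    (w' := U k j) (v := V (k + 1) j) (hEB x xi _ tc) (hEB x xi _ tp) (hEB x xi _ tm)
    (hE.bound x xi _ tc)
  have pot : |avgPotential τ G x (k + 1)| ≤ 2 * K := by
    refine (abs_timeAvg_le (K := K) fun s hs => ?_)
    refine (hGl x xi _ (add_mul_mem_Icc hτ (by rw [← em]; exact tm.1)
      (by rw [← ep]; exact tp.2) hs)).trans (mul_le_of_le_one_right hK hl1)
  have id : dtt τ (gridError a b τ M E U) (k + 1) j
        - dxx (mesh a b M) (avg (gridError a b τ M E U) (k + 1)) j
        + avg (gridError a b τ M E U) (k + 1) j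
      = ((E x ((k + 2 : ℕ) * τ) - 2 * E x ((k + 1 : ℕ) * τ) + E x (k * τ)) / τ ^ 2
        - ((spaceDiff (mesh a b M) E x ((k + 2 : ℕ) * τ) + spaceDiff (mesh a b M) E x (k * τ)) / 2
          - (E x ((k + 2 : ℕ) * τ) + E x (k * τ)) / 2
          - timeAvg τ (fun s => G x s) ((k + 1 : ℕ) * τ)
            * ((E x ((k + 2 : ℕ) * τ) + E x (k * τ)) / 2)
          + E x ((k + 1 : ℕ) * τ) ^ 2 * ((E x ((k + 2 : ℕ) * τ) + E x (k * τ)) / 2)))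
        + (E x ((k + 1 : ℕ) * τ) ^ 2 * ((E x ((k + 2 : ℕ) * τ) + E x (k * τ)) / 2)
          - (rhoB ρ B (U (k + 1) j) - V (k + 1) j) * gB ρ B (U (k + 2) j) (U k j))
        - avgPotential τ G x (k + 1)
          * ((gridError a b τ M E U (k + 2) j + gridError a b τ M E U k j) / 2) := by
    have hav : timeAvg τ (fun s => G x s) ((k + 1 : ℕ) * τ) = avgPotential τ G x (k + 1) := rfl
    rw [hav]
    simp only [dtt, dxx, avg, spaceDiff, gridError, node_succ, node_pred hj1, Nat.add_sub_cancel,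
      ← hx] at sch ⊢
    linear_combination -sch
  obtain ⟨-, c1, c2, c3, -⟩ := systemConst_bounds hK hD0
  have pe : |avgPotential τ G x (k + 1)
        * ((gridError a b τ M E U (k + 2) j + gridError a b τ M E U k j) / 2)|
      ≤ 2 * K * ((|gridError a b τ M E U (k + 2) j| + |gridError a b τ M E U k j|) / 2) := by
    rw [abs_mul, abs_div, abs_of_pos (by norm_num : (0 : ℝ) < 2)]
    gcongr
    exact abs_add_le _ _
  rw [id, abs_neg]
  refine (abs_sub _ _).trans ((add_le_add (abs_add_le _ _) le_rfl).trans
    ((add_le_add (add_le_add con rea) pe).trans ?_))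
  have n1 := mul_le_mul_of_nonneg_right c1 (abs_nonneg (gridError a b τ M E U (k + 2) j))
  have n2 := mul_le_mul_of_nonneg_right c1 (abs_nonneg (gridError a b τ M E U k j))
  have n3 := mul_le_mul_of_nonneg_right c2 (abs_nonneg (gridError a b τ M E U (k + 1) j))
  have n4 := mul_le_mul_of_nonneg_right c3 (abs_nonneg (V (k + 1) j))
  have n5 := mul_nonneg hD0 (abs_nonneg (V (k + 1) j))
  simp only [gridError, ← hx] at n1 n2 n3 ⊢
  linarith

/-- Since `F` is compared with `0`, the residual of the wave part is the second difference of
`-E²`, which is merely bounded. -/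
lemma scheme_residual_F (hab : a < b)
    (hT : 0 < T)
    (hM : 1 ≤ M)
    (hρ : IsCutoff ρ)
    (hB : 0 < B)
    (hD0 : 0 ≤ D)
    (hE : IsRegular a b T K E)
    (hEB : ∀ x ∈ Icc a b, ∀ t ∈ Icc 0 T, |E x t| < B)
    (hK : 0 ≤ K)
    (hτ : 0 < τ)
    (hn : n * τ ≤ T)
    (hS : IsCutoffScheme a b T α ε τ M ρ B E₀ E₁ ω₀ G U V)
    {k : ℕ} (hk : k + 2 ≤ n) {j : ℕ} (hj : j ∈ Finset.Ico 1 M) :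
    |dtt τ (fun k j => -V k j - sourceError a b τ M ρ B E U k j) (k + 1) j
        - 1 / ε ^ 2 * dxx (mesh a b M) (avg (fun k j => -V k j) (k + 1)) j| ≤ systemConst K D := by
  have time : ∀ k ≤ n, (k : ℝ) * τ ∈ Icc 0 T := fun k hk =>
    ⟨by positivity, le_trans (by gcongr) hn⟩
  have xi := node_mem hab hM (Finset.mem_Ico.1 hj).2.le
  set x := node a b M j with hx
  have tp := time (k + 2) hk
  have tc := time (k + 1) (by omega)
  have tm := time k (by omega)
  have ep : ((k + 2 : ℕ) : ℝ) * τ = ((k + 1 : ℕ) : ℝ) * τ + τ := by push_cast; ring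
  have em : (k : ℝ) * τ = ((k + 1 : ℕ) : ℝ) * τ - τ := by push_cast; ring
  have hkT : ((k + 1 + 1 : ℕ) : ℝ) ≤ T / τ := by
    rw [le_div_iff₀ hτ]; exact tp.2
  have sch := (hS.step (k + 1) (by omega) hkT j hj).2
  have av := abs_avg_sub_le (hE.hasDeriv_zero hT xi) (hE.hasDeriv_one hab hT xi) hK
    (hE.dt_two x xi) hτ (by rw [← em]; exact tm.1) (by rw [← ep]; exact tp.2)
  rw [← ep, ← em] at av
  have lp := hE.abs_sub_le hT xi tp tc
  have lm := hE.abs_sub_le hT xi tm tc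
  have e1 : |((k + 2 : ℕ) : ℝ) * τ - (k + 1 : ℕ) * τ| = τ := by
    rw [ep, add_sub_cancel_left, abs_of_pos hτ]
  have e2 : |(k : ℝ) * τ - (k + 1 : ℕ) * τ| = τ := by
    rw [em, sub_sub_cancel_left, abs_neg, abs_of_pos hτ]
  rw [e1] at lp
  rw [e2] at lm
  have id : dtt τ (fun k j => -V k j - sourceError a b τ M ρ B E U k j) (k + 1) j
        - 1 / ε ^ 2 * dxx (mesh a b M) (avg (fun k j => -V k j) (k + 1)) j
      = -((E x ((k + 2 : ℕ) * τ) - E x ((k + 1 : ℕ) * τ)) ^ 2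
        + (E x (k * τ) - E x ((k + 1 : ℕ) * τ)) ^ 2
        + 4 * E x ((k + 1 : ℕ) * τ)
          * ((E x ((k + 2 : ℕ) * τ) + E x (k * τ)) / 2 - E x ((k + 1 : ℕ) * τ))) / τ ^ 2 := by
    simp only [dtt, dxx, avg, sourceError, Nat.add_sub_cancel, ← hx,
      rhoB_eq_sq hρ hB (hEB x xi _ tp).le, rhoB_eq_sq hρ hB (hEB x xi _ tc).le,
      rhoB_eq_sq hρ hB (hEB x xi _ tm).le] at sch ⊢
    linear_combination -sch
  have s1 : (E x ((k + 2 : ℕ) * τ) - E x ((k + 1 : ℕ) * τ)) ^ 2 ≤ (K * τ) ^ 2 := by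
    rw [← sq_abs]; exact pow_le_pow_left₀ (abs_nonneg _) lp 2
  have s2 : (E x (k * τ) - E x ((k + 1 : ℕ) * τ)) ^ 2 ≤ (K * τ) ^ 2 := by
    rw [← sq_abs]; exact pow_le_pow_left₀ (abs_nonneg _) lm 2
  have bd := hE.bound x xi _ tc
  rw [id, abs_div, abs_neg, abs_of_pos (by positivity : 0 < τ ^ 2), div_le_iff₀ (by positivity)]
  refine (abs_add_three _ _ _).trans ?_
  rw [abs_of_nonneg (sq_nonneg _), abs_of_nonneg (sq_nonneg _), abs_mul, abs_mul,
    abs_of_pos (by norm_num : (0 : ℝ) < 4)]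
  have c := (systemConst_bounds hK hD0).1
  calc _ ≤ (K * τ) ^ 2 + (K * τ) ^ 2 + 4 * K * (K * τ ^ 2) := by gcongr
    _ = 6 * K ^ 2 * τ ^ 2 := by ring
    _ ≤ _ := by gcongr

/-- The errors form an error system in which `f` is the error of the approximation of `0`, and not
of `F`. -/
theorem isErrorSystem (hab : a < b) (hT : 0 < T) (hM : 1 ≤ M)
    (hρ : IsCutoff ρ) (hB : 0 < B) (hD0 : 0 ≤ D) (hD : ∀ s, |deriv (rhoB ρ B) s| ≤ D)
    (hD' : ∀ s r, |deriv (rhoB ρ B) s - deriv (rhoB ρ B) r| ≤ D * |s - r|)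
    (hG : IsWaveSolution a b T α β ε ω₀ ω₁ G) (hsol : IsKGZSolution a b T ε E₀ E₁ G E F)
    (hE : IsRegular a b T K E) (hEB : ∀ x ∈ Icc a b, ∀ t ∈ Icc 0 T, |E x t| < B)
    (hF : ∀ x ∈ Icc a b, ∀ t ∈ Icc 0 T, |F x t| ≤ K * ε)
    (hGl : ∀ x ∈ Icc a b, ∀ t ∈ Icc 0 T, |G x t| ≤ K * l)
    (hK : 0 ≤ K) (hε : 0 < ε) (hl : 0 ≤ l) (hl1 : l ≤ 1) (hτ : 0 < τ) (hτ1 : τ ≤ 1)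
    (hn : n * τ ≤ T) (hS : IsCutoffScheme a b T α ε τ M ρ B E₀ E₁ ω₀ G U V) :
    IsErrorSystem (mesh a b M) M τ ε (systemConst K D)
      ((consistencyConst K + 1) * (mesh a b M ^ 2 + τ ^ 2 + τ * l + ε)) n
      (gridError a b τ M E U) (fun k j => -V k j) (sourceError a b τ M ρ B E U) := by
  have hh := mesh_pos hab hM
  have time : ∀ k ≤ n, (k : ℝ) * τ ∈ Icc 0 T := fun k hk =>
    ⟨by positivity, le_trans (by gcongr) hn⟩
  have hS0 : 0 ≤ mesh a b M ^ 2 + τ ^ 2 + τ * l + ε := by positivity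
  have K3 := pow_nonneg hK 3
  have hC0 : 0 ≤ consistencyConst K := by unfold consistencyConst; positivity
  have t0 : (0 : ℝ) ∈ Icc 0 T := left_mem_Icc.2 hT.le
  -- at the boundary nodes all time derivatives of `E` vanish
  have bdry : ∀ x, x = a ∨ x = b → x ∈ Icc a b ∧ ∀ t ∈ Icc 0 T, E x t = 0 := by
    rintro x (rfl | rfl)
    · exact ⟨left_mem_Icc.2 hab.le, fun t ht => (hsol.boundary_E t ht).1⟩
    · exact ⟨right_mem_Icc.2 hab.le, fun t ht => (hsol.boundary_E t ht).2⟩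
  have firstE : 1 ≤ n → ∀ j ≤ M, gridError a b τ M E U 1 j = taylorError T τ E (node a b M j) := by
    intro hn1 j hj
    have hτT : τ ∈ Icc 0 T := by simpa using time 1 hn1
    have ends : U 1 j = 0 → (node a b M j = a ∨ node a b M j = b) →
        gridError a b τ M E U 1 j = taylorError T τ E (node a b M j) := by
      intro hU hx
      obtain ⟨hx, hz⟩ := bdry _ hx
      obtain ⟨d1, d2⟩ := hE.isC2.dt_eq_zero hab hT hx hz t0
      simp only [gridError, taylorError, hU, d1, d2, hz 0 t0, Nat.cast_one, one_mul]
      ring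
    rcases Nat.eq_zero_or_pos j with rfl | hj0
    · exact ends (hS.boundary 1).1 (Or.inl node_zero)
    rcases hj.eq_or_lt with rfl | hjM
    · exact ends (hS.boundary 1).2.1 (Or.inr (node_last hM))
    have hj' : j ∈ Finset.Ico 1 M := Finset.mem_Ico.2 ⟨hj0, hjM⟩
    have st := node_stencil hab hM hj'
    have xi := node_mem hab hM hj
    rw [gridError, taylorError, (hS.first j hj').1,
      hsol.initDttE_eq hab hT hG ⟨by linarith, by linarith⟩, hsol.init_E _ xi, hsol.init_dt_E _ xi,
      Nat.cast_one, one_mul]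
  refine ⟨fun k hk => ?_, fun k hk => ?_, fun k hk j hj => ?_, fun k hk j hj => ?_,
    fun k hk j hj => ?_, fun k hk j hj => ?_, fun j hj => ?_, fun h1 j hj => ?_,
    fun h1 j hj => ?_, fun h1 j hj => ?_⟩
  · have := hsol.boundary_E _ (time k hk)
    simp [gridError, node_zero, node_last hM, this.1, this.2, hS.boundary k]
  · simp [hS.boundary k]
  · refine (scheme_residual_E hab hT hM hρ hB hD0 hD hD' hG.regular hsol hE hEB hF hGl hK hε hl hl1
      hτ hn hS hk hj).trans ?_
    gcongr
    linarith
  · exact scheme_residual_F hab hT hM hρ hB hD0 hE hEB hK hτ hn hS hk hj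
  · rw [sourceError, gridError]
    refine (abs_rhoB_sub_le hρ hD _ _).trans ?_
    gcongr
    exact (systemConst_bounds hK hD0).2.2.2.1
  · have xi := node_mem hab hM (Finset.mem_Ico.1 hj).2.le
    have lip := hE.abs_sub_le hT xi (time (k + 1) hk) (time k (by omega))
    have e : |((k + 1 : ℕ) : ℝ) * τ - k * τ| = τ := by
      rw [← sub_mul]; push_cast; rw [add_sub_cancel_left, one_mul, abs_of_pos hτ]
    rw [e] at lip
    refine (abs_source_incr_le hρ hD0 hD hD' lip).trans ?_
    obtain ⟨-, -, -, c1, c2⟩ := systemConst_bounds hK hD0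
    unfold gridError
    rw [mul_add (systemConst K D), ← mul_assoc (2 * D), ← mul_assoc (systemConst K D) τ]
    gcongr
  · have xi := node_mem hab hM hj
    simp [gridError, hS.init j hj, hsol.init_E _ xi]
  · have hτT : τ ∈ Icc 0 T := by simpa using time 1 h1
    have st := node_stencil hab hM hj
    rw [firstE h1 j (Finset.mem_Ico.1 hj).2.le]
    refine (abs_taylorError_le hab hT hK hE hsol hG.regular hF hGl hh st.1 st.2 hτ hτ1 hτT.2
      hε.le hl).trans ?_
    gcongr
    linarith
  · have hτT : τ ∈ Icc 0 T := by simpa using time 1 h1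
    have key := abs_taylorError_sub_le hab hT hK hE (node_mem hab hM hj.le)
      (node_mem hab hM (j := j + 1) hj) hτ hτT.2
    rw [dxPlus, firstE h1 _ hj.le, firstE h1 _ hj, abs_div, abs_of_pos hh, div_le_iff₀ hh]
    rw [node_succ, add_sub_cancel_left, abs_of_pos hh, ← node_succ] at key
    refine key.trans ?_
    rw [mul_right_comm]
    refine mul_le_mul_of_nonneg_right ?_ hh.le
    have h2 : 2 * K ≤ consistencyConst K + 1 := by
      unfold consistencyConst; nlinarith [sq_nonneg K]
    have h3 : τ ^ 2 ≤ mesh a b M ^ 2 + τ ^ 2 + τ * l + ε := by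
      have : 0 ≤ τ * l := by positivity
      nlinarith [sq_nonneg (mesh a b M)]
    exact mul_le_mul h2 h3 (sq_nonneg τ) (by linarith)
  · have st := node_stencil hab hM hj
    have xi := node_mem hab hM (Finset.mem_Ico.1 hj).2.le
    have b0 := hE.bound _ xi 0 t0
    have b1 := hE.dt_one _ xi 0 t0
    have b2 := hE.dt_two _ xi 0 t0
    rw [abs_neg, (hS.first j hj).2, initDttF,
      hsol.initDttE_eq hab hT hG ⟨by linarith, by linarith⟩, ← hsol.init_E _ xi,
      ← hsol.init_dt_E _ xi, abs_mul, abs_of_nonneg (by positivity : 0 ≤ τ ^ 2 / 2)]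
    have q : |2 * dt T 1 E (node a b M j) 0 ^ 2
        + 2 * E (node a b M j) 0 * dt T 2 E (node a b M j) 0| ≤ 2 * K ^ 2 + 2 * K * K := by
      refine (abs_add_le _ _).trans ?_
      rw [abs_mul, abs_mul, abs_mul, abs_pow, abs_of_pos (by norm_num : (0 : ℝ) < 2)]
      gcongr
    have c := (systemConst_bounds hK hD0).1
    calc _ ≤ τ ^ 2 / 2 * (2 * K ^ 2 + 2 * K * K) := by gcongr
      _ = 2 * K ^ 2 * τ ^ 2 := by ring
      _ ≤ _ := by gcongr; linarith [sq_nonneg K]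

end system

/-! ### Existence and convergence -/

section convergence

lemma gridNorm_eq (h : ℝ) (M : ℕ) (v : ℕ → ℝ) : gridNorm h M v = √(sqNorm h M v) := by
  simp only [gridNorm, sqNorm, sq_abs]

lemma gridGradNorm_eq (h : ℝ) (M : ℕ) (v : ℕ → ℝ) :
    gridGradNorm h M v = √(cellSq h M (dxPlus h v)) := by
  simp only [gridGradNorm, cellSq, sq_abs]

lemma sqNorm_add_le {h : ℝ} (hh : 0 ≤ h) (M : ℕ) (u v : ℕ → ℝ) :
    sqNorm h M (fun j => u j + v j) ≤ 2 * sqNorm h M u + 2 * sqNorm h M v := by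
  unfold sqNorm
  have : ∑ j ∈ Finset.Ico 1 M, (u j + v j) ^ 2
      ≤ 2 * ∑ j ∈ Finset.Ico 1 M, u j ^ 2 + 2 * ∑ j ∈ Finset.Ico 1 M, v j ^ 2 := by
    rw [Finset.mul_sum, Finset.mul_sum, ← Finset.sum_add_distrib]
    exact Finset.sum_le_sum fun j _ => by nlinarith [sq_nonneg (u j - v j)]
  nlinarith [mul_le_mul_of_nonneg_left this hh]

variable {a b T α β ε τ K : ℝ} {M : ℕ} {G : ℝ → ℝ → ℝ}

/-- The implicit operator of the scheme is positive when the time step is small compared with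
the potential. -/
lemma implicit_coeff_pos (hab : a < b) (hM : 1 ≤ M) (hτ : 0 < τ) (hK : 0 ≤ K)
    (hτK : τ * (K + 1) ≤ 1) (hG : ∀ x ∈ Icc a b, ∀ t ∈ Icc 0 T, |G x t| ≤ K)
    {k : ℕ} (hk : 1 ≤ k) (hkT : ((k + 1 : ℕ) : ℝ) ≤ T / τ) {j : ℕ} (hj : j ∈ Finset.Ico 1 M) :
    0 < 1 / τ ^ 2 + (1 + avgPotential τ G (node a b M j) k) / 2 := by
  have xi := node_mem hab hM (Finset.mem_Ico.1 hj).2.le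
  rw [le_div_iff₀ hτ] at hkT
  have hk' : (1 : ℝ) ≤ k := by exact_mod_cast hk
  push_cast at hkT
  have pot : |avgPotential τ G (node a b M j) k| ≤ 2 * K := by
    refine abs_timeAvg_le (K := K) fun s hs =>
      hG _ xi _ (add_mul_mem_Icc hτ (by nlinarith) (by linarith) hs)
  have hτ1 : τ ≤ 1 := by nlinarith
  have h1 : K + 1 ≤ 1 / τ ^ 2 := by
    rw [le_div_iff₀ (by positivity)]
    nlinarith [mul_nonneg hτ.le hK]
  linarith [(abs_le.1 pot).1]

end convergence

end KGZ

theorem theorem3 (a b T α β : ℝ) (hab : a < b) (hT : 0 < T) (hα : 0 ≤ α) (hβ : -1 ≤ β)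
    (E₀ E₁ ω₀ ω₁ : ℝ → ℝ) (ρ : ℝ → ℝ) (hρ : IsCutoff ρ)
    (G E F E' : ℝ → ℝ → ℝ → ℝ)
    (hG : ∀ ε ∈ Set.Ioc (0 : ℝ) 1, IsWaveSolution a b T α β ε ω₀ ω₁ (G ε))
    (hEF : ∀ ε ∈ Set.Ioc (0 : ℝ) 1, IsKGZSolution a b T ε E₀ E₁ (G ε) (E ε) (F ε))
    (hE' : ∀ ε ∈ Set.Ioc (0 : ℝ) 1, IsKGOPSolution a b T E₀ E₁ (G ε) (E' ε))
    (hA : AssumptionA a b T α β E F E')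
    (hB : AssumptionB a b E₀ E₁ ω₀ ω₁) :
    ∃ τ₂ > (0 : ℝ), ∃ C > (0 : ℝ),
      ∀ ε ∈ Set.Ioc (0 : ℝ) 1, ∀ τ ∈ Set.Ioc (0 : ℝ) τ₂,
      ∀ M : ℕ, 1 ≤ M → mesh a b M ≤ 1 / 2 →
        (∃ U V : ℕ → ℕ → ℝ,
          IsCutoffScheme a b T α ε τ M ρ (supBound a b T E E' + 1) E₀ E₁ ω₀ (G ε) U V) ∧
        ∀ U V : ℕ → ℕ → ℝ,
          IsCutoffScheme a b T α ε τ M ρ (supBound a b T E E' + 1) E₀ E₁ ω₀ (G ε) U V →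
          ∀ k : ℕ, (k : ℝ) ≤ T / τ →
            gridNorm (mesh a b M) M (gridError a b τ M (E ε) U k)
              + gridGradNorm (mesh a b M) M (gridError a b τ M (E ε) U k)
              + gridNorm (mesh a b M) M (gridError a b τ M (F ε) V k)
            ≤ C * (mesh a b M ^ 2 + τ ^ 2 + τ * ε ^ alphaStar α β + ε) := by
  obtain ⟨K₀, hK₀, hreg⟩ := exists_regular_bounds hab hT (fun ε hε => (hEF ε hε).regular_E)
    (fun ε hε => (hEF ε hε).regular_F) (fun ε hε => (hE' ε hε).regular) hA
  obtain ⟨K₁, hK₁, hwave⟩ := exists_wave_bound hab hT hG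
  set K := max K₀ K₁
  have hK : 0 ≤ K := hK₀.trans (le_max_left _ _)
  set B := supBound a b T E E' + 1
  have hEB : ∀ ε ∈ Set.Ioc (0 : ℝ) 1, ∀ x ∈ Set.Icc a b, ∀ t ∈ Set.Icc 0 T, |E ε x t| < B :=
    fun ε hε x hx t ht => (abs_le_supBound hab
      (fun ε hε x hx t ht => ⟨(hreg ε hε).1.bound x hx t ht, ((hreg ε hε).2 x hx t ht).2⟩) hε
      (hEF ε hε).boundary_E hx ht).trans_lt (lt_add_one _)
  have ta : a ∈ Set.Icc a b := Set.left_mem_Icc.2 hab.le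
  have t0 : (0 : ℝ) ∈ Set.Icc 0 T := Set.left_mem_Icc.2 hT.le
  have hB0 : 0 < B := (abs_nonneg _).trans_lt (hEB 1 (by norm_num) a ta 0 t0)
  obtain ⟨D, hD0, -, hD, hD'⟩ := exists_rhoB_bound hρ hB0
  have hℓ : 0 ≤ b - a := by linarith
  have K3 := pow_nonneg hK 3
  have hL : 0 ≤ systemConst K D := by unfold systemConst; positivity
  have hC0 : 0 ≤ consistencyConst K := by unfold consistencyConst; positivity
  have hI : 0 ≤ initConst (systemConst K D) (b - a) := by unfold initConst; positivity
  set Λ := growthConst (systemConst K D) (b - a)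
  have hΛ : 1 ≤ Λ := growthConst_ge_one hL hℓ
  set c := (12 + 4 * systemConst K D ^ 2)
    * (Real.exp (4 * Λ * T) * (initConst (systemConst K D) (b - a) + 1))
  have hc : 0 ≤ c := by positivity
  set Q := 2 * ((b - a) * K ^ 2) + 2 * c
  refine ⟨min (1 / (2 * Λ)) (1 / (K + 1)), by positivity,
    3 * (√Q * (consistencyConst K + 1)) + 1, by positivity, fun ε hε τ hτ M hM _ => ?_⟩
  obtain ⟨hτ, hτ2⟩ := hτ
  have hτΛ : τ * Λ ≤ 1 / 2 := by
    have := (le_div_iff₀ (by positivity)).1 (hτ2.trans (min_le_left _ _))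
    linarith
  have hτK : τ * (K + 1) ≤ 1 :=
    (le_div_iff₀ (by positivity)).1 (hτ2.trans (min_le_right _ _))
  have hτ1 : τ ≤ 1 := by nlinarith
  have hl : 0 ≤ ε ^ alphaStar α β := Real.rpow_nonneg hε.1.le _
  have hl1 : ε ^ alphaStar α β ≤ 1 :=
    Real.rpow_le_one hε.1.le hε.2 (le_min hα (by linarith))
  have hE := (hreg ε hε).1.mono (le_max_left K₀ K₁)
  have hF : ∀ x ∈ Set.Icc a b, ∀ t ∈ Set.Icc 0 T, |F ε x t| ≤ K * ε := fun x hx t ht =>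
    ((hreg ε hε).2 x hx t ht).1.trans
      (mul_le_mul_of_nonneg_right (le_max_left _ _) hε.1.le)
  have hGl : ∀ x ∈ Set.Icc a b, ∀ t ∈ Set.Icc 0 T, |G ε x t| ≤ K * ε ^ alphaStar α β :=
    fun x hx t ht => (hwave ε hε x hx t ht).trans
      (mul_le_mul_of_nonneg_right (le_max_right _ _) hl)
  have hG1 : ∀ x ∈ Set.Icc a b, ∀ t ∈ Set.Icc 0 T, |G ε x t| ≤ K := fun x hx t ht =>
    (hGl x hx t ht).trans (mul_le_of_le_one_right hK hl1)
  constructor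
  · refine exists_cutoffScheme hab hM hτ (continuous_gB_left hρ hD0 hD') (abs_gB_le hD) ?_ ?_
      fun k hk hkT j hj => implicit_coeff_pos hab hM hτ hK hτK hG1 hk hkT hj
    · rw [← (hEF ε hε).init_E a ta, ((hEF ε hε).boundary_E 0 t0).1]
    · rw [← (hEF ε hε).init_E b (Set.right_mem_Icc.2 hab.le), ((hEF ε hε).boundary_E 0 t0).2]
  · intro U V hS k hk
    have hh := mesh_pos hab hM
    set S := mesh a b M ^ 2 + τ ^ 2 + τ * ε ^ alphaStar α β + ε
    have hτl : 0 ≤ τ * ε ^ alphaStar α β := by positivity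
    have hS0 : 0 ≤ S := by have := hε.1; positivity
    have hSR : S ≤ (consistencyConst K + 1) * S := by nlinarith
    set R := (consistencyConst K + 1) * S with hR
    have hn : ((⌊T / τ⌋₊ : ℕ) : ℝ) * τ ≤ T :=
      (le_div_iff₀ hτ).1 (Nat.floor_le (by positivity))
    have hεR : ε ≤ R := le_trans (by nlinarith [sq_nonneg (mesh a b M), sq_nonneg τ]) hSR
    have hτR : τ ^ 2 ≤ R := le_trans (by nlinarith [sq_nonneg (mesh a b M), hε.1]) hSR
    have hR0 : 0 ≤ R := hε.1.le.trans hεR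
    have H := isErrorSystem hab hT hM hρ hB0 hD0 hD hD' (hG ε hε) (hEF ε hε) hE (hEB ε hε) hF hGl
      hK hε.1 hl hl1 hτ hτ1 hn hS
    have bd := H.bound hh hM hτ hτ1 hL hε.1 hε.2 hεR hτR
      (by rw [natCast_mul_mesh hM]; exact hτΛ) hn k ((Nat.le_floor_iff (by positivity)).2 hk)
    rw [natCast_mul_mesh hM] at bd
    have n1 := sqNorm_nonneg hh.le M (gridError a b τ M (E ε) U k)
    have n2 := cellSq_nonneg hh.le M (dxPlus (mesh a b M) (gridError a b τ M (E ε) U k))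
    have n3 := sqNorm_nonneg hh.le M fun j => -V k j
    have hkT : (k : ℝ) * τ ≤ T := (le_div_iff₀ hτ).1 hk
    -- the scheme approximates `0` in place of `F`, at the cost of an error of size `ε`
    have nF : sqNorm (mesh a b M) M (gridError a b τ M (F ε) V k) ≤ Q * R ^ 2 := by
      have h1 : sqNorm (mesh a b M) M (fun j => F ε (node a b M j) (k * τ))
          ≤ M * mesh a b M * (K * ε) ^ 2 :=
        sqNorm_le_of_abs_le hh.le fun j hj =>
          hF _ (node_mem hab hM (Finset.mem_Ico.1 hj).2.le) _ ⟨by positivity, hkT⟩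
      rw [natCast_mul_mesh hM] at h1
      have h2 := sqNorm_add_le hh.le M (fun j => F ε (node a b M j) (k * τ)) fun j => -V k j
      have h3 : (b - a) * (K * ε) ^ 2 ≤ (b - a) * K ^ 2 * R ^ 2 := by
        rw [mul_pow, ← mul_assoc]
        have := hε.1.le
        gcongr
      simp only [← sub_eq_add_neg] at h2
      calc _ ≤ _ := h2
        _ ≤ 2 * ((b - a) * K ^ 2 * R ^ 2) + 2 * (c * R ^ 2) := by linarith
        _ = _ := by ring
    have cQ : c * R ^ 2 ≤ Q * R ^ 2 := by
      have : c ≤ Q := by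
        have : 0 ≤ (b - a) * K ^ 2 := by positivity
        linarith
      gcongr
    have root : ∀ {s : ℝ}, s ≤ Q * R ^ 2 → √s ≤ √Q * R := fun hs => by
      refine (Real.sqrt_le_sqrt hs).trans (le_of_eq ?_)
      rw [Real.sqrt_mul (by positivity), Real.sqrt_sq hR0]
    rw [gridNorm_eq, gridNorm_eq, gridGradNorm_eq]
    have r1 := root (s := sqNorm (mesh a b M) M (gridError a b τ M (E ε) U k)) (by linarith)
    have r2 := root (s := cellSq (mesh a b M) M
      (dxPlus (mesh a b M) (gridError a b τ M (E ε) U k))) (by linarith)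
    have r3 := root nF
    calc _ ≤ 3 * (√Q * R) := by linarith
      _ ≤ _ := by rw [hR]; linarith
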